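/- Let $n\ge 3$, $\chi=8(n-1)$, and let $M=SO(2n)/U(n)$, where $U(n)\subset SO(2n)$ is the subgroup of block matrices $(C,D)=\begin{pmatrix}C&D\\-D&C\end{pmatrix}$, corresponding to $C+iD$. Write $\mathfrak{so}(2n)=\mathfrak h\oplus\mathfrak m$, where $\mathfrak h=\mathfrak u(n)$ and $\mathfrak m$ consists of the matrices $(A,B)=\begin{pmatrix}A&B\\B&-A\end{pmatrix}$ with $A,B$ skew. Give $M$ the invariant metric $g$ that is minus the Cartan–Killing form on $\mathfrak m\simeq T_{U(n)}M$, with Levi-Civita connection $\nabla$ and curvature $R$, and put $\mathrm{ad}^2(X)=-R(\cdot,X)X$. A frame at a point is a representative $f\in SO(2n)$ of it; it gives the linear coframe $e\rfloor:TM\to\mathfrak m$. Let $\mathsf e=\frac1{\sqrt\chi}(E_1,0)\in\mathfrak m$, where $E_1$ is the $n\times n$ skew matrix whose only non-zero entries are $(E_1)_{12}=1=-(E_1)_{21}$; let $\mathfrak h_\parallel\simeq\mathfrak{su}(2)\oplus\mathfrak u(n-2)$ be the centralizer of $\mathsf e$ in $\mathfrak h$ (with $\mathfrak{su}(2)$ in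 the upper left $2\times2$ block of $C+iD$), $\mathfrak m_\parallel$ its centralizer in $\mathfrak m$, and $\mathfrak h_\perp,\mathfrak m_\perp$ the orthogonal complements. Elements of $\mathfrak m_\perp$ are written $(r,(v_1,v_2))$ with $r\in\mathbb R$ and $v_1,v_2\in\mathbb C^{n-2}$: for $(A,B)\in\mathfrak m_\perp$, $(A+iB)_{12}=ir$, and $v_1,v_2$ are the first two rows of $A+iB$ in the last $n-2$ columns. A $U(n)$-parallel frame along a smooth curve in $M$ is a smooth frame $f(x)$ in which the tangent vector has component $\mathsf e$ and the $\mathfrak h$-part $u$ of $f^{-1}f_x$ lies in $\mathfrak h_\perp$; its Hasimoto variables $(r,(v_1,v_2))\in\mathfrak m_\perp$ are defined by $u=\sqrt\chi\,\mathrm{ad}(\mathsf e)(r,(v_1,v_2))$. Let $\mathrm J=\begin{pmatrix}ia&b\\-\bar b&-ia\end{pmatrix}\in\mathfrak{su}(2)$ with $a\in\mathbb R$, $b\in\mathbb C$, $a^2+|b|^2=1$. For a curve with a $U(n)$-parallel frame define linear maps of $T_\gamma M$ by $e\rfloor J_\gamma(Z)=-\mathrm{ad}(\mathrm J)(e\rfloor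 Z)$, and $i_\gamma,j_\gamma,k_\gamma$ in the same way with $i\sigma_3,i\sigma_2,i\sigma_1$ instead of $\mathrm J$, where $\sigma_1=\begin{pmatrix}0&1\\1&0\end{pmatrix}$, $\sigma_2=\begin{pmatrix}0&i\\-i&0\end{pmatrix}$, $\sigma_3=\begin{pmatrix}1&0\\0&-1\end{pmatrix}$. Let $t,x$ range over open intervals. All maps are smooth, and flows are considered together with a smooth family, in $(t,x)$, of $U(n)$-parallel frames along the curves $\gamma(t,\cdot)$. **1. Quaternionic structure.** Let $\gamma$ be a curve with a $U(n)$-parallel frame. Then $|\gamma_x|_g=1$. Let $(T_\gamma M)_\parallel$ be the null space of $\mathrm{ad}^2(\gamma_x)$ in $T_\gamma M$ and $(T_\gamma M)_\perp$ its orthogonal complement. Then $T_\gamma M=(T_\gamma M)_\parallel\oplus(T_\gamma M)_\perp$, and $(T_\gamma M)_\perp$ is the orthogonal sum of $(T_\gamma M)_\perp^{\mathbb C}$ and $(T_\gamma M)_\perp^{\mathbb R}$, its images under $-\frac{\chi^2}{3}\big(\frac4\chi+\mathrm{ad}^2(\gamma_x)\big)\mathrm{ad}^2(\gamma_x)$ and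 $\frac{\chi^2}{12}\big(\frac1\chi+\mathrm{ad}^2(\gamma_x)\big)\mathrm{ad}^2(\gamma_x)$, which have real dimensions $4(n-2)$ and $1$ and on which $\mathrm{ad}^2(\gamma_x)$ is $-\frac1\chi$ and $-\frac4\chi$, respectively. The maps $i_\gamma,j_\gamma,k_\gamma$ depend smoothly on $x$ (as do all maps that correspond to a fixed $2\times2$ matrix), commute with $\mathrm{ad}^2(\gamma_x)$, vanish on $(T_\gamma M)_\parallel$ and $(T_\gamma M)_\perp^{\mathbb R}$, preserve $(T_\gamma M)_\perp^{\mathbb C}$, and satisfy there $$-i_\gamma^2=-j_\gamma^2=-k_\gamma^2=\mathrm{id},\qquad i_\gamma j_\gamma=k_\gamma,\quad j_\gamma k_\gamma=i_\gamma,\quad k_\gamma i_\gamma=j_\gamma ,$$ so that they define a degenerate almost quaternionic structure along the curve. Moreover $J_\gamma=a\,i_\gamma-(\mathrm{Re}\,b)\,j_\gamma+(\mathrm{Im}\,b)\,k_\gamma$, and $J_\gamma^2=-\mathrm{id}$ on $(T_\gamma M)_\perp^{\mathbb C}$. **2. The flow is non-stretching.** If $\gamma(t,x)$ is a smooth flow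 of curves in $M$, the curve at a time $t_0$ has a $U(n)$-parallel frame, and $\gamma_t=J_\gamma(\nabla_x\gamma_x)$ at $t=t_0$, then $\partial_t\,g(\gamma_x,\gamma_x)=0$ at $t=t_0$. **3. The curve flow of the generator $\mathrm J$.** For a flow with $U(n)$-parallel frames and Hasimoto variables $(r,(v_1,v_2))$, if $(e\rfloor\gamma_t)_\perp=\frac1{\sqrt\chi}\big(0,(v_1,v_2)\mathrm J\big)$ everywhere, then $D_x (e\rfloor\gamma_t)_\parallel=0$. Furthermore, $e\rfloor\gamma_t=\frac1{\sqrt\chi}\big(0,(v_1,v_2)\mathrm J\big)\in\mathfrak m_\perp$ everywhere if and only if $$\gamma_t=J_\gamma(\nabla_x\gamma_x),\qquad |\gamma_x|_g=1. \tag{$*$}$$ **4. Correspondence with the $SU(2)$ NLS system.** With $L=\begin{pmatrix}\bar v_1\\ \bar v_2\end{pmatrix}\cdot(v_1,v_2)$ and $N=\begin{pmatrix}\bar v_1\\ \bar v_2\end{pmatrix}\cdot(v_{1x},v_{2x})-\begin{pmatrix}\bar v_{1x}\\ \bar v_{2x}\end{pmatrix}\cdot(v_1,v_2)$, consider the system $$r_t=\tfrac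 i2\mathrm{tr}(L_x\mathrm J),$$ $$(v_1,v_2)_t-\tfrac1\chi(v_1,v_2)\mathrm J=(v_1,v_2)_{xx}\mathrm J+(2ir_x+4r^2)(v_1,v_2)\mathrm J+(v_1,v_2)\big(\{\mathrm J,L\}+\tfrac12[\mathrm J,L]-\mathrm{tr}(\mathrm JL)\big)+(v_1,v_2)\,D_x^{-1}\big(2ir[L,\mathrm J]+\tfrac12[N,\mathrm J]\big),$$ where $D_x^{-1}$ is some smooth $\mathfrak{su}(2)$-valued antiderivative. (a) If a flow with $U(n)$-parallel frames $f$ satisfies $(*)$, then there is a smooth $k(t)\in U(n-2)$ (acting on the last $n-2$ indices) such that the frames $fk$ are again $U(n)$-parallel, the flow satisfies $(*)$ with the map $J_\gamma$ of these frames, and their Hasimoto variables satisfy the NLS system. (b) Every smooth solution of the NLS system is the family of Hasimoto variables of $U(n)$-parallel frames along a flow $\gamma$ in $M$ that satisfies $(*)$. -/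

import Mathlib

open scoped Matrix ContDiff

namespace SU2CurveFlow

/-! ## The symmetric space `M = SO(2n)/U(n)` -/

/-- Indices of `n × n` matrices (for `n ≥ 2`), split as `2 + (n - 2)`. -/
abbrev Idx (n : ℕ) : Type := Fin 2 ⊕ Fin (n - 2)

/-- Real `2n × 2n` matrices, in `n × n` blocks. -/
abbrev Mat (n : ℕ) : Type := Matrix (Idx n ⊕ Idx n) (Idx n ⊕ Idx n) ℝ

/-- The group `SO(2n)`. -/
abbrev SO (n : ℕ) : Type := ↥(Matrix.specialOrthogonalGroup (Idx n ⊕ Idx n) ℝ)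

/-- The matrix `(C, D)` of the complex matrix `C + iD`. -/
def hElt {n : ℕ} (C D : Matrix (Idx n) (Idx n) ℝ) : Mat n := Matrix.fromBlocks C D (-D) C

/-- The matrix `(A, B)` with blocks `A, B, B, -A`. -/
def mElt {n : ℕ} (A B : Matrix (Idx n) (Idx n) ℝ) : Mat n := Matrix.fromBlocks A B B (-A)

/-- The standard complex structure of `ℝ²ⁿ`. -/
def J₀ (n : ℕ) : Mat n := Matrix.fromBlocks 0 1 (-1) 0

theorem transpose_mul_self {n : ℕ} (g : SO n) : (g : Mat n)ᵀ * (g : Mat n) = 1 := by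
  have h := (Matrix.mem_specialOrthogonalGroup_iff.1 g.2).1
  exact (Matrix.mem_orthogonalGroup_iff' (Idx n ⊕ Idx n) ℝ).1 h

theorem mul_transpose_self {n : ℕ} (g : SO n) : (g : Mat n) * (g : Mat n)ᵀ = 1 :=
  mul_eq_one_comm.1 (transpose_mul_self g)

theorem coe_inv {n : ℕ} (g : SO n) : ((g⁻¹ : SO n) : Mat n) = (g : Mat n)ᵀ := by
  have h : ((g⁻¹ : SO n) : Mat n) * (g : Mat n) = 1 := by
    have h0 := congrArg (fun k : SO n => (k : Mat n)) (inv_mul_cancel g)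
    exact h0
  calc ((g⁻¹ : SO n) : Mat n) = ((g⁻¹ : SO n) : Mat n) * ((g : Mat n) * (g : Mat n)ᵀ) := by
        rw [mul_transpose_self, mul_one]
    _ = (g : Mat n)ᵀ := by rw [← mul_assoc, h, one_mul]

theorem hElt_comm {n : ℕ} (C D : Matrix (Idx n) (Idx n) ℝ) : hElt C D * J₀ n = J₀ n * hElt C D := by
  simp [hElt, J₀, Matrix.fromBlocks_multiply]

theorem exists_hElt {n : ℕ} (Y : Mat n) (h : Y * J₀ n = J₀ n * Y) : ∃ C D, Y = hElt C D := by
  refine ⟨Y.toBlocks₁₁, Y.toBlocks₁₂, ?_⟩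
  rw [← Matrix.fromBlocks_toBlocks Y] at h
  simp only [J₀, Matrix.fromBlocks_multiply, Matrix.fromBlocks_inj] at h
  obtain ⟨h1, h2, -, -⟩ := h
  simp at h1 h2
  conv_lhs => rw [← Matrix.fromBlocks_toBlocks Y]
  rw [hElt, Matrix.fromBlocks_inj]
  exact ⟨rfl, rfl, h1.symm, h2.symm⟩

/-- The subgroup `U(n) ⊂ SO(2n)`: the elements of the form `(C, D)`. -/
def U (n : ℕ) : Subgroup (SO n) where
  carrier := {g | ∃ C D, (g : Mat n) = hElt C D}
  one_mem' := ⟨1, 0, by simp [hElt]⟩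
  mul_mem' := by
    rintro g k ⟨C, D, h1⟩ ⟨P, Q, h2⟩
    refine ⟨C * P - D * Q, C * Q + D * P, ?_⟩
    have h3 : ((g * k : SO n) : Mat n) = (g : Mat n) * (k : Mat n) := rfl
    rw [h3, h1, h2, hElt, hElt, hElt, Matrix.fromBlocks_multiply, Matrix.fromBlocks_inj]
    refine ⟨?_, rfl, ?_, ?_⟩ <;> noncomm_ring
  inv_mem' := by
    rintro g ⟨C, D, h⟩
    refine ⟨Cᵀ, -Dᵀ, ?_⟩
    rw [coe_inv, h, hElt, hElt, Matrix.fromBlocks_transpose]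
    simp

/-- The space `M = SO(2n)/U(n)`. -/
abbrev M (n : ℕ) : Type := SO n ⧸ U n

/-- The equivariant embedding `gU(n) ↦ g J₀ g⁻¹` of `M` into the matrices, whose image is the
adjoint orbit of `J₀`. It identifies `M` with an embedded submanifold, through which smoothness,
tangent vectors and covariant derivatives are expressed. -/
def embed {n : ℕ} : M n → Mat n :=
  Quotient.lift (fun g : SO n => (g : Mat n) * J₀ n * (g : Mat n)ᵀ) (by
    intro g k hgk
    obtain ⟨C, D, h⟩ := QuotientGroup.leftRel_apply.1 hgk
    have h1 : (g : Mat n)ᵀ * (k : Mat n) = hElt C D := by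
      rw [← coe_inv]; exact h
    have h2 : (k : Mat n) = (g : Mat n) * hElt C D := by
      rw [← h1, ← mul_assoc, mul_transpose_self, one_mul]
    have h3 : hElt C D * (hElt C D)ᵀ = 1 := by
      rw [← h1, Matrix.transpose_mul, Matrix.transpose_transpose, mul_assoc,
        ← mul_assoc (k : Mat n), mul_transpose_self, one_mul, transpose_mul_self]
    show (g : Mat n) * J₀ n * (g : Mat n)ᵀ = (k : Mat n) * J₀ n * (k : Mat n)ᵀ
    rw [h2, Matrix.transpose_mul, mul_assoc (g : Mat n) (hElt C D), hElt_comm]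
    simp only [mul_assoc]
    rw [← mul_assoc (hElt C D) (hElt C D)ᵀ, h3, one_mul])

theorem embed_mk {n : ℕ} (g : SO n) :
    embed (QuotientGroup.mk g : M n) = (g : Mat n) * J₀ n * (g : Mat n)ᵀ := rfl

theorem embed_injective {n : ℕ} : Function.Injective (embed : M n → Mat n) := by
  intro p q
  refine Quotient.inductionOn₂ p q ?_
  intro g k h
  have h' : (g : Mat n) * J₀ n * (g : Mat n)ᵀ = (k : Mat n) * J₀ n * (k : Mat n)ᵀ := h
  refine QuotientGroup.eq.2 ?_
  have hc : ((g : Mat n)ᵀ * (k : Mat n)) * J₀ n = J₀ n * ((g : Mat n)ᵀ * (k : Mat n)) := by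
    calc ((g : Mat n)ᵀ * (k : Mat n)) * J₀ n
        = (g : Mat n)ᵀ * ((k : Mat n) * J₀ n * (k : Mat n)ᵀ) * (k : Mat n) := by
          simp only [mul_assoc]; rw [transpose_mul_self, mul_one]
      _ = (g : Mat n)ᵀ * ((g : Mat n) * J₀ n * (g : Mat n)ᵀ) * (k : Mat n) := by rw [h']
      _ = J₀ n * ((g : Mat n)ᵀ * (k : Mat n)) := by
          simp only [← mul_assoc]; rw [transpose_mul_self, one_mul]
  obtain ⟨C, D, hCD⟩ := exists_hElt _ hc
  refine ⟨C, D, ?_⟩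
  rw [← hCD, ← coe_inv]
  rfl

/-! ## Riemannian structure

A point is given by its image `S` under the embedding. -/

/-- The constant `χ = 8(n-1)`. -/
noncomputable def χ (n : ℕ) : ℝ := 8 * ((n : ℝ) - 1)

/-- The Cartan-Killing form of `so(2n)`. -/
noncomputable def killing {n : ℕ} (P Q : Mat n) : ℝ := (2 * (n : ℝ) - 2) * (P * Q).trace

/-- The tangent space of `M` at `S`. -/
def tangent {n : ℕ} (S : Mat n) : Submodule ℝ (Mat n) where
  carrier := {Z | Zᵀ = -Z ∧ Z * S + S * Z = 0}
  zero_mem' := by simp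
  add_mem' := by
    rintro Y Z ⟨h1, h2⟩ ⟨h3, h4⟩
    refine ⟨by rw [Matrix.transpose_add, h1, h3]; abel, ?_⟩
    calc (Y + Z) * S + S * (Y + Z) = (Y * S + S * Y) + (Z * S + S * Z) := by noncomm_ring
      _ = 0 := by rw [h2, h4, add_zero]
  smul_mem' := by
    rintro r Z ⟨h1, h2⟩
    refine ⟨by rw [Matrix.transpose_smul, h1, smul_neg], ?_⟩
    rw [smul_mul_assoc, mul_smul_comm, ← smul_add, h2, smul_zero]

/-- The generator in `so(2n)` of the transvection with velocity `Z` at `S`; it is the inverse of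
`P ↦ ⁅P, S⁆`. At `S = g J₀ g⁻¹` it takes tangent vectors to `Ad(g)𝔪`. -/
noncomputable def gen {n : ℕ} (S : Mat n) : Mat n →ₗ[ℝ] Mat n where
  toFun Z := (-(1 / 2) : ℝ) • (Z * S)
  map_add' Y Z := by rw [add_mul, smul_add]
  map_smul' r Z := by
    rw [smul_mul_assoc, smul_comm]; rfl

/-- The invariant metric, minus the Cartan-Killing form. -/
noncomputable def metric {n : ℕ} (S Y Z : Mat n) : ℝ := -killing (gen S Y) (gen S Z)

/-- The Riemannian curvature `R(X,Y)Z`, corresponding to `-[[X,Y],Z]` in `𝔪`. -/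
noncomputable def curvature {n : ℕ} (S X Y Z : Mat n) : Mat n :=
  ⁅-⁅⁅gen S X, gen S Y⁆, gen S Z⁆, S⁆

/-- The linear map `ad²(X) = -R(·,X)X`. -/
noncomputable def adSq {n : ℕ} (S X : Mat n) : Mat n →ₗ[ℝ] Mat n where
  toFun Z := -curvature S Z X X
  map_add' Y Z := by
    simp only [curvature, map_add, Ring.lie_def]
    noncomm_ring
  map_smul' r Z := by
    simp only [curvature, map_smul, Ring.lie_def, mul_smul_comm, smul_mul_assoc, RingHom.id_apply,
      ← smul_sub, ← smul_neg]

/-- `(TM)_∥`, the null space of `ad²(X)`. -/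
noncomputable def tangentPar {n : ℕ} (S X : Mat n) : Submodule ℝ (Mat n) :=
  tangent S ⊓ LinearMap.ker (adSq S X)

/-- `(TM)_⊥`, the orthogonal complement of `(TM)_∥`. -/
noncomputable def tangentPerp {n : ℕ} (S X : Mat n) : Submodule ℝ (Mat n) where
  carrier := {Z | Z ∈ tangent S ∧ ∀ W ∈ tangentPar S X, metric S Z W = 0}
  zero_mem' := ⟨zero_mem _, fun W _ => by simp [metric, killing]⟩
  add_mem' := by
    rintro Y Z ⟨h1, h2⟩ ⟨h3, h4⟩
    refine ⟨add_mem h1 h3, fun W hW => ?_⟩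
    have h5 := h2 W hW
    have h6 := h4 W hW
    simp only [metric, killing, map_add, add_mul, Matrix.trace_add, mul_add] at h5 h6 ⊢
    linarith
  smul_mem' := by
    rintro r Z ⟨h1, h2⟩
    refine ⟨Submodule.smul_mem _ r h1, fun W hW => ?_⟩
    have h5 := h2 W hW
    simp only [metric, killing, map_smul, smul_mul_assoc, Matrix.trace_smul, smul_eq_mul] at h5 ⊢
    linear_combination r * h5

/-- The projection onto the `-1/χ` eigenspace of `ad²(X)`. -/
noncomputable def projC {n : ℕ} (S X : Mat n) : Mat n →ₗ[ℝ] Mat n :=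
  (-(χ n ^ 2 / 3)) • (((4 / χ n) • LinearMap.id + adSq S X) ∘ₗ adSq S X)

/-- The projection onto the `-4/χ` eigenspace of `ad²(X)`. -/
noncomputable def projR {n : ℕ} (S X : Mat n) : Mat n →ₗ[ℝ] Mat n :=
  (χ n ^ 2 / 12) • (((1 / χ n) • LinearMap.id + adSq S X) ∘ₗ adSq S X)

/-- `(TM)_⊥^ℂ`. -/
noncomputable def tangentC {n : ℕ} (S X : Mat n) : Submodule ℝ (Mat n) :=
  (tangentPerp S X).map (projC S X)

/-- `(TM)_⊥^ℝ`. -/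
noncomputable def tangentR {n : ℕ} (S X : Mat n) : Submodule ℝ (Mat n) :=
  (tangentPerp S X).map (projR S X)

/-! ## Calculus for matrix functions, curves in `M` -/

/-- The entrywise derivative. -/
noncomputable def mderiv {α β E : Type*} [NormedAddCommGroup E] [NormedSpace ℝ E]
    (F : ℝ → Matrix α β E) (x : ℝ) : Matrix α β E :=
  Matrix.of fun i j => deriv (fun s => F s i j) x

/-- Smoothness of a matrix function on a set of parameters. -/
def SmoothOn {α β E : Type*} [NormedAddCommGroup E] [NormedSpace ℝ E]
    (F : ℝ → Matrix α β E) (X : Set ℝ) : Prop :=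
  ∀ i j, ContDiffOn ℝ ∞ (fun x => F x i j) X

/-- Joint smoothness of a matrix function of `(t, x)` on `T × X`. -/
def SmoothOn₂ {α β E : Type*} [NormedAddCommGroup E] [NormedSpace ℝ E]
    (F : ℝ → ℝ → Matrix α β E) (T X : Set ℝ) : Prop :=
  ∀ i j, ContDiffOn ℝ ∞ (fun p : ℝ × ℝ => F p.1 p.2 i j) (T ×ˢ X)

/-- The velocity of a curve in `M`. -/
noncomputable def velocity {n : ℕ} (c : ℝ → M n) (x : ℝ) : Mat n :=
  mderiv (fun s => embed (c s)) x

/-- The covariant derivative `∇ₓ Z` of a vector field `Z` along the curve `c`: the orthogonal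
projection of the derivative onto the tangent space. (`Y ↦ (Y + SYS)/2` is the orthogonal projection
of the skew matrices onto the tangent space at `S`; the metric is a constant multiple of the
Euclidean one, so this is the Levi-Civita connection.) -/
noncomputable def covDeriv {n : ℕ} (c : ℝ → M n) (Z : ℝ → Mat n) (x : ℝ) : Mat n :=
  (1 / 2 : ℝ) • (mderiv Z x + embed (c x) * mderiv Z x * embed (c x))

/-- The principal normal vector `∇ₓ cₓ`. -/
noncomputable def normal {n : ℕ} (c : ℝ → M n) : ℝ → Mat n := covDeriv c (velocity c)

/-! ## Frames

A frame at the point `gU(n)` is a representative `g`. -/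

/-- The linear coframe `e : T M → 𝔪` in the frame `g`; the tangent vector
`g ⁅z, J₀⁆ g⁻¹` at `g J₀ g⁻¹` has the component `z`. -/
noncomputable def coframe {n : ℕ} (g : SO n) : Mat n →ₗ[ℝ] Mat n where
  toFun Z := (-(1 / 2) : ℝ) • ((g : Mat n)ᵀ * Z * (g : Mat n) * J₀ n)
  map_add' Y Z := by simp only [mul_add, add_mul, smul_add]
  map_smul' r Z := by
    simp only [mul_smul_comm, smul_mul_assoc, RingHom.id_apply, smul_comm r]

/-- The inverse of the coframe, as a map `𝔪 → T M`. -/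
noncomputable def solder {n : ℕ} (g : SO n) : Mat n →ₗ[ℝ] Mat n where
  toFun z := (g : Mat n) * ⁅z, J₀ n⁆ * (g : Mat n)ᵀ
  map_add' y z := by
    simp only [Ring.lie_def]
    noncomm_ring
  map_smul' r z := by
    simp only [Ring.lie_def, mul_smul_comm, smul_mul_assoc, RingHom.id_apply, ← smul_sub]

theorem J₀_mul_self (n : ℕ) : J₀ n * J₀ n = -1 := by
  have h : (1 : Mat n) = Matrix.fromBlocks 1 0 0 1 := Matrix.fromBlocks_one.symm
  rw [J₀, Matrix.fromBlocks_multiply, h, Matrix.fromBlocks_neg, Matrix.fromBlocks_inj]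
  simp

theorem coframe_solder {n : ℕ} (g : SO n) (A B : Matrix (Idx n) (Idx n) ℝ) :
    coframe g (solder g (mElt A B)) = mElt A B := by
  have h : J₀ n * mElt A B = -(mElt A B * J₀ n) := by
    simp [J₀, mElt, Matrix.fromBlocks_multiply, Matrix.fromBlocks_neg]
  have h1 : ⁅mElt A B, J₀ n⁆ = (2 : ℝ) • (mElt A B * J₀ n) := by
    rw [Ring.lie_def, h, sub_neg_eq_add, two_smul]
  have h2 : ∀ Y : Mat n, (g : Mat n)ᵀ * ((g : Mat n) * Y * (g : Mat n)ᵀ) * (g : Mat n) = Y := by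
    intro Y
    calc (g : Mat n)ᵀ * ((g : Mat n) * Y * (g : Mat n)ᵀ) * (g : Mat n)
        = ((g : Mat n)ᵀ * (g : Mat n)) * Y * ((g : Mat n)ᵀ * (g : Mat n)) := by
          simp only [mul_assoc]
      _ = Y := by rw [transpose_mul_self, one_mul, mul_one]
  show (-(1 / 2) : ℝ) • ((g : Mat n)ᵀ * ((g : Mat n) * ⁅mElt A B, J₀ n⁆ * (g : Mat n)ᵀ)
    * (g : Mat n) * J₀ n) = _
  rw [h2, h1, smul_mul_assoc, mul_assoc, J₀_mul_self, smul_smul]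
  simp

/-- The `𝔥`-valued connection component along a frame `g(x)`: the part of `g⁻¹gₓ` in `𝔥 = u(n)`. -/
noncomputable def connection {n : ℕ} (g : ℝ → SO n) (x : ℝ) : Mat n :=
  let Y := (g x : Mat n)ᵀ * mderiv (fun s => (g s : Mat n)) x
  (1 / 2 : ℝ) • (Y - J₀ n * Y * J₀ n)

/-- The unit element `e` of the Cartan subspace. -/
noncomputable def ee (n : ℕ) : Mat n :=
  (1 / √(χ n)) • mElt (Matrix.fromBlocks !![0, 1; -1, 0] 0 0 0) 0

/-- The Lie algebra `𝔥 = u(n)`. -/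
def uLie (n : ℕ) : Set (Mat n) := {K | ∃ C D, Cᵀ = -C ∧ Dᵀ = D ∧ K = hElt C D}

/-- The centralizer `𝔥_∥` of `e` in `u(n)`. -/
def hPar (n : ℕ) : Set (Mat n) := {K | K ∈ uLie n ∧ ⁅K, ee n⁆ = 0}

/-- The perp space `𝔥_⊥` of `𝔥_∥` in `u(n)`. -/
def hPerp (n : ℕ) : Set (Mat n) := {u | u ∈ uLie n ∧ ∀ K ∈ hPar n, killing u K = 0}

/-- `g` is a `U(n)`-parallel frame along the curve `c`, whose tangent vector has the frame
component `e`. -/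
structure IsParallelFrame {n : ℕ} (X : Set ℝ) (c : ℝ → M n) (g : ℝ → SO n) : Prop where
  smooth : SmoothOn (fun x => (g x : Mat n)) X
  lifts : ∀ x ∈ X, c x = QuotientGroup.mk (g x)
  tangent : ∀ x ∈ X, coframe (g x) (velocity c x) = ee n
  perp : ∀ x ∈ X, connection g x ∈ hPerp n

/-- `g(t,x)` is a smooth family of `U(n)`-parallel frames along the curves `γ(t,·)`. -/
structure IsFlowFrame {n : ℕ} (T X : Set ℝ) (γ : ℝ → ℝ → M n) (g : ℝ → ℝ → SO n) : Prop where
  smooth : SmoothOn₂ (fun t x => (g t x : Mat n)) T X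
  parallel : ∀ t ∈ T, IsParallelFrame X (γ t) (g t)

/-- The element `(r, (v₁, v₂))` of `𝔪_⊥`; the columns of `V` are `v₁` and `v₂`. -/
noncomputable def mPerp {n : ℕ} (r : ℝ) (V : Matrix (Fin (n - 2)) (Fin 2) ℂ) : Mat n :=
  mElt (Matrix.fromBlocks 0 (V.map Complex.re)ᵀ (-V.map Complex.re) 0)
    (Matrix.fromBlocks !![0, r; -r, 0] (V.map Complex.im)ᵀ (-V.map Complex.im) 0)

/-- The projection of `𝔪` onto `𝔪_⊥`. -/
noncomputable def projPerp {n : ℕ} (z : Mat n) : Mat n :=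
  (-(χ n ^ 2 / 4)) • ((5 / χ n) • ⁅ee n, ⁅ee n, z⁆⁆ + ⁅ee n, ⁅ee n, ⁅ee n, ⁅ee n, z⁆⁆⁆⁆)

/-- `(r, V)` are the Hasimoto variables `v` of the frames `g`: the connection component is
`u = √χ ad(e) v`. -/
def IsHasimoto {n : ℕ} (T X : Set ℝ) (g : ℝ → ℝ → SO n) (r : ℝ → ℝ → ℝ)
    (V : ℝ → ℝ → Matrix (Fin (n - 2)) (Fin 2) ℂ) : Prop :=
  ∀ t ∈ T, ∀ x ∈ X, connection (g t) x = √(χ n) • ⁅ee n, mPerp (r t x) (V t x)⁆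

/-! ## The action of `su(2)` -/

/-- The inclusion of `su(2)` in `𝔥_∥ = su(2) ⊕ u(n-2)`. -/
noncomputable def suEmbed (n : ℕ) (K : Matrix (Fin 2) (Fin 2) ℂ) : Mat n :=
  hElt (Matrix.fromBlocks (K.map Complex.re) 0 0 0) (Matrix.fromBlocks (K.map Complex.im) 0 0 0)

/-- The `su(2)` generator with parameters `a, b`. -/
noncomputable def suGen (a : ℝ) (b : ℂ) : Matrix (Fin 2) (Fin 2) ℂ :=
  !![Complex.I * a, b; -(starRingEnd ℂ) b, -(Complex.I * a)]

/-- The Pauli matrices, with the sign convention for the second one used here. -/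
def pauli₁ : Matrix (Fin 2) (Fin 2) ℂ := !![0, 1; 1, 0]

/-- The second Pauli matrix (this is minus the most common choice). -/
noncomputable def pauli₂ : Matrix (Fin 2) (Fin 2) ℂ := !![0, Complex.I; -Complex.I, 0]

/-- The third Pauli matrix. -/
def pauli₃ : Matrix (Fin 2) (Fin 2) ℂ := !![1, 0; 0, -1]

/-- The linear map on the tangent space at the point of the frame `g` that corresponds to
`-ad(K)`, that is, `e⌟(frameMap g K Z) = -ad(K)(e⌟Z)`. -/
noncomputable def frameMap {n : ℕ} (g : SO n) (K : Matrix (Fin 2) (Fin 2) ℂ) :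
    Mat n →ₗ[ℝ] Mat n where
  toFun Z := solder g (-⁅suEmbed n K, coframe g Z⁆)
  map_add' Y Z := by
    rw [← map_add]
    congr 1
    simp only [map_add, Ring.lie_def]
    noncomm_ring
  map_smul' r Z := by
    rw [RingHom.id_apply, ← map_smul]
    congr 1
    simp only [map_smul, Ring.lie_def, mul_smul_comm, smul_mul_assoc, ← smul_sub, smul_neg]

/-- The maps `i, j, k` make the subspace `C` a quaternionic vector space and vanish on the
subspaces `R` and `P`. -/
structure IsDegenerateQuaternionic {n : ℕ} (C R P : Submodule ℝ (Mat n))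
    (i j k : Mat n →ₗ[ℝ] Mat n) : Prop where
  maps_i : ∀ Z ∈ C, i Z ∈ C
  maps_j : ∀ Z ∈ C, j Z ∈ C
  maps_k : ∀ Z ∈ C, k Z ∈ C
  i_sq : ∀ Z ∈ C, i (i Z) = -Z
  j_sq : ∀ Z ∈ C, j (j Z) = -Z
  k_sq : ∀ Z ∈ C, k (k Z) = -Z
  i_j : ∀ Z ∈ C, i (j Z) = k Z
  j_k : ∀ Z ∈ C, j (k Z) = i Z
  k_i : ∀ Z ∈ C, k (i Z) = j Z
  zero_R : ∀ Z ∈ R, i Z = 0 ∧ j Z = 0 ∧ k Z = 0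
  zero_P : ∀ Z ∈ P, i Z = 0 ∧ j Z = 0 ∧ k Z = 0

/-! ## The curve flow and the NLS system -/

/-- The curve flow equation `γ_t = J_γ(∇ₓ γₓ)`, `|γₓ| = 1`, with `J_γ` the map that corresponds to
`-ad(J)` in the frame `g`. -/
def IsCurveFlow {n : ℕ} (J : Matrix (Fin 2) (Fin 2) ℂ) (T X : Set ℝ) (γ : ℝ → ℝ → M n)
    (g : ℝ → ℝ → SO n) : Prop :=
  ∀ t ∈ T, ∀ x ∈ X,
    velocity (fun s => γ s x) t = frameMap (g t x) J (normal (γ t) x) ∧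
    metric (embed (γ t x)) (velocity (γ t) x) (velocity (γ t) x) = 1

/-- The element of `SO(2n)` lies in the subgroup `U(n-2)`. -/
def InUnitaryFactor {n : ℕ} (k : SO n) : Prop :=
  ∃ C D : Matrix (Fin (n - 2)) (Fin (n - 2)) ℝ,
    (k : Mat n) = hElt (Matrix.fromBlocks 1 0 0 C) (Matrix.fromBlocks 0 0 0 D)

/-- The `SU(2)` NLS system with generator `J` for the real scalar `r` and the pair of complex
vectors `(v₁, v₂)`, the columns of `V`. The nonlocal term `Θ = Dₓ⁻¹(…)` is an `su(2)`-valued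
antiderivative. -/
def IsNLSSolution {n : ℕ} (J : Matrix (Fin 2) (Fin 2) ℂ) (T X : Set ℝ) (r : ℝ → ℝ → ℝ)
    (V : ℝ → ℝ → Matrix (Fin (n - 2)) (Fin 2) ℂ) : Prop :=
  ContDiffOn ℝ ∞ (fun p : ℝ × ℝ => r p.1 p.2) (T ×ˢ X) ∧ SmoothOn₂ V T X ∧
  ∃ Θ : ℝ → ℝ → Matrix (Fin 2) (Fin 2) ℂ,
    SmoothOn₂ Θ T X ∧
    ∀ t ∈ T, ∀ x ∈ X,
      (Θ t x)ᴴ = -Θ t x ∧ (Θ t x).trace = 0 ∧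
      (let Vx := mderiv (V t)
       let rx := deriv (r t) x
       let L : ℝ → Matrix (Fin 2) (Fin 2) ℂ := fun y => (V t y)ᴴ * V t y
       let N : Matrix (Fin 2) (Fin 2) ℂ := (V t x)ᴴ * Vx x - (Vx x)ᴴ * V t x
       mderiv (Θ t) x = (2 * Complex.I * (r t x : ℂ)) • ⁅L x, J⁆ + (1 / 2 : ℂ) • ⁅N, J⁆ ∧
       ((deriv (fun s => r s x) t : ℝ) : ℂ) = Complex.I / 2 * (mderiv L x * J).trace ∧
       mderiv (fun s => V s x) t - ((1 / χ n : ℝ) : ℂ) • (V t x * J) =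
         mderiv Vx x * J
         + (2 * Complex.I * (rx : ℂ) + 4 * (r t x : ℂ) ^ 2) • (V t x * J)
         + V t x * ((J * L x + L x * J) + (1 / 2 : ℂ) • ⁅J, L x⁆ - (J * L x).trace • 1)
         + V t x * Θ t x)

end SU2CurveFlow

/-!
A real `2n × 2n` matrix is the sum of a complex linear and a complex antilinear endomorphism of
`ℂⁿ`, so it is a pair of complex `n × n` matrices: `hC H` is the linear part with matrix `C + iD`,
and `mC W` the antilinear part with matrix `A + iB`. The products are
`hC H * mC W = mC (H̄ W)`, `mC W * mC W' = hC (W̄ W')` and so on, and all brackets of `𝔥` and `𝔪`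
become products of complex matrices, which split into blocks of sizes `2` and `n - 2`. In this
form `𝔪` consists of the matrices `mBlock c B D`, where `c` is the coefficient of `ε = (0 1; -1 0)`
in the upper left block, `√χ e` is `mBlock 1 0 0`, and `𝔥_⊥` consists of the matrices `uBlock r V`
of the Hasimoto variables (`mem_hPerp_iff`).

*The structure along a curve.* A frame `g` identifies the tangent space with `𝔪`
(`mem_tangent_iff`). There `ad²(e)` is `-1/χ` on the block `B`, `-4/χ` on the imaginary part of `c`,
and `0` on the real part of `c` and on `D` (`adSq_ee`), which gives the two splittings, and `-ad(K)`
is the multiplication of `B` by `K` from the right (`lie_suEmbed`), so that the quaternion relations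
are those of the matrices `iσ₃`, `iσ₂`, `iσ₁`.

*The flow is non-stretching.* In a parallel frame, `∇ₓγₓ` is `(4r, (v₁, v₂))/√χ`
(`IsParallelFrame.normal_eq`). The metric is a multiple of the trace form on tangent vectors, and
`J_γ(∇ₓγₓ)` is orthogonal to `γₓ` and, `J` being skew, to `∇ₓγₓ`, so the derivative of `|γₓ|²` is
the derivative of a product that vanishes along the curve, minus a term that vanishes
(`hasDerivAt_metric_velocity`).

*The generator.* The formula for `∇ₓγₓ` translates the flow equation into
`e⌟γ_t = (0, (v₁, v₂)J)/√χ` (`IsFlowFrame.isCurveFlow_iff`). The `𝔪`-component of the zero curvature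
equation of `g⁻¹dg` shows that the parallel part of `e⌟γ_t` is constant along each curve
(`IsFlowFrame.mderiv_par_eq_zero`).

*From the flow to the NLS system.* The `𝔪`-component of the zero curvature equation determines the
`𝔥_⊥`-component of `g⁻¹g_t` (`IsFlowFrame.exists_hPart_eq_wBlock`). The undetermined rest consists
of a traceless block `Θ` and a block `F` in `u(n-2)`. By the `𝔥`-component
(`IsFlowFrame.curvature_blocks`) the derivative of `F` in `x` is that of `(V J Vᴴ)ᵀ`, so the two
differ by a function of `t` alone, which a gauge transformation `k(t) ∈ U(n-2)` removes
(`exists_gauge`). Then `Θ` is the antiderivative in the NLS system, and the remaining blocks are the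
equations for `r` and `(v₁, v₂)` (`nls_block₁₁`, `nls_block₁₂`).

*From the NLS system to the flow.* The same computation shows that a solution defines a flat
`so(2n)`-valued connection on `T × X` (`flat_of_nls`), and integrating it gives the frames
(`exists_frame_of_flat`). The integration solves `y' = yP` with skew `P`, first in `t` and then in
`x`. The retraction to the unit ball makes the equation globally Lipschitz and bounded, so that the
Picard-Lindelöf theorem yields a solution on the whole interval, and as `y y*` is conserved the
retraction acts trivially on it (`exists_unitary_solution_Icc`). Flatness gives the equation in `t`
away from the initial value of `x` (`hasDerivAt_left_of_flat`).
-/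

namespace SU2CurveFlow

/-! ### Real `2n × 2n` matrices as pairs of complex `n × n` matrices -/

section ComplexMatrices

variable {l m k : Type*}

/-- The entrywise complex conjugate of a matrix. -/
def cj (A : Matrix l m ℂ) : Matrix l m ℂ := A.map (starRingEnd ℂ)

@[simp] theorem cj_apply (A : Matrix l m ℂ) (i : l) (j : m) :
    cj A i j = starRingEnd ℂ (A i j) := rfl

@[simp] theorem cj_cj (A : Matrix l m ℂ) : cj (cj A) = A := by ext; simp

@[simp] theorem cj_add (A B : Matrix l m ℂ) : cj (A + B) = cj A + cj B := by ext; simp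

@[simp] theorem cj_sub (A B : Matrix l m ℂ) : cj (A - B) = cj A - cj B := by ext; simp

@[simp] theorem cj_neg (A : Matrix l m ℂ) : cj (-A) = -cj A := by ext; simp

@[simp] theorem cj_zero : cj (0 : Matrix l m ℂ) = 0 := by ext; simp

@[simp] theorem cj_one [DecidableEq m] : cj (1 : Matrix m m ℂ) = 1 := by
  ext i j; by_cases h : i = j <;> simp [Matrix.one_apply, h]

@[simp] theorem cj_smul (c : ℂ) (A : Matrix l m ℂ) : cj (c • A) = starRingEnd ℂ c • cj A := by
  ext; simp

@[simp] theorem cj_smul_real (c : ℝ) (A : Matrix l m ℂ) : cj (c • A) = c • cj A := by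
  ext; simp

@[simp] theorem cj_mul [Fintype m] (A : Matrix l m ℂ) (B : Matrix m k ℂ) :
    cj (A * B) = cj A * cj B := Matrix.map_mul

@[simp] theorem cj_transpose (A : Matrix l m ℂ) : (cj A)ᵀ = Aᴴ := by ext; simp

@[simp] theorem cj_conjTranspose (A : Matrix l m ℂ) : cj (Aᴴ) = Aᵀ := by ext; simp

@[simp] theorem cj_of_transpose (A : Matrix l m ℂ) : cj (Aᵀ) = Aᴴ := by ext; simp

@[simp] theorem conjTranspose_cj (A : Matrix l m ℂ) : (cj A)ᴴ = Aᵀ := by ext; simp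

@[simp] theorem conjTranspose_transpose' (A : Matrix l m ℂ) : (Aᴴ)ᵀ = cj A := by ext; simp

@[simp] theorem transpose_conjTranspose' (A : Matrix l m ℂ) : (Aᵀ)ᴴ = cj A := by ext; simp

theorem cj_fromBlocks {p : Type*} (A : Matrix l m ℂ) (B : Matrix l k ℂ) (C : Matrix p m ℂ)
    (D : Matrix p k ℂ) :
    cj (Matrix.fromBlocks A B C D) = Matrix.fromBlocks (cj A) (cj B) (cj C) (cj D) :=
  Matrix.fromBlocks_map _ _ _ _ _

theorem trace_fromBlocks {p q : Type*} [Fintype p] [Fintype q] (A : Matrix p p ℂ)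
    (B : Matrix p q ℂ) (C : Matrix q p ℂ) (D : Matrix q q ℂ) :
    (Matrix.fromBlocks A B C D).trace = A.trace + D.trace := by
  simp [Matrix.trace, Fintype.sum_sum_type]

theorem trace_cj [Fintype m] (A : Matrix m m ℂ) : (cj A).trace = starRingEnd ℂ A.trace := by
  simp [Matrix.trace]

end ComplexMatrices

variable {n : ℕ}

/-- The complex-linear real matrix `(C, D)` that represents `C + iD`. -/
def hC (H : Matrix (Idx n) (Idx n) ℂ) : Mat n := hElt (H.map Complex.re) (H.map Complex.im)

/-- The antilinear real matrix `(A, B)` that represents `A + iB` followed by conjugation. -/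
def mC (W : Matrix (Idx n) (Idx n) ℂ) : Mat n := mElt (W.map Complex.re) (W.map Complex.im)

/-- The complex matrix of the complex-linear part of a real matrix. -/
noncomputable def hPart (Y : Mat n) : Matrix (Idx n) (Idx n) ℂ := Matrix.of fun i j =>
  ⟨(Y (.inl i) (.inl j) + Y (.inr i) (.inr j)) / 2, (Y (.inl i) (.inr j) - Y (.inr i) (.inl j)) / 2⟩

/-- The complex matrix of the antilinear part of a real matrix. -/
noncomputable def mPart (Y : Mat n) : Matrix (Idx n) (Idx n) ℂ := Matrix.of fun i j =>
  ⟨(Y (.inl i) (.inl j) - Y (.inr i) (.inr j)) / 2, (Y (.inl i) (.inr j) + Y (.inr i) (.inl j)) / 2⟩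

theorem hC_apply_ll (H : Matrix (Idx n) (Idx n) ℂ) (i j : Idx n) :
    hC H (.inl i) (.inl j) = (H i j).re := rfl
theorem hC_apply_lr (H : Matrix (Idx n) (Idx n) ℂ) (i j : Idx n) :
    hC H (.inl i) (.inr j) = (H i j).im := rfl
theorem hC_apply_rl (H : Matrix (Idx n) (Idx n) ℂ) (i j : Idx n) :
    hC H (.inr i) (.inl j) = -(H i j).im := rfl
theorem hC_apply_rr (H : Matrix (Idx n) (Idx n) ℂ) (i j : Idx n) :
    hC H (.inr i) (.inr j) = (H i j).re := rfl
theorem mC_apply_ll (H : Matrix (Idx n) (Idx n) ℂ) (i j : Idx n) :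
    mC H (.inl i) (.inl j) = (H i j).re := rfl
theorem mC_apply_lr (H : Matrix (Idx n) (Idx n) ℂ) (i j : Idx n) :
    mC H (.inl i) (.inr j) = (H i j).im := rfl
theorem mC_apply_rl (H : Matrix (Idx n) (Idx n) ℂ) (i j : Idx n) :
    mC H (.inr i) (.inl j) = (H i j).im := rfl
theorem mC_apply_rr (H : Matrix (Idx n) (Idx n) ℂ) (i j : Idx n) :
    mC H (.inr i) (.inr j) = -(H i j).re := rfl

theorem hC_hPart_add_mC_mPart (Y : Mat n) : hC (hPart Y) + mC (mPart Y) = Y := by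
  ext i j
  rcases i with i | i <;> rcases j with j | j <;>
    simp only [Matrix.add_apply, hC_apply_ll, hC_apply_lr, hC_apply_rl, hC_apply_rr, mC_apply_ll,
      mC_apply_lr, mC_apply_rl, mC_apply_rr, hPart, mPart, Matrix.of_apply] <;> ring

@[simp] theorem hPart_hC (H : Matrix (Idx n) (Idx n) ℂ) : hPart (hC H) = H := by
  ext i j; apply Complex.ext <;>
    simp [hPart, hC_apply_ll, hC_apply_lr, hC_apply_rl, hC_apply_rr]

@[simp] theorem mPart_mC (H : Matrix (Idx n) (Idx n) ℂ) : mPart (mC H) = H := by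
  ext i j; apply Complex.ext <;>
    simp [mPart, mC_apply_ll, mC_apply_lr, mC_apply_rl, mC_apply_rr]

@[simp] theorem mPart_hC (H : Matrix (Idx n) (Idx n) ℂ) : mPart (hC H) = 0 := by
  ext i j; apply Complex.ext <;>
    simp [mPart, hC_apply_ll, hC_apply_lr, hC_apply_rl, hC_apply_rr]

@[simp] theorem hPart_mC (H : Matrix (Idx n) (Idx n) ℂ) : hPart (mC H) = 0 := by
  ext i j; apply Complex.ext <;>
    simp [hPart, mC_apply_ll, mC_apply_lr, mC_apply_rl, mC_apply_rr]

@[simp] theorem hPart_add (Y Z : Mat n) : hPart (Y + Z) = hPart Y + hPart Z := by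
  ext i j; apply Complex.ext <;> simp [hPart] <;> ring

@[simp] theorem mPart_add (Y Z : Mat n) : mPart (Y + Z) = mPart Y + mPart Z := by
  ext i j; apply Complex.ext <;> simp [mPart] <;> ring

@[simp] theorem hPart_sub (Y Z : Mat n) : hPart (Y - Z) = hPart Y - hPart Z := by
  ext i j; apply Complex.ext <;> simp [hPart] <;> ring

@[simp] theorem mPart_sub (Y Z : Mat n) : mPart (Y - Z) = mPart Y - mPart Z := by
  ext i j; apply Complex.ext <;> simp [mPart] <;> ring

@[simp] theorem hPart_zero : hPart (0 : Mat n) = 0 := by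
  ext i j; apply Complex.ext <;> simp [hPart]

@[simp] theorem mPart_zero : mPart (0 : Mat n) = 0 := by
  ext i j; apply Complex.ext <;> simp [mPart]

theorem hC_injective : Function.Injective (hC : _ → Mat n) := fun A B h => by
  rw [← hPart_hC A, h, hPart_hC]

theorem mC_injective : Function.Injective (mC : _ → Mat n) := fun A B h => by
  rw [← mPart_mC A, h, mPart_mC]

theorem hC_add (A B : Matrix (Idx n) (Idx n) ℂ) : hC (A + B) = hC A + hC B := by
  ext (i | i) (j | j) <;> simp [hC_apply_ll, hC_apply_lr, hC_apply_rl, hC_apply_rr]; ring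

theorem mC_add (A B : Matrix (Idx n) (Idx n) ℂ) : mC (A + B) = mC A + mC B := by
  ext (i | i) (j | j) <;> simp [mC_apply_ll, mC_apply_lr, mC_apply_rl, mC_apply_rr]; ring

theorem hC_neg (A : Matrix (Idx n) (Idx n) ℂ) : hC (-A) = -hC A := by
  ext (i | i) (j | j) <;> simp [hC_apply_ll, hC_apply_lr, hC_apply_rl, hC_apply_rr]

theorem mC_neg (A : Matrix (Idx n) (Idx n) ℂ) : mC (-A) = -mC A := by
  ext (i | i) (j | j) <;> simp [mC_apply_ll, mC_apply_lr, mC_apply_rl, mC_apply_rr]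

theorem hC_sub (A B : Matrix (Idx n) (Idx n) ℂ) : hC (A - B) = hC A - hC B := by
  rw [sub_eq_add_neg, hC_add, hC_neg, ← sub_eq_add_neg]

theorem mC_sub (A B : Matrix (Idx n) (Idx n) ℂ) : mC (A - B) = mC A - mC B := by
  rw [sub_eq_add_neg, mC_add, mC_neg, ← sub_eq_add_neg]

@[simp] theorem hC_zero : hC (0 : Matrix (Idx n) (Idx n) ℂ) = 0 := by
  simpa using hC_sub (0 : Matrix (Idx n) (Idx n) ℂ) 0

@[simp] theorem mC_zero : mC (0 : Matrix (Idx n) (Idx n) ℂ) = 0 := by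
  simpa using mC_sub (0 : Matrix (Idx n) (Idx n) ℂ) 0

theorem hC_smul (c : ℝ) (A : Matrix (Idx n) (Idx n) ℂ) : hC (c • A) = c • hC A := by
  ext (i | i) (j | j) <;> simp [hC_apply_ll, hC_apply_lr, hC_apply_rl, hC_apply_rr]

theorem mC_smul (c : ℝ) (A : Matrix (Idx n) (Idx n) ℂ) : mC (c • A) = c • mC A := by
  ext (i | i) (j | j) <;> simp [mC_apply_ll, mC_apply_lr, mC_apply_rl, mC_apply_rr]

theorem hC_mul_hC (H K : Matrix (Idx n) (Idx n) ℂ) : hC H * hC K = hC (H * K) := by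
  ext (i | i) (j | j) <;>
    simp [hC_apply_ll, hC_apply_lr, hC_apply_rl, hC_apply_rr, Matrix.mul_apply,
      Fintype.sum_sum_type, Finset.sum_add_distrib, Finset.sum_sub_distrib] <;> ring

theorem hC_mul_mC (H W : Matrix (Idx n) (Idx n) ℂ) : hC H * mC W = mC (cj H * W) := by
  ext (i | i) (j | j) <;>
    simp [hC_apply_ll, hC_apply_lr, hC_apply_rl, hC_apply_rr, Matrix.mul_apply,
      mC_apply_ll, mC_apply_lr, mC_apply_rl, mC_apply_rr,
      Fintype.sum_sum_type, Finset.sum_add_distrib] <;> ring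

theorem mC_mul_hC (W H : Matrix (Idx n) (Idx n) ℂ) : mC W * hC H = mC (W * H) := by
  ext (i | i) (j | j) <;>
    simp [hC_apply_ll, hC_apply_lr, hC_apply_rl, hC_apply_rr, Matrix.mul_apply,
      mC_apply_ll, mC_apply_lr, mC_apply_rl, mC_apply_rr,
      Fintype.sum_sum_type, Finset.sum_add_distrib] <;> ring

theorem mC_mul_mC (W Z : Matrix (Idx n) (Idx n) ℂ) : mC W * mC Z = hC (cj W * Z) := by
  ext (i | i) (j | j) <;>
    simp [hC_apply_ll, hC_apply_lr, hC_apply_rl, hC_apply_rr, Matrix.mul_apply,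
      mC_apply_ll, mC_apply_lr, mC_apply_rl, mC_apply_rr,
      Fintype.sum_sum_type, Finset.sum_add_distrib] <;> ring

theorem hC_transpose (H : Matrix (Idx n) (Idx n) ℂ) : (hC H)ᵀ = hC Hᴴ := by
  ext (i | i) (j | j) <;> simp [hC_apply_ll, hC_apply_lr, hC_apply_rl, hC_apply_rr]

theorem mC_transpose (W : Matrix (Idx n) (Idx n) ℂ) : (mC W)ᵀ = mC Wᵀ := by
  ext (i | i) (j | j) <;> simp [mC_apply_ll, mC_apply_lr, mC_apply_rl, mC_apply_rr]

theorem hC_I : hC (Complex.I • (1 : Matrix (Idx n) (Idx n) ℂ)) = J₀ n := by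
  ext (i | i) (j | j) <;> simp [hC_apply_ll, hC_apply_lr, hC_apply_rl, hC_apply_rr, J₀,
    Matrix.one_apply] <;> split_ifs <;> simp

theorem trace_hC (H : Matrix (Idx n) (Idx n) ℂ) : (hC H).trace = 2 * H.trace.re := by
  simp [Matrix.trace, Fintype.sum_sum_type, hC_apply_ll, hC_apply_rr]; ring

theorem mC_mul_J₀ (W : Matrix (Idx n) (Idx n) ℂ) : mC W * J₀ n = mC (Complex.I • W) := by
  rw [← hC_I, mC_mul_hC, mul_smul_comm, mul_one]

theorem J₀_mul_mC (W : Matrix (Idx n) (Idx n) ℂ) : J₀ n * mC W = -(mC W * J₀ n) := by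
  rw [mC_mul_J₀, ← hC_I, hC_mul_mC, ← mC_neg]; simp

theorem hC_mul_J₀ (H : Matrix (Idx n) (Idx n) ℂ) : hC H * J₀ n = J₀ n * hC H := hElt_comm _ _

theorem lie_hC_mC (H W : Matrix (Idx n) (Idx n) ℂ) : ⁅hC H, mC W⁆ = mC (cj H * W - W * H) := by
  rw [Ring.lie_def, hC_mul_mC, mC_mul_hC, mC_sub]

theorem lie_mC_hC (W H : Matrix (Idx n) (Idx n) ℂ) : ⁅mC W, hC H⁆ = mC (W * H - cj H * W) := by
  rw [Ring.lie_def, hC_mul_mC, mC_mul_hC, mC_sub]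

theorem lie_mC_mC (W Z : Matrix (Idx n) (Idx n) ℂ) : ⁅mC W, mC Z⁆ = hC (cj W * Z - cj Z * W) := by
  rw [Ring.lie_def, mC_mul_mC, mC_mul_mC, hC_sub]

theorem killing_hC (H K : Matrix (Idx n) (Idx n) ℂ) :
    killing (hC H) (hC K) = (2 * (n : ℝ) - 2) * (2 * (H * K).trace.re) := by
  rw [killing, hC_mul_hC, trace_hC]

theorem killing_mC (W Z : Matrix (Idx n) (Idx n) ℂ) :
    killing (mC W) (mC Z) = (2 * (n : ℝ) - 2) * (2 * (cj W * Z).trace.re) := by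
  rw [killing, mC_mul_mC, trace_hC]

/-! ### The decomposition of `so(2n)` by the centralizer of `e`, in complex blocks -/

/-- The `2 × 2` skew matrix `ε`. -/
def eps : Matrix (Fin 2) (Fin 2) ℂ := !![0, 1; -1, 0]

theorem eps_mul_eps : eps * eps = -1 := by
  ext i j; fin_cases i <;> fin_cases j <;> simp [eps]

theorem eps_mul_eps_mul {m : Type*} (A : Matrix (Fin 2) m ℂ) : eps * (eps * A) = -A := by
  rw [← Matrix.mul_assoc, eps_mul_eps, Matrix.neg_mul, Matrix.one_mul]

theorem mul_eps_mul_eps {m : Type*} (A : Matrix m (Fin 2) ℂ) : A * eps * eps = -A := by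
  rw [Matrix.mul_assoc, eps_mul_eps, Matrix.mul_neg, Matrix.mul_one]

@[simp] theorem cj_eps : cj eps = eps := by
  ext i j; fin_cases i <;> fin_cases j <;> simp [eps]

@[simp] theorem eps_transpose : epsᵀ = -eps := by
  ext i j; fin_cases i <;> fin_cases j <;> simp [eps]

@[simp] theorem eps_conjTranspose : epsᴴ = -eps := by
  ext i j; fin_cases i <;> fin_cases j <;> simp [eps]

/-- Conjugation by `ε` is the cofactor map of `2 × 2` matrices. -/
theorem eps_mul_mul_eps (A : Matrix (Fin 2) (Fin 2) ℂ) : eps * A * eps = Aᵀ - A.trace • 1 := by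
  ext i j; fin_cases i <;> fin_cases j <;>
    simp [eps, Matrix.mul_apply, Matrix.vecMul, dotProduct, Matrix.trace_fin_two]

theorem cj_mul_eps {K : Matrix (Fin 2) (Fin 2) ℂ} (h : Kᴴ = -K) (h0 : K.trace = 0) :
    cj K * eps = eps * K := by
  have h1 : cj K = -Kᵀ := by
    rw [← cj_conjTranspose, h, cj_neg, neg_neg]
  have h2 := eps_mul_mul_eps K
  rw [h0, zero_smul, sub_zero] at h2
  rw [h1, ← h2, Matrix.neg_mul, mul_eps_mul_eps, neg_neg]

theorem exists_smul_eps {A : Matrix (Fin 2) (Fin 2) ℂ} (h : Aᵀ = -A) : ∃ c : ℂ, A = c • eps := by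
  refine ⟨A 0 1, ?_⟩
  have h1 : ∀ i j, A j i = -A i j := fun i j => congrFun (congrFun h i) j
  have h00 : A 0 0 = 0 := self_eq_neg.1 (h1 0 0)
  have h11 : A 1 1 = 0 := self_eq_neg.1 (h1 1 1)
  ext i j; fin_cases i <;> fin_cases j <;> simp [eps, h00, h11, h1 0 1]

/-- The complex matrix of `√χ e`. -/
def eBlock (n : ℕ) : Matrix (Idx n) (Idx n) ℂ := Matrix.fromBlocks eps 0 0 0

/-- The complex matrix of a general element of `𝔪`: a skew matrix in blocks. -/
def mBlock (c : ℂ) (B : Matrix (Fin (n - 2)) (Fin 2) ℂ)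
    (D : Matrix (Fin (n - 2)) (Fin (n - 2)) ℂ) : Matrix (Idx n) (Idx n) ℂ :=
  Matrix.fromBlocks (c • eps) Bᵀ (-B) D

/-- The complex matrix of the element of `𝔥_⊥` with Hasimoto variables `(r, V)`. -/
noncomputable def uBlock (r : ℝ) (V : Matrix (Fin (n - 2)) (Fin 2) ℂ) :
    Matrix (Idx n) (Idx n) ℂ :=
  Matrix.fromBlocks ((-2 * Complex.I * r) • 1) (eps * Vᵀ) (cj V * eps) 0

theorem χ_pos (hn : 3 ≤ n) : 0 < χ n := by
  have : (3 : ℝ) ≤ n := by exact_mod_cast hn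
  rw [χ]; linarith

theorem ee_eq : ee n = mC ((1 / √(χ n)) • eBlock n) := by
  rw [mC_smul, ee]
  congr 1
  rw [mC, eBlock, Matrix.fromBlocks_map, Matrix.fromBlocks_map]
  have him : eps.map Complex.im = 0 := by
    ext i j; fin_cases i <;> fin_cases j <;> simp [eps]
  congr 2
  · ext i j; fin_cases i <;> fin_cases j <;> simp [eps]
  · simp [him]

theorem mPerp_eq (r : ℝ) (V : Matrix (Fin (n - 2)) (Fin 2) ℂ) :
    mPerp r V = mC (mBlock (Complex.I * r) V 0) := by
  rw [mC, mBlock, Matrix.fromBlocks_map, Matrix.fromBlocks_map, mPerp]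
  congr 2
  · ext i j; fin_cases i <;> fin_cases j <;> simp [eps]
  · ext i j; fin_cases i <;> fin_cases j <;> simp [eps]

theorem suEmbed_eq (K : Matrix (Fin 2) (Fin 2) ℂ) :
    suEmbed n K = hC (Matrix.fromBlocks K 0 0 0) := by
  rw [hC, Matrix.fromBlocks_map, Matrix.fromBlocks_map, suEmbed]
  congr 2

theorem mBlock_transpose (c : ℂ) (B : Matrix (Fin (n - 2)) (Fin 2) ℂ)
    {D : Matrix (Fin (n - 2)) (Fin (n - 2)) ℂ} (hD : Dᵀ = -D) :
    (mBlock c B D)ᵀ = -mBlock c B D := by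
  rw [mBlock, Matrix.fromBlocks_transpose, Matrix.fromBlocks_neg, hD]
  simp

theorem exists_mBlock {W : Matrix (Idx n) (Idx n) ℂ} (h : Wᵀ = -W) :
    ∃ c B D, Dᵀ = -D ∧ W = mBlock c B D := by
  have h1 := h
  rw [← Matrix.fromBlocks_toBlocks W, Matrix.fromBlocks_transpose, Matrix.fromBlocks_neg,
    Matrix.fromBlocks_inj] at h1
  obtain ⟨h11, h12, h21, h22⟩ := h1
  obtain ⟨c, hc⟩ := exists_smul_eps h11
  refine ⟨c, -W.toBlocks₂₁, W.toBlocks₂₂, h22, ?_⟩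
  conv_lhs => rw [← Matrix.fromBlocks_toBlocks W]
  rw [mBlock, Matrix.fromBlocks_inj]
  refine ⟨hc, ?_, by simp, rfl⟩
  rw [Matrix.transpose_neg, h12, neg_neg]

theorem mBlock_add (c d : ℂ) (B C : Matrix (Fin (n - 2)) (Fin 2) ℂ)
    (D F : Matrix (Fin (n - 2)) (Fin (n - 2)) ℂ) :
    mBlock c B D + mBlock d C F = mBlock (c + d) (B + C) (D + F) := by
  simp only [mBlock, Matrix.fromBlocks_add, add_smul, Matrix.transpose_add, neg_add]

theorem mBlock_smul (a : ℝ) (c : ℂ) (B : Matrix (Fin (n - 2)) (Fin 2) ℂ)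
    (D : Matrix (Fin (n - 2)) (Fin (n - 2)) ℂ) :
    a • mBlock c B D = mBlock (a * c) (a • B) (a • D) := by
  simp only [mBlock, Matrix.fromBlocks_smul, Matrix.transpose_smul, smul_neg]
  congr 1
  ext i j; simp [mul_assoc]

theorem mBlock_inj {c d : ℂ} {B C : Matrix (Fin (n - 2)) (Fin 2) ℂ}
    {D F : Matrix (Fin (n - 2)) (Fin (n - 2)) ℂ} :
    mBlock c B D = mBlock d C F ↔ c = d ∧ B = C ∧ D = F := by
  refine ⟨fun h => ?_, fun ⟨h1, h2, h3⟩ => by rw [h1, h2, h3]⟩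
  rw [mBlock, mBlock, Matrix.fromBlocks_inj] at h
  obtain ⟨h1, -, h2, h3⟩ := h
  exact ⟨by simpa [eps] using congrFun (congrFun h1 0) 1, neg_injective h2, h3⟩

theorem mBlock_eq_zero_iff {c : ℂ} {B : Matrix (Fin (n - 2)) (Fin 2) ℂ}
    {D : Matrix (Fin (n - 2)) (Fin (n - 2)) ℂ} : mBlock c B D = 0 ↔ c = 0 ∧ B = 0 ∧ D = 0 := by
  have : mBlock 0 0 0 = (0 : Matrix (Idx n) (Idx n) ℂ) := by simp [mBlock]
  rw [← this, mBlock_inj]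

theorem uBlock_inj {r q : ℝ} {V V' : Matrix (Fin (n - 2)) (Fin 2) ℂ} :
    uBlock r V = uBlock q V' ↔ r = q ∧ V = V' := by
  refine ⟨fun h => ?_, fun ⟨h1, h2⟩ => by rw [h1, h2]⟩
  rw [uBlock, uBlock, Matrix.fromBlocks_inj] at h
  obtain ⟨h1, h2, -, -⟩ := h
  constructor
  · simpa using congrFun (congrFun h1 0) 0
  · have := congrArg (fun A => (eps * A)ᵀ) h2
    simpa [eps_mul_eps_mul] using this

theorem uBlock_conjTranspose (r : ℝ) (V : Matrix (Fin (n - 2)) (Fin 2) ℂ) :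
    (uBlock r V)ᴴ = -uBlock r V := by
  rw [uBlock, Matrix.fromBlocks_conjTranspose, Matrix.fromBlocks_neg, Matrix.fromBlocks_inj]
  refine ⟨?_, ?_, ?_, ?_⟩
  · simp [Matrix.conjTranspose_smul, ← neg_smul]
  · simp [Matrix.conjTranspose_mul]
  · simp [Matrix.conjTranspose_mul]
  · simp

/-- The Lie bracket of `√χ e` with a general element of `𝔪`. -/
theorem lie_eBlock (c : ℂ) (B : Matrix (Fin (n - 2)) (Fin 2) ℂ)
    (D : Matrix (Fin (n - 2)) (Fin (n - 2)) ℂ) :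
    ⁅mC (eBlock n), mC (mBlock c B D)⁆ = hC (uBlock c.im B) := by
  rw [lie_mC_mC, eBlock, mBlock, uBlock, cj_fromBlocks, cj_fromBlocks, Matrix.fromBlocks_multiply,
    Matrix.fromBlocks_multiply, sub_eq_add_neg, Matrix.fromBlocks_neg, Matrix.fromBlocks_add]
  congr 2
  · simp only [cj_eps, mul_smul_comm, eps_mul_eps, cj_smul, smul_mul_assoc, cj_zero,
      Matrix.zero_mul, Matrix.mul_zero, add_zero, ← sub_smul, ← sub_eq_add_neg, smul_neg,
      neg_sub_neg]
    congr 1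
    apply Complex.ext <;> simp
    ring
  all_goals simp

/-- The action of `ad(√χ e)` on `𝔥_⊥`. -/
theorem lie_eBlock_uBlock (r : ℝ) (V : Matrix (Fin (n - 2)) (Fin 2) ℂ) :
    ⁅mC (eBlock n), hC (uBlock r V)⁆ = -mPerp (4 * r) V := by
  rw [lie_mC_hC, mPerp_eq, ← mC_neg, eBlock, mBlock, uBlock, cj_fromBlocks,
    Matrix.fromBlocks_multiply, Matrix.fromBlocks_multiply, sub_eq_add_neg, Matrix.fromBlocks_neg,
    Matrix.fromBlocks_add, Matrix.fromBlocks_neg]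
  congr 2
  · ext i j; fin_cases i <;> fin_cases j <;> simp [eps, Complex.conj_ofNat] <;> ring
  · simp [eps_mul_eps_mul]
  · simp [mul_eps_mul_eps]
  · simp

theorem sq_one_div_sqrt (hn : 3 ≤ n) : (1 / √(χ n)) * (1 / √(χ n)) = 1 / χ n := by
  rw [div_mul_div_comm, Real.mul_self_sqrt (χ_pos hn).le, one_mul]

theorem sqrt_χ_mul (hn : 3 ≤ n) : √(χ n) * (1 / √(χ n)) = 1 :=
  mul_one_div_cancel (Real.sqrt_pos.2 (χ_pos hn)).ne'

theorem lie_smul_left' (c : ℝ) (Y Z : Mat n) : ⁅c • Y, Z⁆ = c • ⁅Y, Z⁆ := by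
  simp only [Ring.lie_def, smul_mul_assoc, mul_smul_comm, smul_sub]

theorem lie_smul_right' (c : ℝ) (Y Z : Mat n) : ⁅Y, c • Z⁆ = c • ⁅Y, Z⁆ := by
  simp only [Ring.lie_def, smul_mul_assoc, mul_smul_comm, smul_sub]

theorem lie_ee_mBlock (c : ℂ) (B : Matrix (Fin (n - 2)) (Fin 2) ℂ)
    (D : Matrix (Fin (n - 2)) (Fin (n - 2)) ℂ) :
    ⁅ee n, mC (mBlock c B D)⁆ = (1 / √(χ n)) • hC (uBlock c.im B) := by
  rw [ee_eq, mC_smul, lie_smul_left', lie_eBlock]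

/-- `𝔥_⊥` in terms of the Hasimoto variables. -/
theorem sqrt_smul_lie_ee_mPerp (hn : 3 ≤ n) (r : ℝ) (V : Matrix (Fin (n - 2)) (Fin 2) ℂ) :
    √(χ n) • ⁅ee n, mPerp r V⁆ = hC (uBlock r V) := by
  rw [mPerp_eq, lie_ee_mBlock, smul_smul, sqrt_χ_mul hn, one_smul]
  simp

theorem lie_ee_lie_ee (hn : 3 ≤ n) (c : ℂ) (B : Matrix (Fin (n - 2)) (Fin 2) ℂ)
    (D : Matrix (Fin (n - 2)) (Fin (n - 2)) ℂ) :
    ⁅ee n, ⁅ee n, mC (mBlock c B D)⁆⁆ = (-(1 / χ n)) • mPerp (4 * c.im) B := by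
  rw [lie_ee_mBlock, lie_smul_right', ee_eq, mC_smul, lie_smul_left', lie_eBlock_uBlock,
    smul_smul, sq_one_div_sqrt hn, smul_neg, neg_smul]

theorem mPerp_add (r q : ℝ) (V V' : Matrix (Fin (n - 2)) (Fin 2) ℂ) :
    mPerp r V + mPerp q V' = mPerp (r + q) (V + V') := by
  simp only [mPerp_eq, ← mC_add, mBlock_add]; simp [mul_add]

theorem mPerp_smul (a r : ℝ) (V : Matrix (Fin (n - 2)) (Fin 2) ℂ) :
    a • mPerp r V = mPerp (a * r) (a • V) := by
  simp only [mPerp_eq, ← mC_smul, mBlock_smul, smul_zero]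
  congr 2
  push_cast; ring

theorem lie_ee_lie_ee_mPerp (hn : 3 ≤ n) (r : ℝ) (V : Matrix (Fin (n - 2)) (Fin 2) ℂ) :
    ⁅ee n, ⁅ee n, mPerp r V⁆⁆ = (-(1 / χ n)) • mPerp (4 * r) V := by
  rw [mPerp_eq, lie_ee_lie_ee hn]; simp

theorem projPerp_mC (hn : 3 ≤ n) (c : ℂ) (B : Matrix (Fin (n - 2)) (Fin 2) ℂ)
    (D : Matrix (Fin (n - 2)) (Fin (n - 2)) ℂ) :
    projPerp (mC (mBlock c B D)) = mPerp c.im B := by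
  have hχ := (χ_pos hn).ne'
  rw [projPerp, lie_ee_lie_ee hn, lie_smul_right', lie_smul_right', lie_ee_lie_ee_mPerp hn,
    smul_smul, smul_smul, mPerp_smul, mPerp_smul, mPerp_add, mPerp_smul]
  congr 1
  · field_simp; ring
  · rw [← add_smul, smul_smul]
    convert one_smul ℝ B using 2
    field_simp; ring

theorem mem_uLie_iff {Y : Mat n} : Y ∈ uLie n ↔ ∃ H, Hᴴ = -H ∧ Y = hC H := by
  constructor
  · rintro ⟨C, D, hC', hD, rfl⟩
    refine ⟨Matrix.of fun i j => ⟨C i j, D i j⟩, ?_, ?_⟩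
    · ext i j
      have h1 : C j i = -C i j := congrFun (congrFun hC' i) j
      have h2 : D j i = D i j := congrFun (congrFun hD i) j
      apply Complex.ext <;> simp [h1, h2]
    · ext (i | i) (j | j) <;> simp [hElt, hC_apply_ll, hC_apply_lr, hC_apply_rl, hC_apply_rr]
  · rintro ⟨H, hH, rfl⟩
    have h1 : ∀ i j, starRingEnd ℂ (H j i) = -H i j := fun i j => congrFun (congrFun hH i) j
    refine ⟨H.map Complex.re, H.map Complex.im, ?_, ?_, rfl⟩
    · ext i j; simpa using congrArg Complex.re (h1 i j)
    · ext i j; simpa using congrArg Complex.im (h1 i j)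

/-- The Frobenius norm is definite: a matrix with `Re tr(Aᴴ A) = 0` vanishes. -/
theorem eq_zero_of_re_trace {l m : Type*} [Fintype l] [Fintype m] {A : Matrix l m ℂ}
    (h : (Aᴴ * A).trace.re = 0) : A = 0 := by
  have h1 : (Aᴴ * A).trace.re = ∑ j, ∑ i, Complex.normSq (A i j) := by
    simp [Matrix.trace, Matrix.mul_apply, Complex.normSq_apply]
  rw [h1, Finset.sum_eq_zero_iff_of_nonneg
    (fun j _ => Finset.sum_nonneg fun i _ => Complex.normSq_nonneg _)] at h
  ext i j
  have h2 := h j (Finset.mem_univ _)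
  rw [Finset.sum_eq_zero_iff_of_nonneg (fun i _ => Complex.normSq_nonneg _)] at h2
  exact Complex.normSq_eq_zero.1 (h2 i (Finset.mem_univ _))

/-- The centralizer of `e` contains `su(2) ⊕ u(n-2)`. -/
theorem mem_hPar {K : Matrix (Fin 2) (Fin 2) ℂ} {F : Matrix (Fin (n - 2)) (Fin (n - 2)) ℂ}
    (hK : Kᴴ = -K) (hK0 : K.trace = 0) (hF : Fᴴ = -F) :
    hC (Matrix.fromBlocks K 0 0 F) ∈ hPar n := by
  refine ⟨mem_uLie_iff.2 ⟨_, ?_, rfl⟩, ?_⟩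
  · rw [Matrix.fromBlocks_conjTranspose, hK, hF, Matrix.fromBlocks_neg]; simp
  · rw [ee_eq, lie_hC_mC, eBlock, cj_fromBlocks, mul_smul_comm, smul_mul_assoc, ← smul_sub,
      Matrix.fromBlocks_multiply, Matrix.fromBlocks_multiply]
    simp [cj_mul_eps hK hK0]

/-- The centralizer of `e` is `su(2) ⊕ u(n-2)`. -/
theorem exists_of_mem_hPar (hn : 3 ≤ n) {Y : Mat n} (h : Y ∈ hPar n) :
    ∃ K F, Matrix.trace K = 0 ∧ Y = hC (Matrix.fromBlocks K 0 0 F) := by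
  obtain ⟨h1, h2⟩ := h
  obtain ⟨H, hH, rfl⟩ := mem_uLie_iff.1 h1
  have hs : (1 / √(χ n)) ≠ 0 := (one_div_pos.2 (Real.sqrt_pos.2 (χ_pos hn))).ne'
  rw [ee_eq, mC_smul, lie_smul_right', smul_eq_zero_iff_right hs, lie_hC_mC, ← mC_zero] at h2
  have h3 := mC_injective h2
  have hH' := hH
  rw [← Matrix.fromBlocks_toBlocks H, Matrix.fromBlocks_conjTranspose, Matrix.fromBlocks_neg,
    Matrix.fromBlocks_inj] at hH
  obtain ⟨hK, hQ, hQ', hF⟩ := hH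
  rw [← Matrix.fromBlocks_toBlocks H, eBlock, cj_fromBlocks, Matrix.fromBlocks_multiply,
    Matrix.fromBlocks_multiply, sub_eq_add_neg, Matrix.fromBlocks_neg, Matrix.fromBlocks_add,
    ← Matrix.fromBlocks_zero, Matrix.fromBlocks_inj] at h3
  obtain ⟨h11, h12, -, -⟩ := h3
  simp at h11 h12
  have h12' : H.toBlocks₁₂ = 0 := by
    have := congrArg (fun A => -(eps * A)) h12
    simpa [eps_mul_eps_mul] using this
  refine ⟨H.toBlocks₁₁, H.toBlocks₂₂, ?_, ?_⟩
  · have hc : cj H.toBlocks₁₁ = -(H.toBlocks₁₁)ᵀ := by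
      rw [← cj_conjTranspose, hK, cj_neg, neg_neg]
    have h4 : cj H.toBlocks₁₁ * eps * eps = eps * H.toBlocks₁₁ * eps := by
      rw [add_neg_eq_zero.1 h11]
    rw [mul_eps_mul_eps, eps_mul_mul_eps, hc, neg_neg] at h4
    have h5 : H.toBlocks₁₁.trace • (1 : Matrix (Fin 2) (Fin 2) ℂ) = 0 := by
      rw [eq_comm, sub_eq_self] at h4; exact h4
    simpa using congrFun (congrFun h5 0) 0
  · conv_lhs => rw [← Matrix.fromBlocks_toBlocks H]
    have h21 : H.toBlocks₂₁ = 0 := by simpa [h12'] using hQ'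
    rw [h12', h21]

/-- `𝔥_⊥` consists of the matrices of the Hasimoto variables. -/
theorem mem_hPerp_iff (hn : 3 ≤ n) {Y : Mat n} : Y ∈ hPerp n ↔ ∃ r V, Y = hC (uBlock r V) := by
  have hc : (2 * (n : ℝ) - 2) * 2 ≠ 0 := by
    have : (3 : ℝ) ≤ n := by exact_mod_cast hn
    have : 0 < (2 * (n : ℝ) - 2) * 2 := by linarith
    exact this.ne'
  constructor
  · rintro ⟨h1, h2⟩
    obtain ⟨H, hH, rfl⟩ := mem_uLie_iff.1 h1
    rw [← Matrix.fromBlocks_toBlocks H, Matrix.fromBlocks_conjTranspose, Matrix.fromBlocks_neg,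
      Matrix.fromBlocks_inj] at hH
    obtain ⟨hP, hQ, hQ', hR⟩ := hH
    set P := H.toBlocks₁₁ with hPdef
    set R := H.toBlocks₂₂ with hRdef
    have hH : H = Matrix.fromBlocks P H.toBlocks₁₂ H.toBlocks₂₁ R :=
      (Matrix.fromBlocks_toBlocks H).symm
    have key : ∀ K F, Kᴴ = -K → Matrix.trace K = 0 → Fᴴ = -F →
        (P * K).trace.re + (R * F).trace.re = 0 := by
      intro K F hK hK0 hF
      have h3 := h2 _ (mem_hPar hK hK0 hF)
      rw [killing_hC, ← mul_assoc, mul_eq_zero_iff_left hc, hH, Matrix.fromBlocks_multiply,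
        trace_fromBlocks] at h3
      simpa using h3
    have hR0 : R = 0 := by
      have h3 := key 0 R (by simp) (by simp) hR
      refine eq_zero_of_re_trace ?_
      rw [hR]; simpa using h3
    -- The traceless part of `P` is orthogonal to `su(2)`, which contains it.
    set c := P.trace / 2 with hcdef
    have hcI : starRingEnd ℂ c = -c := by
      have := congrArg Matrix.trace hP
      rw [Matrix.trace_conjTranspose, Matrix.trace_neg] at this
      rw [hcdef, map_div₀, ← neg_div]
      congr 1
      exact Complex.conj_ofNat 2
    have hP0 : P - c • 1 = 0 := by
      have hK : (P - c • 1)ᴴ = -(P - c • 1) := by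
        rw [Matrix.conjTranspose_sub, hP, Matrix.conjTranspose_smul, Matrix.conjTranspose_one]
        have : star c = -c := hcI
        rw [this, neg_smul]; abel
      have hK0 : (P - c • (1 : Matrix (Fin 2) (Fin 2) ℂ)).trace = 0 := by
        rw [Matrix.trace_sub, Matrix.trace_smul, Matrix.trace_one, hcdef]; simp
      refine eq_zero_of_re_trace ?_
      have h3 := key _ 0 hK hK0 (by simp)
      rw [Matrix.mul_zero, Matrix.trace_zero, Complex.zero_re, add_zero] at h3
      rw [hK, Matrix.neg_mul, Matrix.trace_neg, Matrix.sub_mul, Matrix.trace_sub, smul_mul_assoc,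
        Matrix.one_mul, Matrix.trace_smul, hK0, smul_zero, sub_zero, Complex.neg_re, h3, neg_zero]
    -- The upper left block is `c = -2ir`, and the upper right one is `ε Vᵀ`.
    refine ⟨-c.im / 2, -(eps * H.toBlocks₁₂)ᵀ, ?_⟩
    congr 1
    rw [hH, uBlock, Matrix.fromBlocks_inj]
    refine ⟨?_, ?_, ?_, hR0⟩
    · rw [sub_eq_zero.1 hP0]
      congr 1
      have h4 := congrArg Complex.re hcI
      simp at h4
      apply Complex.ext
      · simp; linarith
      · simp; ring
    · rw [Matrix.transpose_neg, Matrix.transpose_transpose, Matrix.mul_neg, eps_mul_eps_mul,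
        neg_neg]
      simp
    · have : H.toBlocks₂₁ = -(H.toBlocks₁₂)ᴴ := by rw [hQ', neg_neg]
      simp [this, Matrix.mul_assoc, eps_mul_eps]
  · rintro ⟨r, V, rfl⟩
    refine ⟨mem_uLie_iff.2 ⟨_, uBlock_conjTranspose r V, rfl⟩, fun Y hY => ?_⟩
    obtain ⟨K, F, hK0, rfl⟩ := exists_of_mem_hPar hn hY
    rw [killing_hC, uBlock, Matrix.fromBlocks_multiply, trace_fromBlocks]
    simp [hK0]

/-- Under the identification of `𝔪_⊥^ℂ` with pairs of complex vectors, `-ad(K)` is multiplication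
by `K` from the right. -/
theorem lie_suEmbed {K : Matrix (Fin 2) (Fin 2) ℂ} (hK : Kᴴ = -K) (hK0 : K.trace = 0) (c : ℂ)
    (B : Matrix (Fin (n - 2)) (Fin 2) ℂ) (D : Matrix (Fin (n - 2)) (Fin (n - 2)) ℂ) :
    -⁅suEmbed n K, mC (mBlock c B D)⁆ = mPerp 0 (B * K) := by
  have hc : cj K = -Kᵀ := by rw [← cj_conjTranspose, hK, cj_neg, neg_neg]
  rw [suEmbed_eq, lie_hC_mC, mPerp_eq, ← mC_neg, mBlock, mBlock, cj_fromBlocks,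
    Matrix.fromBlocks_multiply, Matrix.fromBlocks_multiply, sub_eq_add_neg, Matrix.fromBlocks_neg,
    Matrix.fromBlocks_add, Matrix.fromBlocks_neg]
  congr 2
  · simp [cj_mul_eps hK hK0]
  · simp [hc]
  · simp
  · simp

/-! ### Tangent vectors at a point in terms of a frame -/

theorem frame_conj_mul (g : SO n) (Y Z : Mat n) :
    ((g : Mat n) * Y * (g : Mat n)ᵀ) * ((g : Mat n) * Z * (g : Mat n)ᵀ) =
      (g : Mat n) * (Y * Z) * (g : Mat n)ᵀ := by
  calc _ = (g : Mat n) * Y * ((g : Mat n)ᵀ * (g : Mat n)) * Z * (g : Mat n)ᵀ := by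
        simp only [mul_assoc]
    _ = _ := by rw [transpose_mul_self, mul_one]; simp only [mul_assoc]

theorem frame_conj_cancel (g : SO n) (Y : Mat n) :
    (g : Mat n)ᵀ * ((g : Mat n) * Y * (g : Mat n)ᵀ) * (g : Mat n) = Y := by
  calc _ = ((g : Mat n)ᵀ * (g : Mat n)) * Y * ((g : Mat n)ᵀ * (g : Mat n)) := by
        simp only [mul_assoc]
    _ = Y := by rw [transpose_mul_self, one_mul, mul_one]

theorem frame_conj_cancel' (g : SO n) (Y : Mat n) :
    (g : Mat n) * ((g : Mat n)ᵀ * Y * (g : Mat n)) * (g : Mat n)ᵀ = Y := by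
  calc _ = ((g : Mat n) * (g : Mat n)ᵀ) * Y * ((g : Mat n) * (g : Mat n)ᵀ) := by
        simp only [mul_assoc]
    _ = Y := by rw [mul_transpose_self, one_mul, mul_one]

theorem lie_frame_conj (g : SO n) (Y Z : Mat n) :
    ⁅(g : Mat n) * Y * (g : Mat n)ᵀ, (g : Mat n) * Z * (g : Mat n)ᵀ⁆ =
      (g : Mat n) * ⁅Y, Z⁆ * (g : Mat n)ᵀ := by
  rw [Ring.lie_def, Ring.lie_def, frame_conj_mul, frame_conj_mul, mul_sub, sub_mul]

theorem trace_frame_conj (g : SO n) (Y : Mat n) :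
    ((g : Mat n) * Y * (g : Mat n)ᵀ).trace = Y.trace := by
  rw [Matrix.trace_mul_comm, ← mul_assoc, transpose_mul_self, one_mul]

/-- The points of `M` are orthogonal complex structures. -/
theorem embed_mul_self (p : M n) : embed p * embed p = -1 := by
  induction p using QuotientGroup.induction_on with
  | H g =>
    rw [embed_mk, frame_conj_mul, J₀_mul_self, mul_neg, mul_one, neg_mul, mul_transpose_self]

/-- The tangent vector at `g J₀ gᵀ` with the components `z` in the frame `g`. -/
theorem solder_apply (g : SO n) (z : Mat n) :
    solder g z = (g : Mat n) * ⁅z, J₀ n⁆ * (g : Mat n)ᵀ := rfl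

theorem gen_apply (S Z : Mat n) : gen S Z = (-(1 / 2) : ℝ) • (Z * S) := rfl

theorem lie_mC_J₀ (W : Matrix (Idx n) (Idx n) ℂ) : ⁅mC W, J₀ n⁆ = (2 : ℝ) • (mC W * J₀ n) := by
  rw [Ring.lie_def, J₀_mul_mC, sub_neg_eq_add, two_smul]

@[simp] theorem coframe_solder_mC (g : SO n) (W : Matrix (Idx n) (Idx n) ℂ) :
    coframe g (solder g (mC W)) = mC W := coframe_solder g _ _

/-- A frame identifies the tangent space with the skew antilinear matrices. -/
theorem mem_tangent_iff (g : SO n) {Z : Mat n} :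
    Z ∈ tangent (embed (QuotientGroup.mk g : M n)) ↔
      ∃ c B D, Dᵀ = -D ∧ Z = solder g (mC (mBlock c B D)) := by
  constructor
  · rintro ⟨h1, h2⟩
    set Y := (g : Mat n)ᵀ * Z * (g : Mat n) with hY
    have hYt : Yᵀ = -Y := by
      rw [hY, Matrix.transpose_mul, Matrix.transpose_mul, h1, Matrix.transpose_transpose]
      simp [mul_assoc]
    have hZ : Z = (g : Mat n) * Y * (g : Mat n)ᵀ := (frame_conj_cancel' g Z).symm
    have hYJ : Y * J₀ n + J₀ n * Y = 0 := by
      rw [embed_mk, hZ, frame_conj_mul, frame_conj_mul, ← add_mul, ← mul_add] at h2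
      have h3 := frame_conj_cancel g (Y * J₀ n + J₀ n * Y)
      rw [h2] at h3
      simpa using h3.symm
    rw [← hC_hPart_add_mC_mPart Y, add_mul, mul_add, hC_mul_J₀, J₀_mul_mC] at hYJ
    have hH : hPart Y = 0 := by
      have h4 : (2 : ℝ) • (J₀ n * hC (hPart Y)) = 0 := by
        rw [two_smul, ← hYJ]; abel
      have h5 : J₀ n * hC (hPart Y) = 0 := by simpa using h4
      have h6 : hC (hPart Y) = 0 := by
        have := congrArg (fun A => J₀ n * A) h5
        simpa [← mul_assoc, J₀_mul_self] using this
      rw [← hC_zero] at h6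
      exact hC_injective h6
    have hYm : Y = mC (mPart Y) := by
      conv_lhs => rw [← hC_hPart_add_mC_mPart Y, hH, hC_zero, zero_add]
    have hW : ((-(Complex.I / 2)) • mPart Y)ᵀ = -((-(Complex.I / 2)) • mPart Y) := by
      rw [hYm, mC_transpose, ← mC_neg] at hYt
      rw [Matrix.transpose_smul, mC_injective hYt, smul_neg]
    obtain ⟨c, B, D, hD, hcBD⟩ := exists_mBlock hW
    refine ⟨c, B, D, hD, ?_⟩
    rw [← hcBD, solder_apply, lie_mC_J₀, mC_mul_J₀, ← mC_smul, hZ]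
    congr 2
    conv_lhs => rw [hYm]
    congr 1
    ext i j
    have h2 : Complex.I * (Complex.I / 2 * mPart Y i j) = -(mPart Y i j) / 2 := by
      linear_combination (mPart Y i j / 2) * Complex.I_mul_I
    simp [h2]
    ring
  · rintro ⟨c, B, D, hD, rfl⟩
    have hW := mBlock_transpose c B hD
    constructor
    · rw [solder_apply, lie_mC_J₀, mC_mul_J₀, ← mC_smul, Matrix.transpose_mul,
        Matrix.transpose_mul, mC_transpose, Matrix.transpose_smul, Matrix.transpose_smul, hW,
        smul_neg, smul_neg, mC_neg, Matrix.transpose_transpose]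
      simp [mul_assoc]
    · rw [solder_apply, embed_mk, frame_conj_mul, frame_conj_mul, ← add_mul, ← mul_add, lie_mC_J₀]
      have : (2 : ℝ) • (mC (mBlock c B D) * J₀ n) * J₀ n
          + J₀ n * (2 : ℝ) • (mC (mBlock c B D) * J₀ n) = 0 := by
        rw [mul_smul_comm, ← mul_assoc, J₀_mul_mC, smul_mul_assoc, neg_mul, smul_neg,
          add_neg_cancel]
      rw [this, mul_zero, zero_mul]

theorem solder_mC_injective (g : SO n) {W W' : Matrix (Idx n) (Idx n) ℂ}
    (h : solder g (mC W) = solder g (mC W')) : W = W' := by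
  have := congrArg (coframe g) h
  rw [coframe_solder_mC, coframe_solder_mC] at this
  exact mC_injective this

theorem gen_solder (g : SO n) (W : Matrix (Idx n) (Idx n) ℂ) :
    gen (embed (QuotientGroup.mk g : M n)) (solder g (mC W)) =
      (g : Mat n) * mC W * (g : Mat n)ᵀ := by
  rw [gen_apply, solder_apply, embed_mk, frame_conj_mul, lie_mC_J₀, smul_mul_assoc,
    mul_assoc (mC W), J₀_mul_self, mul_smul_comm, smul_mul_assoc, smul_smul]
  simp

theorem killing_frame_conj (g : SO n) (Y Z : Mat n) :
    killing ((g : Mat n) * Y * (g : Mat n)ᵀ) ((g : Mat n) * Z * (g : Mat n)ᵀ) = killing Y Z := by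
  rw [killing, killing, frame_conj_mul, trace_frame_conj]

theorem metric_solder (g : SO n) (c d : ℂ) (B C : Matrix (Fin (n - 2)) (Fin 2) ℂ)
    (D F : Matrix (Fin (n - 2)) (Fin (n - 2)) ℂ) :
    metric (embed (QuotientGroup.mk g : M n)) (solder g (mC (mBlock c B D)))
      (solder g (mC (mBlock d C F))) = (2 * (n : ℝ) - 2) * (2 * (2 * (starRingEnd ℂ c * d).re +
        2 * (Bᴴ * C).trace.re - (cj D * F).trace.re)) := by
  have h1 : (cj B * Cᵀ).trace = (Bᴴ * C).trace := by
    rw [← Matrix.trace_transpose, Matrix.transpose_mul, Matrix.transpose_transpose, cj_transpose,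
      Matrix.trace_mul_comm]
  have h2 : (-1 : Matrix (Fin 2) (Fin 2) ℂ).trace = -2 := by
    rw [Matrix.trace_neg, Matrix.trace_one]; simp
  rw [metric, gen_solder, gen_solder, killing_frame_conj, killing_mC, mBlock, mBlock, cj_fromBlocks,
    Matrix.fromBlocks_multiply, trace_fromBlocks]
  simp only [cj_smul, cj_eps, smul_mul_assoc, mul_smul_comm, eps_mul_eps, cj_of_transpose,
    Matrix.mul_neg, cj_neg, Matrix.neg_mul, Matrix.trace_add, Matrix.trace_smul, Matrix.trace_neg,
    h1, h2, smul_eq_mul, Complex.add_re, Complex.neg_re]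
  have h3 : (starRingEnd ℂ c * d).re = (d * starRingEnd ℂ c).re := by rw [mul_comm]
  have h4 : (d * (starRingEnd ℂ c * -2)).re = -2 * (d * starRingEnd ℂ c).re := by
    rw [show d * (starRingEnd ℂ c * -2) = ((-2 : ℝ) : ℂ) * (d * starRingEnd ℂ c) by push_cast; ring,
      Complex.re_ofReal_mul]
  rw [h3, h4]
  ring

/-- In a frame, `ad²(X)` is the square of the commutator with the components of `X`. -/
theorem adSq_solder (g : SO n) (X W : Matrix (Idx n) (Idx n) ℂ) :
    adSq (embed (QuotientGroup.mk g : M n)) (solder g (mC X)) (solder g (mC W)) =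
      solder g ⁅mC X, ⁅mC X, mC W⁆⁆ := by
  show -curvature _ _ _ _ = _
  rw [curvature, gen_solder, gen_solder, embed_mk, lie_frame_conj, lie_frame_conj, ← neg_mul,
    ← mul_neg, lie_frame_conj, solder_apply, ← neg_mul, ← mul_neg]
  congr 2
  simp only [Ring.lie_def]
  noncomm_ring

/-! ### The splitting of the tangent space along a unit direction -/

section Velocity

variable (g : SO n)

theorem solder_ee : solder g (ee n) = solder g (mC (mBlock ((1 / √(χ n) : ℝ) : ℂ) 0 0)) := by
  rw [ee_eq, eBlock, mBlock, Matrix.fromBlocks_smul]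
  congr 3
  · ext i j; simp
  all_goals simp

theorem adSq_ee (hn : 3 ≤ n) (c : ℂ) (B : Matrix (Fin (n - 2)) (Fin 2) ℂ)
    (D : Matrix (Fin (n - 2)) (Fin (n - 2)) ℂ) :
    adSq (embed (QuotientGroup.mk g : M n)) (solder g (ee n)) (solder g (mC (mBlock c B D))) =
      (-(1 / χ n)) • solder g (mPerp (4 * c.im) B) := by
  have h : ee n = mC ((1 / √(χ n)) • eBlock n) := ee_eq
  rw [← map_smul, ← lie_ee_lie_ee hn c B D, h, adSq_solder]

theorem adSq_ee_mPerp (hn : 3 ≤ n) (r : ℝ) (B : Matrix (Fin (n - 2)) (Fin 2) ℂ) :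
    adSq (embed (QuotientGroup.mk g : M n)) (solder g (ee n)) (solder g (mPerp r B)) =
      (-(1 / χ n)) • solder g (mPerp (4 * r) B) := by
  rw [mPerp_eq r, adSq_ee g hn]; simp

theorem mem_tangentPar_iff (hn : 3 ≤ n) {Z : Mat n} :
    Z ∈ tangentPar (embed (QuotientGroup.mk g : M n)) (solder g (ee n)) ↔
      ∃ (c : ℝ) (D : _), Dᵀ = -D ∧ Z = solder g (mC (mBlock c 0 D)) := by
  have hχ : -(1 / χ n) ≠ 0 := neg_ne_zero.2 (one_div_pos.2 (χ_pos hn)).ne'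
  rw [tangentPar, Submodule.mem_inf, mem_tangent_iff, LinearMap.mem_ker]
  constructor
  · rintro ⟨⟨c, B, D, hD, rfl⟩, h⟩
    rw [adSq_ee g hn, smul_eq_zero_iff_right hχ, mPerp_eq] at h
    have h1 : mBlock (Complex.I * (4 * c.im : ℝ)) B 0 = 0 := by
      apply solder_mC_injective g
      rw [h, mC_zero, map_zero]
    obtain ⟨h2, rfl, -⟩ := mBlock_eq_zero_iff.1 h1
    have h3 : c.im = 0 := by simpa using h2
    refine ⟨c.re, D, hD, ?_⟩
    congr 3
    apply Complex.ext <;> simp [h3]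
  · rintro ⟨c, D, hD, rfl⟩
    refine ⟨⟨c, 0, D, hD, rfl⟩, ?_⟩
    rw [adSq_ee g hn, mPerp_eq]
    simp [mBlock]

theorem metric_factor_pos (hn : 3 ≤ n) : 0 < 2 * (n : ℝ) - 2 := by
  have : (3 : ℝ) ≤ n := by exact_mod_cast hn
  linarith

theorem mem_tangentPerp_iff (hn : 3 ≤ n) {Z : Mat n} :
    Z ∈ tangentPerp (embed (QuotientGroup.mk g : M n)) (solder g (ee n)) ↔
      ∃ r B, Z = solder g (mPerp r B) := by
  have hpos := (metric_factor_pos hn).ne'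
  constructor
  · rintro ⟨h1, h2⟩
    obtain ⟨c, B, D, hD, rfl⟩ := (mem_tangent_iff g).1 h1
    have h3 := h2 _ ((mem_tangentPar_iff g hn).2 ⟨1, 0, by simp, rfl⟩)
    have h4 := h2 _ ((mem_tangentPar_iff g hn).2 ⟨0, D, hD, rfl⟩)
    rw [metric_solder, mul_eq_zero_iff_left hpos] at h3 h4
    have hc : c.re = 0 := by simpa using h3
    have hD0 : D = 0 := by
      apply eq_zero_of_re_trace
      have : Dᴴ = -cj D := by rw [← cj_transpose, ← cj_neg, ← hD]; ext; simp
      rw [this]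
      simpa using h4
    refine ⟨c.im, B, ?_⟩
    rw [mPerp_eq, hD0]
    congr 3
    apply Complex.ext <;> simp [hc]
  · rintro ⟨r, B, rfl⟩
    rw [mPerp_eq]
    refine ⟨(mem_tangent_iff g).2 ⟨_, _, _, by simp, rfl⟩, fun W hW => ?_⟩
    obtain ⟨c, D, -, rfl⟩ := (mem_tangentPar_iff g hn).1 hW
    rw [metric_solder]
    simp

/-- The polynomial in `ad²` is the projection to its `-1/χ` eigenspace. -/
theorem projC_mPerp (hn : 3 ≤ n) (r : ℝ) (B : Matrix (Fin (n - 2)) (Fin 2) ℂ) :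
    projC (embed (QuotientGroup.mk g : M n)) (solder g (ee n)) (solder g (mPerp r B)) =
      solder g (mPerp 0 B) := by
  have hχ := (χ_pos hn).ne'
  simp only [projC, LinearMap.smul_apply, LinearMap.comp_apply, LinearMap.add_apply,
    LinearMap.id_apply, adSq_ee_mPerp g hn, ← map_add, mPerp_smul, mPerp_add, ← map_smul]
  congr 2
  · field_simp; ring
  · simp only [smul_smul, ← add_smul]
    convert one_smul ℝ B using 2
    field_simp; ring

/-- The polynomial in `ad²` is the projection to its `-4/χ` eigenspace. -/
theorem projR_mPerp (hn : 3 ≤ n) (r : ℝ) (B : Matrix (Fin (n - 2)) (Fin 2) ℂ) :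
    projR (embed (QuotientGroup.mk g : M n)) (solder g (ee n)) (solder g (mPerp r B)) =
      solder g (mPerp r 0) := by
  have hχ := (χ_pos hn).ne'
  simp only [projR, LinearMap.smul_apply, LinearMap.comp_apply, LinearMap.add_apply,
    LinearMap.id_apply, adSq_ee_mPerp g hn, ← map_add, mPerp_smul, mPerp_add, ← map_smul]
  congr 2
  · field_simp; ring
  · simp only [smul_smul, ← add_smul]
    convert zero_smul ℝ B using 2
    field_simp; ring

theorem mem_tangentC_iff (hn : 3 ≤ n) {Z : Mat n} :
    Z ∈ tangentC (embed (QuotientGroup.mk g : M n)) (solder g (ee n)) ↔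
      ∃ B, Z = solder g (mPerp 0 B) := by
  rw [tangentC, Submodule.mem_map]
  constructor
  · rintro ⟨Y, hY, rfl⟩
    obtain ⟨r, B, rfl⟩ := (mem_tangentPerp_iff g hn).1 hY
    exact ⟨B, projC_mPerp g hn r B⟩
  · rintro ⟨B, rfl⟩
    exact ⟨_, (mem_tangentPerp_iff g hn).2 ⟨0, B, rfl⟩, projC_mPerp g hn 0 B⟩

theorem mem_tangentR_iff (hn : 3 ≤ n) {Z : Mat n} :
    Z ∈ tangentR (embed (QuotientGroup.mk g : M n)) (solder g (ee n)) ↔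
      ∃ r, Z = solder g (mPerp r 0) := by
  rw [tangentR, Submodule.mem_map]
  constructor
  · rintro ⟨Y, hY, rfl⟩
    obtain ⟨r, B, rfl⟩ := (mem_tangentPerp_iff g hn).1 hY
    exact ⟨r, projR_mPerp g hn r B⟩
  · rintro ⟨r, rfl⟩
    exact ⟨_, (mem_tangentPerp_iff g hn).2 ⟨r, 0, rfl⟩, projR_mPerp g hn r 0⟩

theorem solder_mPerp_inj {r q : ℝ} {B C : Matrix (Fin (n - 2)) (Fin 2) ℂ}
    (h : solder g (mPerp r B) = solder g (mPerp q C)) : r = q ∧ B = C := by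
  rw [mPerp_eq, mPerp_eq] at h
  obtain ⟨h1, h2, -⟩ := mBlock_inj.1 (solder_mC_injective g h)
  exact ⟨by simpa using h1, h2⟩

/-- The parametrization of the `-1/χ` eigenspace by pairs of complex vectors. -/
noncomputable def solderC : Matrix (Fin (n - 2)) (Fin 2) ℂ →ₗ[ℝ] Mat n where
  toFun B := solder g (mPerp 0 B)
  map_add' B C := by rw [← map_add, mPerp_add, add_zero]
  map_smul' a B := by rw [RingHom.id_apply, ← map_smul, mPerp_smul, mul_zero]

/-- The parametrization of the `-4/χ` eigenspace. -/
noncomputable def solderR : ℝ →ₗ[ℝ] Mat n where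
  toFun r := solder g (mPerp r 0)
  map_add' r q := by rw [← map_add, mPerp_add, add_zero]
  map_smul' a r := by rw [RingHom.id_apply, ← map_smul, mPerp_smul, smul_zero, smul_eq_mul]

theorem finrank_tangentC (hn : 3 ≤ n) :
    Module.finrank ℝ (tangentC (embed (QuotientGroup.mk g : M n)) (solder g (ee n))) =
      4 * (n - 2) := by
  have h : tangentC (embed (QuotientGroup.mk g : M n)) (solder g (ee n)) =
      LinearMap.range (solderC g) := by
    ext Z
    rw [mem_tangentC_iff g hn]
    exact ⟨fun ⟨B, hB⟩ => ⟨B, hB.symm⟩, fun ⟨B, hB⟩ => ⟨B, hB.symm⟩⟩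
  rw [h, LinearMap.finrank_range_of_inj fun B C hBC => (solder_mPerp_inj g hBC).2,
    Module.finrank_matrix, Complex.finrank_real_complex]
  simp
  ring

theorem finrank_tangentR (hn : 3 ≤ n) :
    Module.finrank ℝ (tangentR (embed (QuotientGroup.mk g : M n)) (solder g (ee n))) = 1 := by
  have h : tangentR (embed (QuotientGroup.mk g : M n)) (solder g (ee n)) =
      LinearMap.range (solderR g) := by
    ext Z
    rw [mem_tangentR_iff g hn]
    exact ⟨fun ⟨B, hB⟩ => ⟨B, hB.symm⟩, fun ⟨B, hB⟩ => ⟨B, hB.symm⟩⟩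
  rw [h, LinearMap.finrank_range_of_inj fun B C hBC => (solder_mPerp_inj g hBC).1,
    Module.finrank_self]

theorem metric_ee (hn : 3 ≤ n) :
    metric (embed (QuotientGroup.mk g : M n)) (solder g (ee n)) (solder g (ee n)) = 1 := by
  rw [solder_ee, metric_solder, Complex.conj_ofReal, ← Complex.ofReal_mul, sq_one_div_sqrt hn,
    Complex.ofReal_re]
  have := (χ_pos hn).ne'
  have h2 : χ n = 4 * (2 * (n : ℝ) - 2) := by rw [χ]; ring
  simp
  field_simp
  rw [h2]; ring

/-! ### The quaternionic structure -/

/-- In a frame, the map of `K` acts on `(v₁, v₂)` as the right multiplication by `K`, and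
annihilates all other components. -/
theorem frameMap_solder {K : Matrix (Fin 2) (Fin 2) ℂ} (hK : Kᴴ = -K) (hK0 : K.trace = 0) (c : ℂ)
    (B : Matrix (Fin (n - 2)) (Fin 2) ℂ) (D : Matrix (Fin (n - 2)) (Fin (n - 2)) ℂ) :
    frameMap g K (solder g (mC (mBlock c B D))) = solder g (mPerp 0 (B * K)) := by
  show solder g (-⁅suEmbed n K, coframe g _⁆) = _
  rw [coframe_solder_mC, lie_suEmbed hK hK0]

theorem frameMap_mPerp {K : Matrix (Fin 2) (Fin 2) ℂ} (hK : Kᴴ = -K) (hK0 : K.trace = 0) (r : ℝ)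
    (B : Matrix (Fin (n - 2)) (Fin 2) ℂ) :
    frameMap g K (solder g (mPerp r B)) = solder g (mPerp 0 (B * K)) := by
  rw [mPerp_eq r, frameMap_solder g hK hK0]

theorem suEmbed_add (K L : Matrix (Fin 2) (Fin 2) ℂ) :
    suEmbed n (K + L) = suEmbed n K + suEmbed n L := by
  simp only [suEmbed_eq, ← hC_add, Matrix.fromBlocks_add, add_zero]

theorem suEmbed_smul (a : ℝ) (K : Matrix (Fin 2) (Fin 2) ℂ) :
    suEmbed n (a • K) = a • suEmbed n K := by
  simp only [suEmbed_eq, ← hC_smul, Matrix.fromBlocks_smul, smul_zero]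

theorem frameMap_add (K L : Matrix (Fin 2) (Fin 2) ℂ) :
    frameMap g (K + L) = frameMap g K + frameMap g L := by
  ext1 Z
  show solder g (-⁅suEmbed n (K + L), coframe g Z⁆) =
    solder g (-⁅suEmbed n K, coframe g Z⁆) + solder g (-⁅suEmbed n L, coframe g Z⁆)
  rw [← map_add, suEmbed_add]
  congr 1
  simp only [Ring.lie_def]
  noncomm_ring

theorem frameMap_smul (a : ℝ) (K : Matrix (Fin 2) (Fin 2) ℂ) :
    frameMap g (a • K) = a • frameMap g K := by
  ext1 Z
  show solder g (-⁅suEmbed n (a • K), coframe g Z⁆) = a • solder g (-⁅suEmbed n K, coframe g Z⁆)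
  rw [suEmbed_smul, lie_smul_left', ← smul_neg, map_smul]

theorem suGen_eq (a : ℝ) (b : ℂ) : suGen a b =
    a • (Complex.I • pauli₃) + (-b.re) • (Complex.I • pauli₂) + b.im • (Complex.I • pauli₁) := by
  ext i j
  fin_cases i <;> fin_cases j <;> apply Complex.ext <;> simp [suGen, pauli₁, pauli₂, pauli₃]

theorem suGen_conjTranspose (a : ℝ) (b : ℂ) : (suGen a b)ᴴ = -suGen a b := by
  ext i j
  fin_cases i <;> fin_cases j <;> simp [suGen]

theorem suGen_trace (a : ℝ) (b : ℂ) : (suGen a b).trace = 0 := by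
  simp [suGen, Matrix.trace_fin_two]

theorem suGen_mul_self {a : ℝ} {b : ℂ} (hab : a ^ 2 + ‖b‖ ^ 2 = 1) :
    suGen a b * suGen a b = -1 := by
  have h : (a : ℂ) * a + b * starRingEnd ℂ b = 1 := by
    rw [Complex.mul_conj, Complex.normSq_eq_norm_sq, ← Complex.ofReal_mul, ← Complex.ofReal_add,
      ← sq, hab, Complex.ofReal_one]
  ext i j
  fin_cases i <;> fin_cases j <;> simp [suGen, Matrix.mul_apply, Fin.sum_univ_two]
  · linear_combination (a : ℂ) * a * Complex.I_mul_I - h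
  · ring
  · ring
  · linear_combination (a : ℂ) * a * Complex.I_mul_I - h

theorem I_smul_pauli₃ : Complex.I • pauli₃ = suGen 1 0 := by simp [suGen_eq]
theorem I_smul_pauli₂ : Complex.I • pauli₂ = suGen 0 (-1) := by simp [suGen_eq]
theorem I_smul_pauli₁ : Complex.I • pauli₁ = suGen 0 Complex.I := by simp [suGen_eq]

theorem frameMap_suGen_mPerp (a : ℝ) (b : ℂ) (r : ℝ) (B : Matrix (Fin (n - 2)) (Fin 2) ℂ) :
    frameMap g (suGen a b) (solder g (mPerp r B)) = solder g (mPerp 0 (B * suGen a b)) :=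
  frameMap_mPerp g (suGen_conjTranspose a b) (suGen_trace a b) r B

theorem frameMap_suGen_suGen {a : ℝ} {b : ℂ} (hab : a ^ 2 + ‖b‖ ^ 2 = 1)
    (B : Matrix (Fin (n - 2)) (Fin 2) ℂ) :
    frameMap g (suGen a b) (frameMap g (suGen a b) (solder g (mPerp 0 B))) =
      -solder g (mPerp 0 B) := by
  rw [frameMap_suGen_mPerp, frameMap_suGen_mPerp, Matrix.mul_assoc, suGen_mul_self hab, ← map_neg,
    ← neg_one_smul ℝ (mPerp _ _), mPerp_smul]
  simp

theorem suGen_mul_suGen_jk : suGen 0 (-1) * suGen 1 0 = suGen 0 Complex.I := by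
  ext i j
  fin_cases i <;> fin_cases j <;> simp [suGen, Matrix.mul_apply, Fin.sum_univ_two]

theorem suGen_mul_suGen_ki : suGen 0 Complex.I * suGen 0 (-1) = suGen 1 0 := by
  ext i j
  fin_cases i <;> fin_cases j <;> simp [suGen, Matrix.mul_apply, Fin.sum_univ_two]

theorem suGen_mul_suGen_ij : suGen 1 0 * suGen 0 Complex.I = suGen 0 (-1) := by
  ext i j
  fin_cases i <;> fin_cases j <;> simp [suGen, Matrix.mul_apply, Fin.sum_univ_two]

theorem frameMap_suGen_R (a : ℝ) (b : ℂ) (r : ℝ) :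
    frameMap g (suGen a b) (solder g (mPerp r 0)) = 0 := by
  rw [frameMap_suGen_mPerp, Matrix.zero_mul, mPerp_eq]; simp [mBlock]

theorem frameMap_suGen_P (a : ℝ) (b : ℂ) (c : ℂ) (D : Matrix (Fin (n - 2)) (Fin (n - 2)) ℂ) :
    frameMap g (suGen a b) (solder g (mC (mBlock c 0 D))) = 0 := by
  rw [frameMap_solder g (suGen_conjTranspose a b) (suGen_trace a b), Matrix.zero_mul, mPerp_eq]
  simp [mBlock]

/-- Right multiplications by `iσ₃`, `iσ₂`, `iσ₁` are the quaternion units on pairs of complex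
vectors. -/
theorem isDegenerateQuaternionic (hn : 3 ≤ n) :
    IsDegenerateQuaternionic
      (tangentC (embed (QuotientGroup.mk g : M n)) (solder g (ee n)))
      (tangentR (embed (QuotientGroup.mk g : M n)) (solder g (ee n)))
      (tangentPar (embed (QuotientGroup.mk g : M n)) (solder g (ee n)))
      (frameMap g (Complex.I • pauli₃)) (frameMap g (Complex.I • pauli₂))
      (frameMap g (Complex.I • pauli₁)) := by
  rw [I_smul_pauli₁, I_smul_pauli₂, I_smul_pauli₃]
  constructor
  iterate 3
    intro Z hZ
    obtain ⟨B, rfl⟩ := (mem_tangentC_iff g hn).1 hZ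
    exact (mem_tangentC_iff g hn).2 ⟨_, frameMap_suGen_mPerp g _ _ _ _⟩
  iterate 3
    intro Z hZ
    obtain ⟨B, rfl⟩ := (mem_tangentC_iff g hn).1 hZ
    exact frameMap_suGen_suGen g (by simp) B
  · intro Z hZ
    obtain ⟨B, rfl⟩ := (mem_tangentC_iff g hn).1 hZ
    simp only [frameMap_suGen_mPerp, Matrix.mul_assoc, suGen_mul_suGen_jk]
  · intro Z hZ
    obtain ⟨B, rfl⟩ := (mem_tangentC_iff g hn).1 hZ
    simp only [frameMap_suGen_mPerp, Matrix.mul_assoc, suGen_mul_suGen_ki]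
  · intro Z hZ
    obtain ⟨B, rfl⟩ := (mem_tangentC_iff g hn).1 hZ
    simp only [frameMap_suGen_mPerp, Matrix.mul_assoc, suGen_mul_suGen_ij]
  · intro Z hZ
    obtain ⟨r, rfl⟩ := (mem_tangentR_iff g hn).1 hZ
    simp only [frameMap_suGen_R, and_self]
  · intro Z hZ
    obtain ⟨c, D, -, rfl⟩ := (mem_tangentPar_iff g hn).1 hZ
    simp only [frameMap_suGen_P, and_self]

theorem frameMap_adSq (hn : 3 ≤ n) (a : ℝ) (b : ℂ) {Z : Mat n}
    (hZ : Z ∈ tangent (embed (QuotientGroup.mk g : M n))) :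
    frameMap g (suGen a b) (adSq (embed (QuotientGroup.mk g : M n)) (solder g (ee n)) Z) =
      adSq (embed (QuotientGroup.mk g : M n)) (solder g (ee n)) (frameMap g (suGen a b) Z) := by
  obtain ⟨c, B, D, -, rfl⟩ := (mem_tangent_iff g).1 hZ
  rw [adSq_ee g hn, map_smul, frameMap_suGen_mPerp, frameMap_solder g (suGen_conjTranspose a b)
    (suGen_trace a b), adSq_ee_mPerp g hn, mul_zero]

theorem tangentPar_sup_tangentPerp (hn : 3 ≤ n) :
    tangentPar (embed (QuotientGroup.mk g : M n)) (solder g (ee n)) ⊔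
      tangentPerp (embed (QuotientGroup.mk g : M n)) (solder g (ee n)) =
      tangent (embed (QuotientGroup.mk g : M n)) := by
  apply le_antisymm (sup_le inf_le_left fun Z hZ => hZ.1)
  intro Z hZ
  obtain ⟨c, B, D, hD, rfl⟩ := (mem_tangent_iff g).1 hZ
  refine Submodule.mem_sup.2 ⟨_, (mem_tangentPar_iff g hn).2 ⟨c.re, D, hD, rfl⟩, _,
    (mem_tangentPerp_iff g hn).2 ⟨c.im, B, rfl⟩, ?_⟩
  rw [mPerp_eq, ← map_add, ← mC_add, mBlock_add, zero_add, add_zero, mul_comm Complex.I,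
    Complex.re_add_im]

theorem tangentPar_inf_tangentPerp (hn : 3 ≤ n) :
    tangentPar (embed (QuotientGroup.mk g : M n)) (solder g (ee n)) ⊓
      tangentPerp (embed (QuotientGroup.mk g : M n)) (solder g (ee n)) = ⊥ := by
  rw [eq_bot_iff]
  rintro Z ⟨h1, h2⟩
  obtain ⟨c, D, -, rfl⟩ := (mem_tangentPar_iff g hn).1 h1
  obtain ⟨r, B, h3⟩ := (mem_tangentPerp_iff g hn).1 h2
  rw [mPerp_eq] at h3
  obtain ⟨h4, -, h5⟩ := mBlock_inj.1 (solder_mC_injective g h3)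
  have h6 : c = 0 := by simpa using congrArg Complex.re h4
  simp [h5, h6, mBlock]

theorem tangentC_sup_tangentR (hn : 3 ≤ n) :
    tangentC (embed (QuotientGroup.mk g : M n)) (solder g (ee n)) ⊔
      tangentR (embed (QuotientGroup.mk g : M n)) (solder g (ee n)) =
      tangentPerp (embed (QuotientGroup.mk g : M n)) (solder g (ee n)) := by
  apply le_antisymm
  · refine sup_le (fun Z hZ => ?_) fun Z hZ => ?_
    · obtain ⟨B, rfl⟩ := (mem_tangentC_iff g hn).1 hZ
      exact (mem_tangentPerp_iff g hn).2 ⟨0, B, rfl⟩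
    · obtain ⟨r, rfl⟩ := (mem_tangentR_iff g hn).1 hZ
      exact (mem_tangentPerp_iff g hn).2 ⟨r, 0, rfl⟩
  · intro Z hZ
    obtain ⟨r, B, rfl⟩ := (mem_tangentPerp_iff g hn).1 hZ
    refine Submodule.mem_sup.2 ⟨_, (mem_tangentC_iff g hn).2 ⟨B, rfl⟩, _,
      (mem_tangentR_iff g hn).2 ⟨r, rfl⟩, ?_⟩
    rw [← map_add, mPerp_add, zero_add, add_zero]

theorem tangentC_inf_tangentR (hn : 3 ≤ n) :
    tangentC (embed (QuotientGroup.mk g : M n)) (solder g (ee n)) ⊓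
      tangentR (embed (QuotientGroup.mk g : M n)) (solder g (ee n)) = ⊥ := by
  rw [eq_bot_iff]
  rintro Z ⟨h1, h2⟩
  obtain ⟨B, rfl⟩ := (mem_tangentC_iff g hn).1 h1
  obtain ⟨r, h3⟩ := (mem_tangentR_iff g hn).1 h2
  obtain ⟨h4, rfl⟩ := solder_mPerp_inj g h3
  simp [mPerp_eq, mBlock]

theorem metric_tangentC_tangentR (hn : 3 ≤ n) {Y Z : Mat n}
    (hY : Y ∈ tangentC (embed (QuotientGroup.mk g : M n)) (solder g (ee n)))
    (hZ : Z ∈ tangentR (embed (QuotientGroup.mk g : M n)) (solder g (ee n))) :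
    metric (embed (QuotientGroup.mk g : M n)) Y Z = 0 := by
  obtain ⟨B, rfl⟩ := (mem_tangentC_iff g hn).1 hY
  obtain ⟨r, rfl⟩ := (mem_tangentR_iff g hn).1 hZ
  rw [mPerp_eq, mPerp_eq, metric_solder]
  simp

end Velocity

/-! ### Entrywise calculus of matrix functions -/

section Calculus

variable {α β κ E E' : Type*} [NormedAddCommGroup E] [NormedSpace ℝ E]
  [NormedAddCommGroup E'] [NormedSpace ℝ E']

/-- The matrix function `F` has the entrywise derivative `F'` at `x`. -/
def MHasDeriv (F : ℝ → Matrix α β E) (F' : Matrix α β E) (x : ℝ) : Prop :=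
  ∀ i j, HasDerivAt (fun s => F s i j) (F' i j) x

namespace MHasDeriv

variable {F G : ℝ → Matrix α β E} {F' G' : Matrix α β E} {x : ℝ}

theorem mderiv (h : MHasDeriv F F' x) : mderiv F x = F' := by
  ext i j; exact (h i j).deriv

theorem unique (h : MHasDeriv F F' x) (h' : MHasDeriv F G' x) : F' = G' := by
  rw [← h.mderiv, h'.mderiv]

theorem congr_of_eventuallyEq (h : MHasDeriv F F' x) (hFG : ∀ᶠ y in nhds x, G y = F y) :
    MHasDeriv G F' x := fun i j =>
  (h i j).congr_of_eventuallyEq (hFG.mono fun _ hy => congrFun (congrFun hy i) j)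

theorem congr_deriv (h : MHasDeriv F F' x) (hFG : F' = G') : MHasDeriv F G' x := hFG ▸ h

theorem const (A : Matrix α β E) : MHasDeriv (fun _ => A) 0 x := fun _ _ => hasDerivAt_const _ _

theorem add (h : MHasDeriv F F' x) (h' : MHasDeriv G G' x) :
    MHasDeriv (fun y => F y + G y) (F' + G') x := fun i j => (h i j).add (h' i j)

theorem sub (h : MHasDeriv F F' x) (h' : MHasDeriv G G' x) :
    MHasDeriv (fun y => F y - G y) (F' - G') x := fun i j => (h i j).sub (h' i j)

theorem neg (h : MHasDeriv F F' x) : MHasDeriv (fun y => -F y) (-F') x := fun i j => (h i j).neg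

theorem transpose (h : MHasDeriv F F' x) : MHasDeriv (fun y => (F y)ᵀ) F'ᵀ x := fun i j => h j i

theorem map (L : E →L[ℝ] E') (h : MHasDeriv F F' x) :
    MHasDeriv (fun y => (F y).map L) (F'.map L) x := fun i j =>
  L.hasFDerivAt.comp_hasDerivAt x (h i j)

theorem const_smul {R : Type*} [NormedRing R] [NormedAlgebra ℝ R] [Module R E]
    [IsBoundedSMul R E] [IsScalarTower ℝ R E] (c : R) (h : MHasDeriv F F' x) :
    MHasDeriv (fun y => c • F y) (c • F') x := fun i j => (h i j).const_smul c

theorem fromBlocks {γ δ : Type*} {A : ℝ → Matrix α γ E} {B : ℝ → Matrix α δ E}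
    {C : ℝ → Matrix β γ E} {D : ℝ → Matrix β δ E} {A' B' C' D'} (hA : MHasDeriv A A' x)
    (hB : MHasDeriv B B' x) (hC : MHasDeriv C C' x) (hD : MHasDeriv D D' x) :
    MHasDeriv (fun y => Matrix.fromBlocks (A y) (B y) (C y) (D y))
      (Matrix.fromBlocks A' B' C' D') x := by
  rintro (i | i) (j | j)
  exacts [hA i j, hB i j, hC i j, hD i j]

theorem submatrix {γ δ : Type*} (r : γ → α) (c : δ → β) (h : MHasDeriv F F' x) :
    MHasDeriv (fun y => (F y).submatrix r c) (F'.submatrix r c) x := fun i j => h (r i) (c j)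

theorem cj {F : ℝ → Matrix α β ℂ} {F' : Matrix α β ℂ} (h : MHasDeriv F F' x) :
    MHasDeriv (fun y => cj (F y)) (SU2CurveFlow.cj F') x := fun i j =>
  (Complex.conjCLE : ℂ →L[ℝ] ℂ).hasFDerivAt.comp_hasDerivAt x (h i j)

theorem conjTranspose {F : ℝ → Matrix α β ℂ} {F' : Matrix α β ℂ} (h : MHasDeriv F F' x) :
    MHasDeriv (fun y => (F y)ᴴ) F'ᴴ x := h.transpose.cj

theorem mul [Fintype β] {R : Type*} [NormedRing R] [NormedAlgebra ℝ R] {F : ℝ → Matrix α β R}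
    {G : ℝ → Matrix β κ R} {F' G'} (h : MHasDeriv F F' x) (h' : MHasDeriv G G' x) :
    MHasDeriv (fun y => F y * G y) (F' * G x + F x * G') x := fun i j => by
  simp only [Matrix.mul_apply, Matrix.add_apply, ← Finset.sum_add_distrib]
  exact HasDerivAt.fun_sum fun k _ => (h i k).mul (h' k j)

theorem smul {R : Type*} [NormedRing R] [NormedAlgebra ℝ R] {f : ℝ → R} {f' : R}
    {F : ℝ → Matrix α β R} {F'} (hf : HasDerivAt f f' x) (h : MHasDeriv F F' x) :
    MHasDeriv (fun y => f y • F y) (f' • F x + f x • F') x := fun i j => hf.mul (h i j)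

theorem trace [Fintype α] {F : ℝ → Matrix α α E} {F' : Matrix α α E} (h : MHasDeriv F F' x) :
    HasDerivAt (fun y => (F y).trace) F'.trace x :=
  HasDerivAt.fun_sum fun i _ => h i i

theorem hC {H : ℝ → Matrix (Idx n) (Idx n) ℂ} {H'} (h : MHasDeriv H H' x) :
    MHasDeriv (fun y => hC (H y)) (SU2CurveFlow.hC H') x :=
  (h.map Complex.reCLM).fromBlocks (h.map Complex.imCLM) (h.map Complex.imCLM).neg
    (h.map Complex.reCLM)

theorem mC {W : ℝ → Matrix (Idx n) (Idx n) ℂ} {W'} (h : MHasDeriv W W' x) :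
    MHasDeriv (fun y => mC (W y)) (SU2CurveFlow.mC W') x :=
  (h.map Complex.reCLM).fromBlocks (h.map Complex.imCLM) (h.map Complex.imCLM)
    (h.map Complex.reCLM).neg

end MHasDeriv

theorem _root_.HasDerivAt.complexMk {f f₁ : ℝ → ℝ} {f' f₁' x : ℝ} (h : HasDerivAt f f' x)
    (h₁ : HasDerivAt f₁ f₁' x) :
    HasDerivAt (fun y => (⟨f y, f₁ y⟩ : ℂ)) ⟨f', f₁'⟩ x := by
  have h2 := h.ofReal_comp.add (h₁.ofReal_comp.mul_const Complex.I)
  exact (h2.congr_deriv (Complex.mk_eq_add_mul_I _ _).symm).congr_of_eventuallyEq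
    (Filter.Eventually.of_forall fun y => Complex.mk_eq_add_mul_I _ _)

/-- The complex linear part is a real linear function of the matrix. -/
theorem MHasDeriv.hPart {n : ℕ} {Y : ℝ → Mat n} {Y' : Mat n} {x : ℝ} (h : MHasDeriv Y Y' x) :
    MHasDeriv (fun y => hPart (Y y)) (SU2CurveFlow.hPart Y') x := fun _ _ =>
  (((h _ _).add (h _ _)).div_const 2).complexMk (((h _ _).sub (h _ _)).div_const 2)

theorem MHasDeriv.mPart {n : ℕ} {Y : ℝ → Mat n} {Y' : Mat n} {x : ℝ} (h : MHasDeriv Y Y' x) :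
    MHasDeriv (fun y => mPart (Y y)) (SU2CurveFlow.mPart Y') x := fun _ _ =>
  (((h _ _).sub (h _ _)).div_const 2).complexMk (((h _ _).add (h _ _)).div_const 2)

/-- Entrywise smoothness of a matrix function on a subset of a normed space. It contains
`SmoothOn` and `SmoothOn₂` as special cases. -/
def MSmooth {P : Type*} [NormedAddCommGroup P] [NormedSpace ℝ P] (F : P → Matrix α β E)
    (s : Set P) : Prop :=
  ∀ i j, ContDiffOn ℝ ∞ (fun p => F p i j) s

namespace MSmooth

variable {P : Type*} [NormedAddCommGroup P] [NormedSpace ℝ P] {F G : P → Matrix α β E} {s : Set P}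

theorem congr (h : MSmooth F s) (hFG : ∀ p ∈ s, G p = F p) : MSmooth G s := fun i j =>
  (h i j).congr fun p hp => by rw [hFG p hp]

theorem const (A : Matrix α β E) : MSmooth (fun _ => A) s := fun _ _ => contDiffOn_const

theorem add (h : MSmooth F s) (h' : MSmooth G s) : MSmooth (fun y => F y + G y) s :=
  fun i j => (h i j).add (h' i j)

theorem sub (h : MSmooth F s) (h' : MSmooth G s) : MSmooth (fun y => F y - G y) s :=
  fun i j => (h i j).sub (h' i j)

theorem neg (h : MSmooth F s) : MSmooth (fun y => -F y) s := fun i j => (h i j).neg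

theorem transpose (h : MSmooth F s) : MSmooth (fun y => (F y)ᵀ) s := fun i j => h j i

theorem map (L : E →L[ℝ] E') (h : MSmooth F s) : MSmooth (fun y => (F y).map L) s := fun i j =>
  L.contDiff.comp_contDiffOn (h i j)

theorem const_smul {R : Type*} [NormedRing R] [NormedAlgebra ℝ R] [Module R E]
    [IsBoundedSMul R E] [SMulCommClass ℝ R E] (c : R) (h : MSmooth F s) :
    MSmooth (fun y => c • F y) s := fun i j => (h i j).const_smul c

theorem fromBlocks {γ δ : Type*} {A : P → Matrix α γ E} {B : P → Matrix α δ E}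
    {C : P → Matrix β γ E} {D : P → Matrix β δ E} (hA : MSmooth A s)
    (hB : MSmooth B s) (hC : MSmooth C s) (hD : MSmooth D s) :
    MSmooth (fun y => Matrix.fromBlocks (A y) (B y) (C y) (D y)) s := by
  rintro (i | i) (j | j)
  exacts [hA i j, hB i j, hC i j, hD i j]

theorem submatrix {γ δ : Type*} (r : γ → α) (c : δ → β) (h : MSmooth F s) :
    MSmooth (fun y => (F y).submatrix r c) s := fun i j => h (r i) (c j)

theorem cj {F : P → Matrix α β ℂ} (h : MSmooth F s) : MSmooth (fun y => cj (F y)) s := fun i j =>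
  (Complex.conjCLE : ℂ →L[ℝ] ℂ).contDiff.comp_contDiffOn (h i j)

theorem conjTranspose {F : P → Matrix α β ℂ} (h : MSmooth F s) : MSmooth (fun y => (F y)ᴴ) s :=
  h.transpose.cj

theorem mul [Fintype β] {R : Type*} [NormedRing R] [NormedAlgebra ℝ R] {F : P → Matrix α β R}
    {G : P → Matrix β κ R} (h : MSmooth F s) (h' : MSmooth G s) :
    MSmooth (fun y => F y * G y) s := fun i j => by
  simp only [Matrix.mul_apply]
  exact ContDiffOn.sum fun k _ => (h i k).mul (h' k j)

theorem smul {R : Type*} [NormedRing R] [NormedAlgebra ℝ R] {f : P → R}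
    {F : P → Matrix α β R} (hf : ContDiffOn ℝ ∞ f s) (h : MSmooth F s) :
    MSmooth (fun y => f y • F y) s := fun i j => hf.mul (h i j)

theorem comp {P' : Type*} [NormedAddCommGroup P'] [NormedSpace ℝ P'] (h : MSmooth F s)
    {φ : P' → P} {s' : Set P'} (hφ : ContDiffOn ℝ ∞ φ s') (hs : Set.MapsTo φ s' s) :
    MSmooth (fun y => F (φ y)) s' := fun i j => (h i j).comp hφ hs

theorem hC {H : P → Matrix (Idx n) (Idx n) ℂ} (h : MSmooth H s) : MSmooth (fun y => hC (H y)) s :=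
  (h.map Complex.reCLM).fromBlocks (h.map Complex.imCLM) (h.map Complex.imCLM).neg
    (h.map Complex.reCLM)

theorem mC {W : P → Matrix (Idx n) (Idx n) ℂ} (h : MSmooth W s) : MSmooth (fun y => mC (W y)) s :=
  (h.map Complex.reCLM).fromBlocks (h.map Complex.imCLM) (h.map Complex.imCLM)
    (h.map Complex.reCLM).neg

end MSmooth

theorem _root_.ContDiffOn.complexMk {P : Type*} [NormedAddCommGroup P] [NormedSpace ℝ P]
    {f f₁ : P → ℝ} {s : Set P} (h : ContDiffOn ℝ ∞ f s) (h₁ : ContDiffOn ℝ ∞ f₁ s) :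
    ContDiffOn ℝ ∞ (fun y => (⟨f y, f₁ y⟩ : ℂ)) s := by
  have h2 := (Complex.ofRealCLM.contDiff.comp_contDiffOn h).add
    ((Complex.ofRealCLM.contDiff.comp_contDiffOn h₁).mul (contDiffOn_const (c := Complex.I)))
  exact h2.congr fun y _ => Complex.mk_eq_add_mul_I _ _

theorem MSmooth.hPart {n : ℕ} {P : Type*} [NormedAddCommGroup P] [NormedSpace ℝ P] {s : Set P}
    {Y : P → Mat n} (h : MSmooth Y s) : MSmooth (fun y => hPart (Y y)) s := fun _ _ =>
  (((h _ _).add (h _ _)).div_const 2).complexMk (((h _ _).sub (h _ _)).div_const 2)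

theorem MSmooth.mHasDeriv {F : ℝ → Matrix α β E} {X : Set ℝ} (hX : IsOpen X) (h : MSmooth F X)
    {x : ℝ} (hx : x ∈ X) : MHasDeriv F (mderiv F x) x := fun i j =>
  ((((h i j).contDiffAt (hX.mem_nhds hx)).differentiableAt (by simp))).hasDerivAt

theorem MSmooth.mderiv {F : ℝ → Matrix α β E} {X : Set ℝ} (hX : IsOpen X) (h : MSmooth F X) :
    MSmooth (mderiv F) X := fun i j =>
  ((contDiffOn_infty_iff_deriv_of_isOpen hX).1 (h i j)).2

/-! ### Partial derivatives -/

section Partial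

variable {f : ℝ → ℝ → E} {T X : Set ℝ}

theorem hasDerivAt_right_of_differentiableAt {t x : ℝ}
    (h : DifferentiableAt ℝ (fun p : ℝ × ℝ => f p.1 p.2) (t, x)) :
    HasDerivAt (f t) (fderiv ℝ (fun p : ℝ × ℝ => f p.1 p.2) (t, x) (0, 1)) x :=
  h.hasFDerivAt.comp_hasDerivAt (f := fun y => (t, y)) x
    ((hasDerivAt_const x t).prodMk (hasDerivAt_id x))

theorem hasDerivAt_left_of_differentiableAt {t x : ℝ}
    (h : DifferentiableAt ℝ (fun p : ℝ × ℝ => f p.1 p.2) (t, x)) :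
    HasDerivAt (fun s => f s x) (fderiv ℝ (fun p : ℝ × ℝ => f p.1 p.2) (t, x) (1, 0)) t :=
  h.hasFDerivAt.comp_hasDerivAt (f := fun s => (s, x)) t
    ((hasDerivAt_id t).prodMk (hasDerivAt_const t x))

theorem differentiableAt_of_contDiffOn_prod (hT : IsOpen T) (hX : IsOpen X)
    (hf : ContDiffOn ℝ ∞ (fun p : ℝ × ℝ => f p.1 p.2) (T ×ˢ X))
    {t x : ℝ} (ht : t ∈ T) (hx : x ∈ X) :
    DifferentiableAt ℝ (fun p : ℝ × ℝ => f p.1 p.2) (t, x) :=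
  (hf.contDiffAt ((hT.prod hX).mem_nhds ⟨ht, hx⟩)).differentiableAt (by simp)

theorem contDiffOn_deriv_right (hT : IsOpen T) (hX : IsOpen X)
    (hf : ContDiffOn ℝ ∞ (fun p : ℝ × ℝ => f p.1 p.2) (T ×ˢ X)) :
    ContDiffOn ℝ ∞ (fun p : ℝ × ℝ => deriv (f p.1) p.2) (T ×ˢ X) := by
  have h1 := ((contDiffOn_infty_iff_fderiv_of_isOpen (hT.prod hX)).1 hf).2
  refine (h1.clm_apply (contDiffOn_const (c := ((0, 1) : ℝ × ℝ)))).congr ?_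
  rintro ⟨t, x⟩ ⟨ht, hx⟩
  exact (hasDerivAt_right_of_differentiableAt
    (differentiableAt_of_contDiffOn_prod hT hX hf ht hx)).deriv

theorem contDiffOn_deriv_left (hT : IsOpen T) (hX : IsOpen X)
    (hf : ContDiffOn ℝ ∞ (fun p : ℝ × ℝ => f p.1 p.2) (T ×ˢ X)) :
    ContDiffOn ℝ ∞ (fun p : ℝ × ℝ => deriv (fun s => f s p.2) p.1) (T ×ˢ X) := by
  have h1 := ((contDiffOn_infty_iff_fderiv_of_isOpen (hT.prod hX)).1 hf).2
  refine (h1.clm_apply (contDiffOn_const (c := ((1, 0) : ℝ × ℝ)))).congr ?_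
  rintro ⟨t, x⟩ ⟨ht, hx⟩
  exact (hasDerivAt_left_of_differentiableAt
    (differentiableAt_of_contDiffOn_prod hT hX hf ht hx)).deriv

theorem deriv_deriv_comm (hT : IsOpen T) (hX : IsOpen X)
    (hf : ContDiffOn ℝ ∞ (fun p : ℝ × ℝ => f p.1 p.2) (T ×ˢ X))
    {t x : ℝ} (ht : t ∈ T) (hx : x ∈ X) :
    deriv (fun s => deriv (f s) x) t = deriv (fun y => deriv (fun s => f s y) t) x := by
  set F : ℝ × ℝ → E := fun p => f p.1 p.2 with hF
  have hO := (hT.prod hX).mem_nhds (show ((t, x) : ℝ × ℝ) ∈ T ×ˢ X from ⟨ht, hx⟩)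
  have h1 := ((contDiffOn_infty_iff_fderiv_of_isOpen (hT.prod hX)).1 hf).2
  have h2 : DifferentiableAt ℝ (fderiv ℝ F) (t, x) :=
    (h1.contDiffAt hO).differentiableAt (by simp)
  have hsymm : IsSymmSndFDerivAt ℝ F (t, x) :=
    (hf.contDiffAt hO).isSymmSndFDerivAt (by
      simpa using WithTop.coe_le_coe.2 (le_top : (2 : ℕ∞) ≤ ⊤))
  have e1 : deriv (fun s => deriv (f s) x) t = fderiv ℝ (fderiv ℝ F) (t, x) (1, 0) (0, 1) := by
    have h3 : HasDerivAt (fun s => fderiv ℝ F (s, x)) (fderiv ℝ (fderiv ℝ F) (t, x) (1, 0)) t :=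
      hasDerivAt_left_of_differentiableAt (f := fun a b => fderiv ℝ F (a, b)) h2
    have h4 := h3.clm_apply (hasDerivAt_const t ((0, 1) : ℝ × ℝ))
    simp only [map_zero, add_zero] at h4
    rw [← h4.deriv]
    apply Filter.EventuallyEq.deriv_eq
    filter_upwards [hT.mem_nhds ht] with s hs
    exact (hasDerivAt_right_of_differentiableAt
      (differentiableAt_of_contDiffOn_prod hT hX hf hs hx)).deriv
  have e2 : deriv (fun y => deriv (fun s => f s y) t) x =
      fderiv ℝ (fderiv ℝ F) (t, x) (0, 1) (1, 0) := by
    have h3 : HasDerivAt (fun y => fderiv ℝ F (t, y)) (fderiv ℝ (fderiv ℝ F) (t, x) (0, 1)) x :=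
      hasDerivAt_right_of_differentiableAt (f := fun a b => fderiv ℝ F (a, b)) h2
    have h4 := h3.clm_apply (hasDerivAt_const x ((1, 0) : ℝ × ℝ))
    simp only [map_zero, add_zero] at h4
    rw [← h4.deriv]
    apply Filter.EventuallyEq.deriv_eq
    filter_upwards [hX.mem_nhds hx] with y hy
    exact (hasDerivAt_left_of_differentiableAt
      (differentiableAt_of_contDiffOn_prod hT hX hf ht hy)).deriv
  rw [e1, e2, hsymm.eq]

end Partial

namespace SmoothOn₂

variable {F : ℝ → ℝ → Matrix α β E} {T X : Set ℝ}

theorem right (h : SmoothOn₂ F T X) {t : ℝ} (ht : t ∈ T) : MSmooth (F t) X :=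
  MSmooth.comp (F := fun p : ℝ × ℝ => F p.1 p.2) h (φ := fun y => (t, y))
    (contDiffOn_const.prodMk contDiffOn_id) fun _ hy => ⟨ht, hy⟩

theorem left (h : SmoothOn₂ F T X) {x : ℝ} (hx : x ∈ X) : MSmooth (fun s => F s x) T :=
  MSmooth.comp (F := fun p : ℝ × ℝ => F p.1 p.2) h (φ := fun s => (s, x))
    (contDiffOn_id.prodMk contDiffOn_const) fun _ hy => ⟨hy, hx⟩

theorem mderiv_right (hT : IsOpen T) (hX : IsOpen X)
    (h : SmoothOn₂ F T X) : SmoothOn₂ (fun t x => mderiv (F t) x) T X :=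
  fun i j => contDiffOn_deriv_right hT hX (f := fun t x => F t x i j) (h i j)

theorem mderiv_left (hT : IsOpen T) (hX : IsOpen X)
    (h : SmoothOn₂ F T X) :
    SmoothOn₂ (fun t x => mderiv (fun s => F s x) t) T X :=
  fun i j => contDiffOn_deriv_left hT hX (f := fun t x => F t x i j) (h i j)

theorem mderiv_comm (hT : IsOpen T) (hX : IsOpen X)
    (h : SmoothOn₂ F T X) {t x : ℝ} (ht : t ∈ T) (hx : x ∈ X) :
    mderiv (fun s => mderiv (F s) x) t = mderiv (fun y => mderiv (fun s => F s y) t) x := by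
  ext i j
  exact deriv_deriv_comm hT hX (f := fun t x => F t x i j) (h i j) ht hx

end SmoothOn₂

end Calculus

/-! ### Frames along curves -/

/-- The Maurer-Cartan matrix `g⁻¹g'` of a curve of frames. -/
noncomputable def maurerCartan (g : ℝ → SO n) (x : ℝ) : Mat n :=
  (g x : Mat n)ᵀ * mderiv (fun s => (g s : Mat n)) x

theorem MHasDeriv.frame {g : ℝ → SO n} {G' : Mat n} {x : ℝ}
    (h : MHasDeriv (fun s => (g s : Mat n)) G' x) :
    MHasDeriv (fun s => (g s : Mat n)) ((g x : Mat n) * maurerCartan g x) x := by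
  refine h.congr_deriv ?_
  rw [maurerCartan, h.mderiv, ← mul_assoc, mul_transpose_self, one_mul]

theorem maurerCartan_eq {g : ℝ → SO n} {Y : Mat n} {x : ℝ}
    (h : MHasDeriv (fun s => (g s : Mat n)) ((g x : Mat n) * Y) x) : maurerCartan g x = Y := by
  rw [maurerCartan, h.mderiv, ← mul_assoc, transpose_mul_self, one_mul]

theorem maurerCartan_transpose {g : ℝ → SO n} {G' : Mat n} {x : ℝ}
    (h : MHasDeriv (fun s => (g s : Mat n)) G' x) :
    (maurerCartan g x)ᵀ = -maurerCartan g x := by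
  have h1 := h.transpose.mul h
  have h2 : MHasDeriv (fun s => (g s : Mat n)ᵀ * (g s : Mat n)) 0 x := by
    simp only [transpose_mul_self]; exact MHasDeriv.const _
  have h3 := h1.unique h2
  rw [maurerCartan, h.mderiv, Matrix.transpose_mul, Matrix.transpose_transpose]
  exact eq_neg_of_add_eq_zero_left h3

theorem hPart_transpose (Y : Mat n) : hPart Yᵀ = (hPart Y)ᴴ := by
  rw [← hC_hPart_add_mC_mPart Y, Matrix.transpose_add, hC_transpose, mC_transpose]; simp

theorem mPart_transpose (Y : Mat n) : mPart Yᵀ = (mPart Y)ᵀ := by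
  rw [← hC_hPart_add_mC_mPart Y, Matrix.transpose_add, hC_transpose, mC_transpose]; simp

theorem hPart_neg (Y : Mat n) : hPart (-Y) = -hPart Y := by
  rw [← zero_sub, hPart_sub, hPart_zero, zero_sub]

theorem mPart_neg (Y : Mat n) : mPart (-Y) = -mPart Y := by
  rw [← zero_sub, mPart_sub, mPart_zero, zero_sub]

theorem hPart_conjTranspose_of_skew {Y : Mat n} (h : Yᵀ = -Y) : (hPart Y)ᴴ = -hPart Y := by
  rw [← hPart_transpose, h, hPart_neg]

theorem mPart_transpose_of_skew {Y : Mat n} (h : Yᵀ = -Y) : (mPart Y)ᵀ = -mPart Y := by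
  rw [← mPart_transpose, h, mPart_neg]

theorem lie_J₀_eq (Y : Mat n) : ⁅Y, J₀ n⁆ = ⁅mC (mPart Y), J₀ n⁆ := by
  conv_lhs => rw [← hC_hPart_add_mC_mPart Y]
  rw [Ring.lie_def, Ring.lie_def, add_mul, mul_add, hC_mul_J₀]
  abel

/-- The derivative of the moving point of a curve of frames. -/
theorem mHasDeriv_embed_mk {g : ℝ → SO n} {G' : Mat n} {x : ℝ}
    (h : MHasDeriv (fun s => (g s : Mat n)) G' x) :
    MHasDeriv (fun s => embed (QuotientGroup.mk (g s) : M n))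
      (solder (g x) (mC (mPart (maurerCartan g x)))) x := by
  have h1 := (h.frame.mul (MHasDeriv.const (J₀ n))).mul h.frame.transpose
  refine h1.congr_deriv ?_
  rw [Matrix.transpose_mul, maurerCartan_transpose h, solder_apply, ← lie_J₀_eq, Ring.lie_def]
  noncomm_ring

theorem velocity_eq {g : ℝ → SO n} {c : ℝ → M n} {G' : Mat n} {x : ℝ}
    (h : MHasDeriv (fun s => (g s : Mat n)) G' x)
    (hc : ∀ᶠ s in nhds x, c s = QuotientGroup.mk (g s)) :
    velocity c x = solder (g x) (mC (mPart (maurerCartan g x))) :=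
  ((mHasDeriv_embed_mk h).congr_of_eventuallyEq (hc.mono fun s hs => by rw [hs])).mderiv

theorem coframe_velocity {g : ℝ → SO n} {c : ℝ → M n} {G' : Mat n} {x : ℝ}
    (h : MHasDeriv (fun s => (g s : Mat n)) G' x)
    (hc : ∀ᶠ s in nhds x, c s = QuotientGroup.mk (g s)) :
    coframe (g x) (velocity c x) = mC (mPart (maurerCartan g x)) := by
  rw [velocity_eq h hc, coframe_solder_mC]

theorem half_sub_J₀_mul_mul_J₀ (Y : Mat n) :
    (1 / 2 : ℝ) • (Y - J₀ n * Y * J₀ n) = hC (hPart Y) := by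
  conv_lhs => rw [← hC_hPart_add_mC_mPart Y]
  rw [mul_add, ← hC_mul_J₀, J₀_mul_mC, add_mul, neg_mul, mul_assoc, mul_assoc, J₀_mul_self,
    mul_neg, mul_neg, mul_one, mul_one, neg_neg]
  module

theorem half_add_J₀_mul_mul_J₀ (Y : Mat n) :
    (1 / 2 : ℝ) • (Y + J₀ n * Y * J₀ n) = mC (mPart Y) := by
  conv_lhs => rw [← hC_hPart_add_mC_mPart Y]
  rw [mul_add, ← hC_mul_J₀, J₀_mul_mC, add_mul, neg_mul, mul_assoc, mul_assoc, J₀_mul_self,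
    mul_neg, mul_neg, mul_one, mul_one, neg_neg]
  module

theorem connection_eq (g : ℝ → SO n) (x : ℝ) :
    connection g x = hC (hPart (maurerCartan g x)) :=
  half_sub_J₀_mul_mul_J₀ _

/-- The covariant derivative in terms of a frame: `e⌟∇ₓZ = (e⌟Z)ₓ + [u, e⌟Z]`. -/
theorem covDeriv_solder {g : ℝ → SO n} {c : ℝ → M n} {G' : Mat n} {x : ℝ}
    (h : MHasDeriv (fun s => (g s : Mat n)) G' x) (hc : c x = QuotientGroup.mk (g x))
    {Z : ℝ → Mat n} {W : ℝ → Matrix (Idx n) (Idx n) ℂ} {W' : Matrix (Idx n) (Idx n) ℂ}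
    (hW : MHasDeriv W W' x) (hZ : ∀ᶠ s in nhds x, Z s = solder (g s) (mC (W s))) :
    covDeriv c Z x =
      solder (g x) (mC W' + ⁅hC (hPart (maurerCartan g x)), mC (W x)⁆) := by
  set Y := maurerCartan g x with hY
  have h1 : MHasDeriv (fun s => solder (g s) (mC (W s)))
      ((g x : Mat n) * (⁅mC W', J₀ n⁆ + ⁅Y, ⁅mC (W x), J₀ n⁆⁆) * (g x : Mat n)ᵀ) x := by
    have h2 : MHasDeriv (fun s => ⁅mC (W s), J₀ n⁆) ⁅mC W', J₀ n⁆ x := by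
      refine ((hW.mC.mul (MHasDeriv.const (J₀ n))).sub
        ((MHasDeriv.const (J₀ n)).mul hW.mC)).congr_deriv ?_
      rw [Ring.lie_def]; simp
    refine ((h.frame.mul h2).mul h.frame.transpose).congr_deriv ?_
    rw [Matrix.transpose_mul, maurerCartan_transpose h, ← hY, Ring.lie_def Y]
    noncomm_ring
  rw [covDeriv, (h1.congr_of_eventuallyEq hZ).mderiv, hc, embed_mk, frame_conj_mul, frame_conj_mul,
    ← add_mul, ← mul_add, ← smul_mul_assoc, ← mul_smul_comm, half_add_J₀_mul_mul_J₀, solder_apply]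
  congr 2
  have h4 : ∀ A : Matrix (Idx n) (Idx n) ℂ, (2 : ℝ) • Complex.I • A = (2 * Complex.I) • A := by
    intro A; ext i j; simp [mul_assoc]
  -- The antilinear part of `Y` brackets `[e⌟Z, J₀] ∈ 𝔪` into `𝔥`, the normal direction.
  have h3 : ∀ Q : Mat n, ⁅Q, ⁅mC (W x), J₀ n⁆⁆ =
      mC (cj (hPart Q) * (2 * Complex.I) • W x - ((2 * Complex.I) • W x) * hPart Q) +
      hC (cj (mPart Q) * (2 * Complex.I) • W x - cj ((2 * Complex.I) • W x) * mPart Q) := by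
    intro Q
    rw [lie_mC_J₀, mC_mul_J₀, ← mC_smul, h4, ← lie_hC_mC, ← lie_mC_mC]
    conv_lhs => rw [← hC_hPart_add_mC_mPart Q]
    simp only [Ring.lie_def]
    noncomm_ring
  rw [h3, lie_hC_mC, ← mC_add, lie_mC_J₀, lie_mC_J₀, mC_mul_J₀, mC_mul_J₀, ← mC_smul, ← mC_smul]
  simp only [mPart_add, mPart_mC, mPart_hC, add_zero, h4, mul_smul_comm, smul_mul_assoc, ← smul_sub,
    ← smul_add]

/-- For a parallel frame, the components of the Maurer-Cartan matrix are the unit vector `e` and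
the Hasimoto variables. -/
theorem IsParallelFrame.mPart_maurerCartan {X : Set ℝ} (hX : IsOpen X) {c : ℝ → M n}
    {g : ℝ → SO n} (h : IsParallelFrame X c g) {x : ℝ} (hx : x ∈ X) :
    mPart (maurerCartan g x) = (1 / √(χ n)) • eBlock n := by
  have h1 := h.tangent x hx
  rw [coframe_velocity (MSmooth.mHasDeriv hX h.smooth hx)
    (Filter.eventually_of_mem (hX.mem_nhds hx) h.lifts), ee_eq] at h1
  exact mC_injective h1

theorem IsParallelFrame.velocity_eq {X : Set ℝ} (hX : IsOpen X) {c : ℝ → M n}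
    {g : ℝ → SO n} (h : IsParallelFrame X c g) {x : ℝ} (hx : x ∈ X) :
    velocity c x = solder (g x) (ee n) := by
  rw [SU2CurveFlow.velocity_eq (MSmooth.mHasDeriv hX h.smooth hx)
    (Filter.eventually_of_mem (hX.mem_nhds hx) h.lifts), h.mPart_maurerCartan hX hx, ee_eq]

/-- In a parallel frame, `e⌟∇ₓγₓ = [u, e]`, which is `(4r, (v₁, v₂))/√χ`: the coefficient of `r` is
the ratio of the eigenvalues of `ad(e)²`. -/
theorem IsParallelFrame.normal_eq {X : Set ℝ} (hX : IsOpen X) {c : ℝ → M n}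
    {g : ℝ → SO n} (h : IsParallelFrame X c g) {x : ℝ} (hx : x ∈ X) {r : ℝ}
    {V : Matrix (Fin (n - 2)) (Fin 2) ℂ} (hrV : connection g x = hC (uBlock r V)) :
    normal c x = (1 / √(χ n)) • solder (g x) (mPerp (4 * r) V) := by
  rw [connection_eq] at hrV
  have h1 := covDeriv_solder (MSmooth.mHasDeriv hX h.smooth hx) (h.lifts x hx)
    (Z := velocity c) (MHasDeriv.const ((1 / √(χ n)) • eBlock n))
    (Filter.eventually_of_mem (hX.mem_nhds hx) fun s hs => by rw [h.velocity_eq hX hs, ee_eq])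
  rw [normal, h1, hrV, mC_zero, zero_add, mC_smul, lie_smul_right', ← map_smul]
  congr 2
  have h2 := lie_eBlock_uBlock (n := n) r V
  rw [Ring.lie_def] at h2 ⊢
  rw [← neg_sub, h2, neg_neg]

theorem IsParallelFrame.frameMap_normal {X : Set ℝ} (hX : IsOpen X) {c : ℝ → M n}
    {g : ℝ → SO n} (h : IsParallelFrame X c g) {x : ℝ} (hx : x ∈ X) {r : ℝ}
    {V : Matrix (Fin (n - 2)) (Fin 2) ℂ} (hrV : connection g x = hC (uBlock r V)) (a : ℝ) (b : ℂ) :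
    frameMap (g x) (suGen a b) (normal c x) =
      solder (g x) ((1 / √(χ n)) • mPerp 0 (V * suGen a b)) := by
  rw [h.normal_eq hX hx hrV, map_smul, frameMap_suGen_mPerp, map_smul]

theorem IsParallelFrame.smoothOn_frameMap {X : Set ℝ} {c : ℝ → M n}
    {g : ℝ → SO n} (h : IsParallelFrame X c g) (K : Matrix (Fin 2) (Fin 2) ℂ) {Z : ℝ → Mat n}
    (hZ : SmoothOn Z X) : SmoothOn (fun x => frameMap (g x) K (Z x)) X := by
  have hg : MSmooth (fun x => (g x : Mat n)) X := h.smooth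
  have hJ : MSmooth (fun _ : ℝ => J₀ n) X := MSmooth.const _
  have hK : MSmooth (fun _ : ℝ => suEmbed n K) X := MSmooth.const _
  have h1 : MSmooth (fun x => coframe (g x) (Z x)) X :=
    (((hg.transpose.mul hZ).mul hg).mul hJ).const_smul (-(1 / 2) : ℝ)
  have h2 : MSmooth (fun x => -⁅suEmbed n K, coframe (g x) (Z x)⁆) X :=
    ((hK.mul h1).sub (h1.mul hK)).neg
  exact (hg.mul ((h2.mul hJ).sub (hJ.mul h2))).mul hg.transpose

/-! ### Flows: the zero curvature equations -/

section Flow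

variable {T X : Set ℝ}

theorem SmoothOn₂.maurerCartan_right (hT : IsOpen T) (hX : IsOpen X) {g : ℝ → ℝ → SO n}
    (hg : SmoothOn₂ (fun t x => (g t x : Mat n)) T X) :
    SmoothOn₂ (fun t x => maurerCartan (g t) x) T X :=
  (MSmooth.transpose hg).mul (hg.mderiv_right hT hX)

theorem SmoothOn₂.maurerCartan_left (hT : IsOpen T) (hX : IsOpen X) {g : ℝ → ℝ → SO n}
    (hg : SmoothOn₂ (fun t x => (g t x : Mat n)) T X) :
    SmoothOn₂ (fun t x => maurerCartan (fun s => g s x) t) T X :=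
  (MSmooth.transpose hg).mul (hg.mderiv_left hT hX)

/-- The Maurer-Cartan equation for a two-parameter family of frames. -/
theorem zero_curvature (hT : IsOpen T) (hX : IsOpen X) {g : ℝ → ℝ → SO n}
    (hg : SmoothOn₂ (fun t x => (g t x : Mat n)) T X) {t x : ℝ} (ht : t ∈ T) (hx : x ∈ X) :
    mderiv (fun s => maurerCartan (g s) x) t -
      mderiv (fun y => maurerCartan (fun s => g s y) t) x +
      ⁅maurerCartan (fun s => g s x) t, maurerCartan (g t) x⁆ = 0 := by
  have hP := (hg.maurerCartan_right hT hX).left hx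
  have hQ := (hg.maurerCartan_left hT hX).right ht
  have h1 := MHasDeriv.congr_of_eventuallyEq (G := fun s => mderiv (fun y => (g s y : Mat n)) x)
    (((hg.left hx).mHasDeriv hT ht).frame.mul (hP.mHasDeriv hT ht)) <| by
      filter_upwards [hT.mem_nhds ht] with s hs
      exact ((hg.right hs).mHasDeriv hX hx).frame.mderiv
  have h2 := MHasDeriv.congr_of_eventuallyEq (G := fun y => mderiv (fun s => (g s y : Mat n)) t)
    (((hg.right ht).mHasDeriv hX hx).frame.mul (hQ.mHasDeriv hX hx)) <| by
      filter_upwards [hX.mem_nhds hx] with y hy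
      exact ((hg.left hy).mHasDeriv hT ht).frame.mderiv
  have h3 := hg.mderiv_comm hT hX ht hx
  rw [h1.mderiv, h2.mderiv] at h3
  have h4 := congrArg (fun A => (g t x : Mat n)ᵀ * A) h3
  simp only [mul_add, ← mul_assoc, transpose_mul_self, one_mul] at h4
  rw [Ring.lie_def, ← sub_eq_zero.2 h4]
  abel

theorem hPart_lie (Y Z : Mat n) : hPart ⁅Y, Z⁆ = hPart Y * hPart Z - hPart Z * hPart Y +
    (cj (mPart Y) * mPart Z - cj (mPart Z) * mPart Y) := by
  conv_lhs => rw [← hC_hPart_add_mC_mPart Y, ← hC_hPart_add_mC_mPart Z]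
  simp only [Ring.lie_def, add_mul, mul_add, hC_mul_hC, hC_mul_mC, mC_mul_hC, mC_mul_mC, hPart_sub,
    hPart_add, hPart_hC, hPart_mC]
  abel

theorem mPart_lie (Y Z : Mat n) : mPart ⁅Y, Z⁆ = cj (hPart Y) * mPart Z - mPart Z * hPart Y -
    (cj (hPart Z) * mPart Y - mPart Y * hPart Z) := by
  conv_lhs => rw [← hC_hPart_add_mC_mPart Y, ← hC_hPart_add_mC_mPart Z]
  simp only [Ring.lie_def, add_mul, mul_add, hC_mul_hC, hC_mul_mC, mC_mul_hC, mC_mul_mC, mPart_sub,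
    mPart_add, mPart_hC, mPart_mC]
  abel

/-- The `𝔥`-component of the zero curvature equation. -/
theorem zero_curvature_h (hT : IsOpen T) (hX : IsOpen X) {g : ℝ → ℝ → SO n}
    (hg : SmoothOn₂ (fun t x => (g t x : Mat n)) T X) {t x : ℝ} (ht : t ∈ T) (hx : x ∈ X)
    {U A w W U' w' : Matrix (Idx n) (Idx n) ℂ} (hU : hPart (maurerCartan (g t) x) = U)
    (hA : mPart (maurerCartan (g t) x) = A) (hw : hPart (maurerCartan (fun s => g s x) t) = w)
    (hW : mPart (maurerCartan (fun s => g s x) t) = W)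
    (hU' : MHasDeriv (fun s => hPart (maurerCartan (g s) x)) U' t)
    (hw' : MHasDeriv (fun y => hPart (maurerCartan (fun s => g s y) t)) w' x) :
    U' - w' + (w * U - U * w + (cj W * A - cj A * W)) = 0 := by
  have h := congrArg hPart (zero_curvature hT hX hg ht hx)
  rw [hPart_add, hPart_sub, hPart_zero, hPart_lie, hU, hA, hw, hW,
    (((hg.maurerCartan_right hT hX).left hx).mHasDeriv hT ht).hPart.unique hU',
    (((hg.maurerCartan_left hT hX).right ht).mHasDeriv hX hx).hPart.unique hw'] at h
  exact h

/-- The `𝔪`-component of the zero curvature equation. -/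
theorem zero_curvature_m (hT : IsOpen T) (hX : IsOpen X) {g : ℝ → ℝ → SO n}
    (hg : SmoothOn₂ (fun t x => (g t x : Mat n)) T X) {t x : ℝ} (ht : t ∈ T) (hx : x ∈ X)
    {U A w W A' W' : Matrix (Idx n) (Idx n) ℂ} (hU : hPart (maurerCartan (g t) x) = U)
    (hA : mPart (maurerCartan (g t) x) = A) (hw : hPart (maurerCartan (fun s => g s x) t) = w)
    (hW : mPart (maurerCartan (fun s => g s x) t) = W)
    (hA' : MHasDeriv (fun s => mPart (maurerCartan (g s) x)) A' t)
    (hW' : MHasDeriv (fun y => mPart (maurerCartan (fun s => g s y) t)) W' x) :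
    A' - W' + (cj w * A - A * w - (cj U * W - W * U)) = 0 := by
  have h := congrArg mPart (zero_curvature hT hX hg ht hx)
  rw [mPart_add, mPart_sub, mPart_zero, mPart_lie, hU, hA, hw, hW,
    (((hg.maurerCartan_right hT hX).left hx).mHasDeriv hT ht).mPart.unique hA',
    (((hg.maurerCartan_left hT hX).right ht).mHasDeriv hX hx).mPart.unique hW'] at h
  exact h

end Flow

/-! ### The flow is non-stretching -/

theorem re_eq_zero_of_conj_eq_neg {z : ℂ} (h : starRingEnd ℂ z = -z) : z.re = 0 := by
  have := congrArg Complex.re h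
  simp at this
  linarith

theorem conj_trace_mul_of_skew {p : Type*} [Fintype p] {L J : Matrix p p ℂ} (hL : Lᴴ = L)
    (hJ : Jᴴ = -J) : starRingEnd ℂ (L * J).trace = -(L * J).trace := by
  have h := Matrix.trace_conjTranspose (L * J)
  rw [Matrix.conjTranspose_mul, hL, hJ, Matrix.neg_mul, Matrix.trace_neg,
    Matrix.trace_mul_comm] at h
  exact h.symm

theorem conj_trace_gram_mul {m p : Type*} [Fintype m] [Fintype p] (V : Matrix m p ℂ)
    {J : Matrix p p ℂ} (hJ : Jᴴ = -J) :
    starRingEnd ℂ (Vᴴ * (V * J)).trace = -(Vᴴ * (V * J)).trace := by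
  rw [← Matrix.mul_assoc]
  exact conj_trace_mul_of_skew (by simp) hJ

/-- On tangent vectors the metric is a constant multiple of the trace form. -/
theorem metric_eq_trace {S Y Z : Mat n} (hS : S * S = -1) (hZ : Z * S + S * Z = 0) :
    metric S Y Z = -((2 * (n : ℝ) - 2) / 4) * (Y * Z).trace := by
  have h1 : Y * S * (Z * S) = Y * Z := by
    rw [eq_neg_of_add_eq_zero_left hZ, mul_neg, mul_assoc Y, ← mul_assoc S S, hS]; simp
  rw [metric, killing, gen_apply, gen_apply, smul_mul_smul_comm, h1, Matrix.trace_smul, smul_eq_mul]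
  ring

/-- `J_γ(∇ₓγₓ)` is orthogonal to `γₓ`. -/
theorem metric_ee_mPerp (g : SO n) (B : Matrix (Fin (n - 2)) (Fin 2) ℂ) :
    metric (embed (QuotientGroup.mk g : M n)) (solder g (ee n)) (solder g (mPerp 0 B)) = 0 := by
  rw [solder_ee, mPerp_eq, metric_solder]; simp

/-- `J_γ(∇ₓγₓ)` is orthogonal to `∇ₓγₓ`, as right multiplication by the skew matrix `J` is skew. -/
theorem metric_mPerp_mPerp_mul (g : SO n) (r : ℝ) (V : Matrix (Fin (n - 2)) (Fin 2) ℂ)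
    {J : Matrix (Fin 2) (Fin 2) ℂ} (hJ : Jᴴ = -J) :
    metric (embed (QuotientGroup.mk g : M n)) (solder g (mPerp r V))
      (solder g (mPerp 0 (V * J))) = 0 := by
  rw [mPerp_eq, mPerp_eq, metric_solder, re_eq_zero_of_conj_eq_neg (conj_trace_gram_mul V hJ)]
  simp

theorem IsParallelFrame.exists_connection_eq (hn : 3 ≤ n) {X : Set ℝ} {c : ℝ → M n} {g : ℝ → SO n}
    (h : IsParallelFrame X c g) {x : ℝ} (hx : x ∈ X) :
    ∃ r V, connection g x = hC (uBlock r V) :=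
  (mem_hPerp_iff hn).1 (h.perp x hx)

/-- If `Y = γ_t` is orthogonal to `Z = γₓ` and to `Zₓ` for the trace form, then
`tr(Z Z_t) = tr(Z Yₓ) = tr(Z Y)ₓ - tr(Zₓ Y) = 0`. -/
theorem hasDerivAt_metric_velocity (hn : 3 ≤ n) (a : ℝ) (b : ℂ) {T X : Set ℝ} (hT : IsOpen T)
    (hX : IsOpen X) {γ : ℝ → ℝ → M n} {t₀ : ℝ} {g : ℝ → SO n} (ht₀ : t₀ ∈ T)
    (hγ : SmoothOn₂ (fun t x => embed (γ t x)) T X) (hg : IsParallelFrame X (γ t₀) g)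
    (hflow : ∀ x ∈ X, velocity (fun s => γ s x) t₀ =
      frameMap (g x) (suGen a b) (normal (γ t₀) x)) {x : ℝ} (hx : x ∈ X) :
    HasDerivAt (fun t => metric (embed (γ t x)) (velocity (γ t) x) (velocity (γ t) x)) 0 t₀ := by
  have hpos := metric_factor_pos hn
  have hS : ∀ t y, embed (γ t y) * embed (γ t y) = -1 := fun t y => embed_mul_self _
  -- Both families of velocities anticommute with the point, that is, they are tangent.
  have hZ : ∀ t ∈ T, ∀ y ∈ X, velocity (γ t) y * embed (γ t y) + embed (γ t y) * velocity (γ t) y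
      = 0 := by
    intro t ht y hy
    have h1 := (hγ.right ht).mHasDeriv hX hy
    refine (h1.mul h1).unique ?_
    simp only [hS]; exact MHasDeriv.const _
  have hY : ∀ y ∈ X, velocity (fun s => γ s y) t₀ * embed (γ t₀ y) +
      embed (γ t₀ y) * velocity (fun s => γ s y) t₀ = 0 := by
    intro y hy
    have h1 := (hγ.left hy).mHasDeriv hT ht₀
    refine (h1.mul h1).unique ?_
    simp only [hS]; exact MHasDeriv.const _
  -- The velocity of the flow is orthogonal to the curve.
  have hZY : ∀ y ∈ X, (velocity (γ t₀) y * velocity (fun s => γ s y) t₀).trace = 0 := by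
    intro y hy
    obtain ⟨r, V, hrV⟩ := hg.exists_connection_eq hn hy
    have h1 := metric_ee_mPerp (g y) ((1 / √(χ n)) • (V * suGen a b))
    have h2 : velocity (fun s => γ s y) t₀ =
        solder (g y) (mPerp 0 ((1 / √(χ n)) • (V * suGen a b))) := by
      rw [hflow y hy, hg.frameMap_normal hX hy hrV, mPerp_smul, mul_zero]
    rw [← h2, ← hg.velocity_eq hX hy, ← hg.lifts y hy, metric_eq_trace (hS t₀ y) (hY y hy)] at h1
    exact (mul_eq_zero_iff_left (by linarith [hpos] : -((2 * (n : ℝ) - 2) / 4) < 0).ne).1 h1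
  -- It is orthogonal to the derivative of the velocity of the curve.
  have hZxY : (mderiv (velocity (γ t₀)) x * velocity (fun s => γ s x) t₀).trace = 0 := by
    obtain ⟨r, V, hrV⟩ := hg.exists_connection_eq hn hx
    have h1 := metric_mPerp_mPerp_mul (g x) (4 * r) V (suGen_conjTranspose a b)
    rw [← hg.lifts x hx] at h1
    have h2 : velocity (fun s => γ s x) t₀ =
        (1 / √(χ n)) • solder (g x) (mPerp 0 (V * suGen a b)) := by
      rw [hflow x hx, hg.frameMap_normal hX hx hrV, map_smul]
    have h3 := hg.normal_eq hX hx hrV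
    have h4 : metric (embed (γ t₀ x)) (normal (γ t₀) x) (velocity (fun s => γ s x) t₀) = 0 := by
      rw [h2, h3, metric, killing, map_smul, map_smul, smul_mul_smul_comm, Matrix.trace_smul]
      rw [metric, killing, neg_eq_zero] at h1
      rw [smul_eq_mul, mul_left_comm, h1, mul_zero, neg_zero]
    rw [metric_eq_trace (hS t₀ x) (hY x hx)] at h4
    have h5 := (mul_eq_zero_iff_left (by linarith [hpos] : -((2 * (n : ℝ) - 2) / 4) < 0).ne).1 h4
    set Y := velocity (fun s => γ s x) t₀
    set S := embed (γ t₀ x) with hSdef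
    set A := mderiv (velocity (γ t₀)) x with hA
    have h6 : (S * A * S * Y).trace = (A * Y).trace := by
      have h7 : Y * S = -(S * Y) := eq_neg_of_add_eq_zero_left (hY x hx)
      calc (S * A * S * Y).trace = (S * (A * S * Y)).trace := by simp only [mul_assoc]
        _ = (A * (S * (Y * S))).trace := by rw [Matrix.trace_mul_comm]; simp only [mul_assoc]
        _ = (A * Y).trace := by rw [h7, mul_neg, ← mul_assoc S S, hS]; simp
    rw [normal, covDeriv, ← hSdef, ← hA, smul_mul_assoc, Matrix.trace_smul, add_mul,
      Matrix.trace_add, h6, smul_eq_mul] at h5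
    linarith
  have hv : SmoothOn₂ (fun t y => velocity (γ t) y) T X := hγ.mderiv_right hT hX
  have hZt := (hv.left hx).mHasDeriv hT ht₀
  have hcomm : mderiv (fun s => velocity (γ s) x) t₀ =
      mderiv (fun y => velocity (fun s => γ s y) t₀) x := hγ.mderiv_comm hT hX ht₀ hx
  have hYx : MHasDeriv (fun y => velocity (fun s => γ s y) t₀) _ x :=
    ((hγ.mderiv_left hT hX).right ht₀).mHasDeriv hX hx
  have hZYx : (velocity (γ t₀) x * mderiv (fun y => velocity (fun s => γ s y) t₀) x).trace = 0 := by
    have h1 := ((((hv.right ht₀).mHasDeriv hX hx).mul hYx).trace)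
    have h2 : HasDerivAt
        (fun y => (velocity (γ t₀) y * velocity (fun s => γ s y) t₀).trace) 0 x :=
      (hasDerivAt_const x (0 : ℝ)).congr_of_eventuallyEq
        (Filter.eventually_of_mem (hX.mem_nhds hx) hZY)
    have h3 := h1.unique h2
    rw [Matrix.trace_add, hZxY, zero_add] at h3
    exact h3
  have h1 := (hZt.mul hZt).trace.const_mul (-((2 * (n : ℝ) - 2) / 4))
  refine (h1.congr_deriv ?_).congr_of_eventuallyEq ?_
  · rw [Matrix.trace_add, Matrix.trace_mul_comm, hcomm, hZYx]; simp
  · filter_upwards [hT.mem_nhds ht₀] with t ht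
    exact metric_eq_trace (hS t x) (hZ t ht x hx)

/-! ### The zero curvature equations in blocks -/

theorem cj_mul_eps_sub {K : Matrix (Fin 2) (Fin 2) ℂ} (h : Kᴴ = -K) :
    cj K * eps - eps * K = -K.trace • eps := by
  have h1 : cj K = -Kᵀ := by rw [← cj_conjTranspose, h, cj_neg, neg_neg]
  rw [h1]
  ext i j; fin_cases i <;> fin_cases j <;>
    simp [eps, Matrix.mul_apply, Matrix.vecMul, dotProduct, Matrix.trace_fin_two] <;> ring

theorem eps_mul_add_transpose_mul_eps (K : Matrix (Fin 2) (Fin 2) ℂ) :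
    eps * K + Kᵀ * eps = K.trace • eps := by
  ext i j; fin_cases i <;> fin_cases j <;>
    simp [eps, Matrix.mul_apply, Matrix.vecMul, dotProduct, Matrix.trace_fin_two] <;> ring

theorem eps_mul_transpose_add_mul_eps {J : Matrix (Fin 2) (Fin 2) ℂ} (hJ0 : J.trace = 0) :
    eps * Jᵀ + J * eps = 0 := by
  have := eps_mul_add_transpose_mul_eps Jᵀ
  rwa [Matrix.transpose_transpose, Matrix.trace_transpose, hJ0, zero_smul] at this

theorem mul_eps_mul_transpose_add {m : Type*} {J : Matrix (Fin 2) (Fin 2) ℂ} (hJ0 : J.trace = 0)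
    (V : Matrix m (Fin 2) ℂ) (s : ℝ) :
    V * eps * (s • (V * J))ᵀ + s • (V * J) * eps * Vᵀ = 0 := by
  have h : V * eps * (V * J)ᵀ + V * J * eps * Vᵀ = V * (eps * Jᵀ + J * eps) * Vᵀ := by
    rw [Matrix.transpose_mul]
    simp only [Matrix.mul_assoc, Matrix.mul_add, Matrix.add_mul]
  rw [Matrix.transpose_smul, Matrix.mul_smul, Matrix.smul_mul, Matrix.smul_mul, ← smul_add, h,
    eps_mul_transpose_add_mul_eps hJ0, Matrix.mul_zero, Matrix.zero_mul, smul_zero]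

/-- The bracket of `𝔥` with `√χ e`, in blocks. -/
theorem cj_mul_eBlock_sub {w11 : Matrix (Fin 2) (Fin 2) ℂ} (h : w11ᴴ = -w11)
    (w12 : Matrix (Fin 2) (Fin (n - 2)) ℂ) (w21 : Matrix (Fin (n - 2)) (Fin 2) ℂ)
    (w22 : Matrix (Fin (n - 2)) (Fin (n - 2)) ℂ) :
    cj (Matrix.fromBlocks w11 w12 w21 w22) * eBlock n - eBlock n * Matrix.fromBlocks w11 w12 w21 w22
      = Matrix.fromBlocks (-w11.trace • eps) (-(eps * w12)) (cj w21 * eps) 0 := by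
  rw [eBlock, cj_fromBlocks, Matrix.fromBlocks_multiply, Matrix.fromBlocks_multiply, sub_eq_add_neg,
    Matrix.fromBlocks_neg, Matrix.fromBlocks_add, ← cj_mul_eps_sub h]
  simp [sub_eq_add_neg]

/-- The bracket of `𝔥_⊥` with `𝔪`, in blocks. -/
theorem cj_uBlock_mul_mBlock_sub (r : ℝ) (V : Matrix (Fin (n - 2)) (Fin 2) ℂ) (c : ℂ)
    (B : Matrix (Fin (n - 2)) (Fin 2) ℂ) (D : Matrix (Fin (n - 2)) (Fin (n - 2)) ℂ) :
    cj (uBlock r V) * mBlock c B D - mBlock c B D * uBlock r V =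
      Matrix.fromBlocks ((4 * Complex.I * r * c - (Vᴴ * B).trace) • eps)
        ((2 * Complex.I * r) • Bᵀ + eps * Vᴴ * D + c • Vᵀ)
        (-c • V - (2 * Complex.I * r) • B - D * cj V * eps)
        (V * eps * Bᵀ + B * eps * Vᵀ) := by
  have h1 := eps_mul_add_transpose_mul_eps (Vᴴ * B)
  rw [Matrix.transpose_mul, conjTranspose_transpose'] at h1
  rw [uBlock, mBlock, cj_fromBlocks, Matrix.fromBlocks_multiply, Matrix.fromBlocks_multiply,
    sub_eq_add_neg, Matrix.fromBlocks_neg, Matrix.fromBlocks_add, sub_smul, ← h1]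
  congr 1
  · simp [Matrix.mul_assoc, smul_smul, Complex.conj_ofNat]
    module
  · simp [Matrix.mul_assoc, eps_mul_eps_mul, Complex.conj_ofNat]
  · simp [Matrix.mul_assoc, eps_mul_eps]
    module
  · simp [Matrix.mul_assoc]

/-- The element of `𝔥` with diagonal blocks `K` and `F`, its off-diagonal blocks being those of
`uBlock 0 Z`. For a curve flow, `g⁻¹g_t` has an `𝔥`-component of this form. -/
noncomputable def wBlock (K : Matrix (Fin 2) (Fin 2) ℂ) (Z : Matrix (Fin (n - 2)) (Fin 2) ℂ)
    (F : Matrix (Fin (n - 2)) (Fin (n - 2)) ℂ) : Matrix (Idx n) (Idx n) ℂ :=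
  Matrix.fromBlocks K (eps * Zᵀ) (cj Z * eps) F

theorem wBlock_conjTranspose {K : Matrix (Fin 2) (Fin 2) ℂ} (hK : Kᴴ = -K)
    (Z : Matrix (Fin (n - 2)) (Fin 2) ℂ)
    {F : Matrix (Fin (n - 2)) (Fin (n - 2)) ℂ} (hF : Fᴴ = -F) :
    (wBlock K Z F)ᴴ = -wBlock K Z F := by
  rw [wBlock, Matrix.fromBlocks_conjTranspose, Matrix.fromBlocks_neg, hK, hF]
  simp [Matrix.conjTranspose_mul]

/-- The bracket of `wBlock` with `𝔥_⊥`, in blocks. -/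
theorem wBlock_mul_uBlock_sub {K : Matrix (Fin 2) (Fin 2) ℂ} (hK : Kᴴ = -K)
    (Z V : Matrix (Fin (n - 2)) (Fin 2) ℂ) {F : Matrix (Fin (n - 2)) (Fin (n - 2)) ℂ}
    (hF : Fᴴ = -F) (r : ℝ) {X : Matrix (Fin 2) (Fin 2) ℂ} {Y : Matrix (Fin (n - 2)) (Fin 2) ℂ}
    (hX : X = Vᴴ * Z - Zᴴ * V) (hY : Y = K.trace • V - V * K + (2 * Complex.I * r) • Z - Fᵀ * V) :
    wBlock K Z F * uBlock r V - uBlock r V * wBlock K Z F =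
      Matrix.fromBlocks (X - X.trace • 1) (eps * Yᵀ) (cj Y * eps) (cj V * Zᵀ - cj Z * Vᵀ) := by
  have h1 := eps_mul_mul_eps (Zᵀ * cj V - Vᵀ * cj Z)
  have h1t : (Zᵀ * cj V - Vᵀ * cj Z)ᵀ = X := by
    rw [hX]; simp [Matrix.transpose_mul]
  have h2 : (eps * K * eps) = Kᵀ - K.trace • 1 := eps_mul_mul_eps K
  rw [← Matrix.trace_transpose, h1t] at h1
  have h3 : K * eps = -(eps * (Kᵀ - K.trace • 1)) := by
    rw [← h2, Matrix.mul_assoc, eps_mul_eps_mul, neg_neg]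
  have h4 : eps * K = -((Kᵀ - K.trace • 1) * eps) := by
    rw [← h2, mul_eps_mul_eps, neg_neg]
  have hcK : cj K = -Kᵀ := by rw [← cj_conjTranspose, hK, cj_neg, neg_neg]
  have hcF : Fᵀᴴ = -Fᵀ := by
    rw [transpose_conjTranspose', ← cj_conjTranspose, hF, cj_neg, neg_neg]
  have hcF' : cj Fᵀ = -F := by rw [cj_of_transpose, hF]
  have htr : starRingEnd ℂ K.trace = -K.trace := by
    rw [← trace_cj, hcK, Matrix.trace_neg, Matrix.trace_transpose]
  rw [← h1, hY, wBlock, uBlock, Matrix.fromBlocks_multiply, Matrix.fromBlocks_multiply,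
    sub_eq_add_neg, Matrix.fromBlocks_neg, Matrix.fromBlocks_add]
  congr 1
  · simp [Matrix.mul_assoc, Matrix.mul_sub, Matrix.sub_mul]
    abel
  · rw [← Matrix.mul_assoc K, h3]
    simp [Matrix.mul_assoc, Matrix.mul_sub, Matrix.sub_mul, Matrix.mul_add]
    abel
  · rw [Matrix.mul_assoc (cj V) eps K, h4]
    simp only [cj_add, cj_sub, cj_smul, cj_mul, hcK, hcF', htr]
    simp [Matrix.mul_assoc, Matrix.mul_sub, Matrix.sub_mul, Matrix.add_mul, Complex.conj_ofNat]
    abel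
  · simp [Matrix.mul_assoc, eps_mul_eps_mul]
    abel

/-- The bracket of `𝔪_⊥^ℂ` with `√χ e`, in blocks. -/
theorem cj_mBlock_mul_eBlock_sub (B : Matrix (Fin (n - 2)) (Fin 2) ℂ) :
    cj (mBlock 0 B 0) * eBlock n - cj (eBlock n) * mBlock 0 B 0 =
      -Matrix.fromBlocks 0 (eps * Bᵀ) (cj B * eps) 0 := by
  rw [eBlock, mBlock, cj_fromBlocks, cj_fromBlocks, Matrix.fromBlocks_multiply,
    Matrix.fromBlocks_multiply, sub_eq_add_neg, Matrix.fromBlocks_neg, Matrix.fromBlocks_neg,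
    Matrix.fromBlocks_add]
  simp

/-! ### The flow equation in terms of the Hasimoto variables -/

/-- The coefficients of a skew matrix, read off from its entries. -/
theorem eq_mBlock {W : Matrix (Idx n) (Idx n) ℂ} (h : Wᵀ = -W) :
    W = mBlock (W (.inl 0) (.inl 1)) (-W.toBlocks₂₁) W.toBlocks₂₂ := by
  obtain ⟨c, B, D, -, rfl⟩ := exists_mBlock h
  simp [mBlock, eps]

theorem IsHasimoto.hPart_maurerCartan (hn : 3 ≤ n) {T X : Set ℝ} {g : ℝ → ℝ → SO n}
    {r : ℝ → ℝ → ℝ} {V : ℝ → ℝ → Matrix (Fin (n - 2)) (Fin 2) ℂ} (h : IsHasimoto T X g r V)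
    {t x : ℝ} (ht : t ∈ T) (hx : x ∈ X) :
    hPart (maurerCartan (g t) x) = uBlock (r t x) (V t x) := by
  have h1 := h t ht x hx
  rw [connection_eq, sqrt_smul_lie_ee_mPerp hn] at h1
  exact hC_injective h1

theorem isHasimoto_iff (hn : 3 ≤ n) {T X : Set ℝ} {g : ℝ → ℝ → SO n}
    {r : ℝ → ℝ → ℝ} {V : ℝ → ℝ → Matrix (Fin (n - 2)) (Fin 2) ℂ} : IsHasimoto T X g r V ↔
      ∀ t ∈ T, ∀ x ∈ X, hPart (maurerCartan (g t) x) = uBlock (r t x) (V t x) := by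
  refine ⟨fun h t ht x hx => h.hPart_maurerCartan hn ht hx, fun h t ht x hx => ?_⟩
  rw [connection_eq, sqrt_smul_lie_ee_mPerp hn, h t ht x hx]

section Flow

variable {T X : Set ℝ} {γ : ℝ → ℝ → M n} {g : ℝ → ℝ → SO n} {r : ℝ → ℝ → ℝ}
  {V : ℝ → ℝ → Matrix (Fin (n - 2)) (Fin 2) ℂ}

theorem IsFlowFrame.mHasDeriv_left (hT : IsOpen T) (h : IsFlowFrame T X γ g) {t x : ℝ} (ht : t ∈ T)
    (hx : x ∈ X) :
    MHasDeriv (fun s => (g s x : Mat n)) (mderiv (fun s => (g s x : Mat n)) t) t :=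
  (h.smooth.left hx).mHasDeriv hT ht

theorem IsFlowFrame.eventually_lifts_left (hT : IsOpen T) (h : IsFlowFrame T X γ g) {t x : ℝ}
    (ht : t ∈ T) (hx : x ∈ X) : ∀ᶠ s in nhds t, γ s x = QuotientGroup.mk (g s x) :=
  Filter.eventually_of_mem (hT.mem_nhds ht) fun s hs => (h.parallel s hs).lifts x hx

theorem IsFlowFrame.velocity_left (hT : IsOpen T) (h : IsFlowFrame T X γ g) {t x : ℝ} (ht : t ∈ T)
    (hx : x ∈ X) : velocity (fun s => γ s x) t =
      solder (g t x) (mC (mPart (maurerCartan (fun s => g s x) t))) :=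
  velocity_eq (h.mHasDeriv_left hT ht hx) (h.eventually_lifts_left hT ht hx)

theorem IsFlowFrame.coframe_velocity_left (hT : IsOpen T) (h : IsFlowFrame T X γ g) {t x : ℝ}
    (ht : t ∈ T) (hx : x ∈ X) : coframe (g t x) (velocity (fun s => γ s x) t) =
      mC (mPart (maurerCartan (fun s => g s x) t)) := by
  rw [h.velocity_left hT ht hx, coframe_solder_mC]

theorem IsFlowFrame.maurerCartan_left_transpose (hT : IsOpen T) (h : IsFlowFrame T X γ g) {t x : ℝ}
    (ht : t ∈ T) (hx : x ∈ X) : (maurerCartan (fun s => g s x) t)ᵀ =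
      -maurerCartan (fun s => g s x) t :=
  maurerCartan_transpose (h.mHasDeriv_left hT ht hx)

theorem smul_mPerp_mul_eq (c : ℝ) (B : Matrix (Fin (n - 2)) (Fin 2) ℂ) :
    c • mPerp 0 B = mC (mBlock 0 (c • B) 0) := by
  rw [mPerp_smul, mPerp_eq]; simp

/-- Both sides of the flow equation in terms of the Hasimoto variables. -/
theorem IsFlowFrame.isCurveFlow_iff (hn : 3 ≤ n) (hT : IsOpen T) (hX : IsOpen X)
    (h : IsFlowFrame T X γ g) (hrV : IsHasimoto T X g r V) (a : ℝ) (b : ℂ) :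
    (∀ t ∈ T, ∀ x ∈ X, coframe (g t x) (velocity (fun s => γ s x) t) =
      (1 / √(χ n)) • mPerp 0 (V t x * suGen a b)) ↔ IsCurveFlow (suGen a b) T X γ g := by
  refine forall₄_congr fun t ht x hx => ?_
  have h0 := h.parallel t ht
  have hc : connection (g t) x = hC (uBlock (r t x) (V t x)) := by
    rw [connection_eq, hrV.hPart_maurerCartan hn ht hx]
  rw [h0.frameMap_normal hX hx hc, h0.velocity_eq hX hx, h0.lifts x hx, metric_ee _ hn,
    h.velocity_left hT ht hx, coframe_solder_mC, smul_mPerp_mul_eq]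
  exact ⟨fun h1 => ⟨by rw [h1], rfl⟩, fun h1 => congrArg mC (solder_mC_injective _ h1.1)⟩

/-- The `𝔪`-component of the zero curvature equation determines the derivative of the velocity of
the flow. -/
theorem IsFlowFrame.mderiv_mPart (hn : 3 ≤ n) (hT : IsOpen T) (hX : IsOpen X)
    (h : IsFlowFrame T X γ g) (hrV : IsHasimoto T X g r V) {t x : ℝ} (ht : t ∈ T) (hx : x ∈ X)
    {K : Matrix (Fin 2) (Fin 2) ℂ} {w12 w21 w22}
    (hw : hPart (maurerCartan (fun s => g s x) t) = Matrix.fromBlocks K w12 w21 w22) {c B D}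
    (hW : mPart (maurerCartan (fun s => g s x) t) = mBlock c B D) :
    MHasDeriv (fun y => mPart (maurerCartan (fun s => g s y) t))
      ((1 / √(χ n)) • Matrix.fromBlocks (-K.trace • eps) (-(eps * w12)) (cj w21 * eps) 0 -
      Matrix.fromBlocks ((4 * Complex.I * r t x * c - ((V t x)ᴴ * B).trace) • eps)
        ((2 * Complex.I * r t x) • Bᵀ + eps * (V t x)ᴴ * D + c • (V t x)ᵀ)
        (-c • V t x - (2 * Complex.I * r t x) • B - D * cj (V t x) * eps)
        (V t x * eps * Bᵀ + B * eps * (V t x)ᵀ)) x := by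
  have hK : Kᴴ = -K := by
    have h1 := hPart_conjTranspose_of_skew (h.maurerCartan_left_transpose hT ht hx)
    rw [hw, Matrix.fromBlocks_conjTranspose, Matrix.fromBlocks_neg, Matrix.fromBlocks_inj] at h1
    exact h1.1
  have hA : MHasDeriv (fun s => mPart (maurerCartan (g s) x)) 0 t :=
    (MHasDeriv.const _).congr_of_eventuallyEq <| Filter.eventually_of_mem (hT.mem_nhds ht)
      fun s hs => (h.parallel s hs).mPart_maurerCartan hX hx
  have hW' := ((((h.smooth.maurerCartan_left hT hX).right ht).mHasDeriv hX hx)).mPart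
  have h1 := zero_curvature_m hT hX h.smooth ht hx (hrV.hPart_maurerCartan hn ht hx)
    ((h.parallel t ht).mPart_maurerCartan hX hx) hw hW hA hW'
  refine hW'.congr_deriv ?_
  rw [← cj_uBlock_mul_mBlock_sub, ← cj_mul_eBlock_sub hK, smul_sub]
  rw [mul_smul_comm, smul_mul_assoc] at h1
  have h2 := eq_neg_of_add_eq_zero_left h1
  rw [zero_sub, neg_inj] at h2
  exact h2

/-- If the perpendicular part of the velocity of the flow is the generator `(0, (v₁, v₂)J)`, then
the parallel part is constant along each curve: the component along `e` has the derivative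
`Re tr(J (v₁, v₂)ᴴ(v₁, v₂)) = 0`, and the lower block has the derivative
`V (εJᵀ + Jε) Vᵀ = 0`. -/
theorem IsFlowFrame.mderiv_par_eq_zero (hn : 3 ≤ n) (hT : IsOpen T) (hX : IsOpen X)
    (h : IsFlowFrame T X γ g) (hrV : IsHasimoto T X g r V) {J : Matrix (Fin 2) (Fin 2) ℂ}
    (hJ : Jᴴ = -J) (hJ0 : J.trace = 0)
    (hflow : ∀ t ∈ T, ∀ x ∈ X, projPerp (coframe (g t x) (velocity (fun s => γ s x) t)) =
      (1 / √(χ n)) • mPerp 0 (V t x * J)) {t x : ℝ} (ht : t ∈ T) (hx : x ∈ X) :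
    mderiv (fun y => coframe (g t y) (velocity (fun s => γ s y) t) -
      projPerp (coframe (g t y) (velocity (fun s => γ s y) t))) x = 0 := by
  set W : ℝ → Matrix (Idx n) (Idx n) ℂ := fun y => mPart (maurerCartan (fun s => g s y) t)
    with hWdef
  set c : ℝ → ℂ := fun y => W y (.inl 0) (.inl 1) with hc
  have hWy : ∀ y ∈ X, W y = mBlock (c y) ((1 / √(χ n)) • (V t y * J)) (W y).toBlocks₂₂ ∧
      (c y).im = 0 := by
    intro y hy
    have h1 := eq_mBlock (mPart_transpose_of_skew (h.maurerCartan_left_transpose hT ht hy))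
    have h2 := hflow t ht y hy
    rw [h.coframe_velocity_left hT ht hy, h1, projPerp_mC hn, smul_mPerp_mul_eq, mPerp_eq] at h2
    obtain ⟨h3, h4, -⟩ := mBlock_inj.1 (mC_injective h2)
    refine ⟨?_, by simpa using h3⟩
    rw [← h4]; exact h1
  set w := hPart (maurerCartan (fun s => g s x) t) with hw
  have hwb : w = Matrix.fromBlocks w.toBlocks₁₁ w.toBlocks₁₂ w.toBlocks₂₁ w.toBlocks₂₂ :=
    (Matrix.fromBlocks_toBlocks w).symm
  have hK : (w.toBlocks₁₁)ᴴ = -w.toBlocks₁₁ := by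
    have h1 := hPart_conjTranspose_of_skew (h.maurerCartan_left_transpose hT ht hx)
    rw [← hw, hwb, Matrix.fromBlocks_conjTranspose, Matrix.fromBlocks_neg,
      Matrix.fromBlocks_inj] at h1
    exact h1.1
  have hd := h.mderiv_mPart hn hT hX hrV ht hx hwb (hWy x hx).1
  set s := 1 / √(χ n) with hs
  -- The derivative of the coefficient of `e` is imaginary, but the coefficient is real.
  have hc1 := hd (.inl 0) (.inl 1)
  have hcre : HasDerivAt (fun y => (c y).re) 0 x := by
    have h1 := (Complex.reCLM.hasFDerivAt.comp_hasDerivAt x hc1)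
    refine h1.congr_deriv ?_
    have h2 : w.toBlocks₁₁.trace.re = 0 := by
      apply re_eq_zero_of_conj_eq_neg
      rw [← trace_cj, ← Matrix.trace_transpose, cj_transpose, hK, Matrix.trace_neg]
    have h3 := re_eq_zero_of_conj_eq_neg (conj_trace_gram_mul (V t x) hJ)
    simp [eps, h2, h3, (hWy x hx).2]
  have hc' : HasDerivAt c 0 x := by
    have h1 := hcre.complexMk (hasDerivAt_const x (0 : ℝ))
    refine h1.congr_of_eventuallyEq (Filter.eventually_of_mem (hX.mem_nhds hx) fun y hy => ?_)
    exact Complex.ext rfl (hWy y hy).2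
  have hD' : MHasDeriv (fun y => (W y).toBlocks₂₂) 0 x := by
    refine (hd.submatrix Sum.inr Sum.inr).congr_deriv ?_
    rw [mul_eps_mul_transpose_add hJ0]
    ext i j; simp
  have hfin : MHasDeriv (fun y => mC (mBlock (c y) 0 (W y).toBlocks₂₂)) 0 x := by
    have h1 : MHasDeriv (fun y => c y • eps) 0 x := by
      refine (MHasDeriv.smul hc' (MHasDeriv.const eps)).congr_deriv ?_
      simp
    have h2 := (h1.fromBlocks (B := fun _ => (0 : Matrix (Fin (n - 2)) (Fin 2) ℂ)ᵀ)
      (C := fun _ => -(0 : Matrix (Fin (n - 2)) (Fin 2) ℂ)) (MHasDeriv.const _)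
      (MHasDeriv.const _) hD').mC
    refine h2.congr_deriv ?_
    rw [Matrix.fromBlocks_zero, mC_zero]
  refine (hfin.congr_of_eventuallyEq (Filter.eventually_of_mem (hX.mem_nhds hx)
    fun y hy => ?_)).mderiv
  rw [hflow t ht y hy, h.coframe_velocity_left hT ht hy, smul_mPerp_mul_eq, ← mC_sub]
  congr 1
  have h1 := (hWy y hy).1
  simp only [hWdef] at h1 ⊢
  conv_lhs => rw [h1]
  rw [sub_eq_iff_eq_add, mBlock_add, add_zero, zero_add, add_zero]

end Flow

/-! ### The algebra of the NLS system -/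

section Algebra

variable {m : Type*} [Fintype m]

/-- The `u(2)`-block of the bracket of the `𝔥_⊥^ℂ`-components of `g⁻¹g_t` and `u`, up to a multiple
of the identity. -/
theorem gram_sub_eq {J : Matrix (Fin 2) (Fin 2) ℂ} (hJ : Jᴴ = -J) (r : ℝ)
    (V Vx : Matrix m (Fin 2) ℂ) :
    Vᴴ * (Vx * J + (2 * Complex.I * r) • (V * J)) - (Vx * J + (2 * Complex.I * r) • (V * J))ᴴ * V =
      Vᴴ * Vx * J + J * (Vxᴴ * V) + (2 * Complex.I * r) • ⁅Vᴴ * V, J⁆ := by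
  have h : star (2 * Complex.I * (r : ℂ)) = -(2 * Complex.I * r) := by
    simp
  rw [Matrix.conjTranspose_add, Matrix.conjTranspose_smul, h, Matrix.conjTranspose_mul,
    Matrix.conjTranspose_mul, hJ, Ring.lie_def]
  simp only [Matrix.mul_add, Matrix.add_mul, Matrix.mul_smul, Matrix.smul_mul, Matrix.neg_mul,
    Matrix.mul_assoc, smul_sub, smul_neg, neg_smul, neg_neg]
  abel

/-- The `su(2) ⊕ u(1)` component of the zero curvature equation, split into trace and traceless
part. -/
theorem nls_block₁₁ {J : Matrix (Fin 2) (Fin 2) ℂ} (hJ : Jᴴ = -J) (r rt : ℝ)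
    {V Vx Z : Matrix m (Fin 2) ℂ} (hZ : Z = Vx * J + (2 * Complex.I * r) • (V * J))
    {X Θx L Lx N : Matrix (Fin 2) (Fin 2) ℂ} (hX : X = Vᴴ * Z - Zᴴ * V) (hL : L = Vᴴ * V)
    (hLx : Lx = Vxᴴ * V + Vᴴ * Vx) (hN : N = Vᴴ * Vx - Vxᴴ * V) :
    (-2 * Complex.I * rt) • 1 - (Θx + (1 / 2 : ℂ) • (J * Lx + Lx * J)) + (X - X.trace • 1) =
      (-2 * Complex.I * rt - (Lx * J).trace) • 1 +
        ((2 * Complex.I * r) • ⁅L, J⁆ + (1 / 2 : ℂ) • ⁅N, J⁆ - Θx) := by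
  have hX' : X = Vᴴ * Vx * J + J * (Vxᴴ * V) + (2 * Complex.I * r) • ⁅L, J⁆ := by
    rw [hX, hZ, gram_sub_eq hJ, hL]
  have htr : X.trace = (Lx * J).trace := by
    rw [hX', hLx, Ring.lie_def, Matrix.trace_add, Matrix.trace_add, Matrix.trace_smul,
      Matrix.trace_sub, Matrix.trace_mul_comm L J, sub_self, smul_zero, add_zero, Matrix.add_mul,
      Matrix.trace_add, Matrix.trace_mul_comm J, add_comm]
  rw [htr, hX', hLx, hN]
  generalize Vᴴ * Vx = A
  generalize Vxᴴ * V = B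
  generalize ((B + A) * J).trace = τ
  simp only [Ring.lie_def, Matrix.mul_add, Matrix.add_mul, Matrix.sub_mul, Matrix.mul_sub]
  module

/-- The `𝔥_⊥^ℂ` component of the zero curvature equation. -/
theorem nls_block₁₂ {J Θ K L : Matrix (Fin 2) (Fin 2) ℂ} (hΘ : Θ.trace = 0) (r rx k : ℝ)
    {V Vx Vxx Vt Z Zx : Matrix m (Fin 2) ℂ} (hZ : Z = Vx * J + (2 * Complex.I * r) • (V * J))
    (hZx : Zx = Vxx * J + ((2 * Complex.I * rx) • (V * J) + (2 * Complex.I * r) • (Vx * J)))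
    (hK : K = Θ + (1 / 2 : ℂ) • (J * L + L * J)) {F : Matrix m m ℂ}
    (hF : F * V = V * J * L) :
    Vt - Zx + (K.trace • V - V * K + (2 * Complex.I * r) • Z - F * V) - (k : ℂ) • (V * J) =
      (Vt - (k : ℂ) • (V * J)) - (Vxx * J +
         (2 * Complex.I * (rx : ℂ) + 4 * (r : ℂ) ^ 2) • (V * J)
         + V * ((J * L + L * J) + (1 / 2 : ℂ) • ⁅J, L⁆ - (J * L).trace • 1)
         + V * Θ) := by
  have htr : K.trace = (J * L).trace := by
    rw [hK, Matrix.trace_add, hΘ, Matrix.trace_smul, Matrix.trace_add, Matrix.trace_mul_comm L J,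
      zero_add, smul_eq_mul]
    ring
  have hI : (2 * Complex.I * (r : ℂ)) * (2 * Complex.I * r) = -(4 * (r : ℂ) ^ 2) := by
    linear_combination (4 * (r : ℂ) ^ 2) * Complex.I_mul_I
  rw [hF, htr, hK, hZ, hZx, Ring.lie_def, smul_add (2 * Complex.I * (r : ℂ)), smul_smul, hI]
  simp only [Matrix.mul_add, Matrix.mul_sub, Matrix.mul_smul, Matrix.mul_one, Matrix.mul_assoc]
  module

end Algebra

/-! ### Linear differential equations with skew coefficients -/

section LinearODE

open Set Filter Topology

/-- The radial retraction onto the closed unit ball. -/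
noncomputable def radialRetraction {E : Type*} [NormedAddCommGroup E] [NormedSpace ℝ E] (y : E) :
    E :=
  (max 1 ‖y‖)⁻¹ • y

section Retraction

variable {E : Type*} [NormedAddCommGroup E] [NormedSpace ℝ E]

theorem norm_radialRetraction_le (y : E) : ‖radialRetraction y‖ ≤ 1 := by
  have h : 0 < max 1 ‖y‖ := lt_max_of_lt_left one_pos
  rw [radialRetraction, norm_smul, norm_inv, Real.norm_of_nonneg h.le, inv_mul_le_one₀ h]
  exact le_max_right _ _

theorem radialRetraction_of_norm_le {y : E} (h : ‖y‖ ≤ 1) : radialRetraction y = y := by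
  rw [radialRetraction, max_eq_left h, inv_one, one_smul]

theorem norm_radialRetraction_sub_le (y z : E) :
    ‖radialRetraction y - radialRetraction z‖ ≤ 2 * ‖y - z‖ := by
  set a := max 1 ‖y‖ with ha
  set b := max 1 ‖z‖ with hb
  have ha1 : 1 ≤ a := le_max_left _ _
  have hb1 : 1 ≤ b := le_max_left _ _
  have ha0 : 0 < a := one_pos.trans_le ha1
  have hb0 : 0 < b := one_pos.trans_le hb1
  have h1 : radialRetraction y - radialRetraction z =
      a⁻¹ • (y - z) + (a⁻¹ * (b - a)) • (b⁻¹ • z) := by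
    have : a⁻¹ * (b - a) * b⁻¹ = a⁻¹ - b⁻¹ := by field_simp
    rw [smul_smul, this, radialRetraction, radialRetraction, ← ha, ← hb]
    module
  have hab : |b - a| ≤ ‖y - z‖ := by
    have h2 : |b - a| ≤ |‖z‖ - ‖y‖| := by
      have h3 := abs_max_sub_max_le_max (1 : ℝ) ‖z‖ 1 ‖y‖
      rw [sub_self, abs_zero, max_eq_right (abs_nonneg (‖z‖ - ‖y‖))] at h3
      exact h3
    rw [← norm_sub_rev z y]
    exact h2.trans (abs_norm_sub_norm_le z y)
  have hz : ‖b⁻¹ • z‖ ≤ 1 := norm_radialRetraction_le z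
  have hia : a⁻¹ ≤ 1 := inv_le_one_of_one_le₀ ha1
  have hia0 : 0 ≤ a⁻¹ := (inv_pos.2 ha0).le
  calc ‖radialRetraction y - radialRetraction z‖
      ≤ ‖a⁻¹ • (y - z)‖ + ‖(a⁻¹ * (b - a)) • (b⁻¹ • z)‖ := by rw [h1]; exact norm_add_le _ _
    _ ≤ ‖y - z‖ + ‖y - z‖ := by
        refine add_le_add ?_ ?_
        · rw [norm_smul, Real.norm_of_nonneg hia0]
          exact mul_le_of_le_one_left (norm_nonneg _) hia
        · rw [norm_smul, norm_mul, Real.norm_of_nonneg hia0, Real.norm_eq_abs]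
          calc a⁻¹ * |b - a| * ‖b⁻¹ • z‖ ≤ a⁻¹ * |b - a| * 1 := by gcongr
            _ ≤ 1 * ‖y - z‖ * 1 := by gcongr
            _ = ‖y - z‖ := by ring
    _ = 2 * ‖y - z‖ := by ring

end Retraction

theorem eq_of_hasDerivWithinAt_zero {E : Type*} [NormedAddCommGroup E] [NormedSpace ℝ E]
    {f : ℝ → E} {s : Set ℝ} (hs : Convex ℝ s) (h : ∀ x ∈ s, HasDerivWithinAt f 0 s x) {x y : ℝ}
    (hx : x ∈ s) (hy : y ∈ s) : f x = f y := by
  have h1 := hs.norm_image_sub_le_of_norm_hasDerivWithin_le (C := 0) h (by simp) hy hx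
  rw [zero_mul] at h1
  exact sub_eq_zero.1 (norm_le_zero_iff.1 h1)

variable {A : Type*} [NormedRing A] [StarRing A] [CStarRing A]

theorem norm_le_one_of_mul_star_eq_one {y : A} (h : y * star y = 1) : ‖y‖ ≤ 1 := by
  rcases subsingleton_or_nontrivial A with h0 | h0
  · rw [Subsingleton.elim y 0, norm_zero]; exact zero_le_one
  · have h1 := CStarRing.norm_self_mul_star (x := y)
    rw [h, CStarRing.norm_one] at h1
    nlinarith [norm_nonneg y]

variable [NormedAlgebra ℝ A] [StarModule ℝ A]

/-- On a compact interval, the equation `y' = yP` with skew `P` has a unitary solution: the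
equation `y' = ρ(y)P`, with the radial retraction `ρ` onto the unit ball, has a bounded Lipschitz
right hand side, and preserves `y y*`. -/
theorem exists_unitary_solution_Icc [CompleteSpace A] {P : ℝ → A} {α β x₀ : ℝ} (hα : α ≤ x₀)
    (hβ : x₀ ≤ β) (hP : ContinuousOn P (Icc α β)) (hskew : ∀ x ∈ Icc α β, star (P x) = -P x)
    {y₀ : A} (hy₀ : y₀ * star y₀ = 1) :
    ∃ y : ℝ → A, y x₀ = y₀ ∧ ∀ x ∈ Icc α β, HasDerivWithinAt y (y x * P x) (Icc α β) x ∧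
      y x * star (y x) = 1 := by
  obtain ⟨C, hC⟩ := isCompact_Icc.exists_bound_of_continuousOn hP
  have hx₀ : x₀ ∈ Icc α β := ⟨hα, hβ⟩
  have hC0 : 0 ≤ C := (norm_nonneg _).trans (hC x₀ hx₀)
  obtain ⟨C', hC'⟩ : ∃ C' : NNReal, (C' : ℝ) = C := ⟨_, Real.coe_toNNReal C hC0⟩
  have hm0 : 0 ≤ max (β - x₀) (x₀ - α) := le_max_of_le_left (sub_nonneg.2 hβ)
  obtain ⟨m, hm⟩ : ∃ m : NNReal, (m : ℝ) = max (β - x₀) (x₀ - α) := ⟨_, Real.coe_toNNReal _ hm0⟩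
  have hpl : IsPicardLindelof (fun x y => radialRetraction y * P x)
      (⟨x₀, hx₀⟩ : Icc α β) y₀ (C' * m) 0 C' (2 * C') := by
    refine ⟨fun x hx => ?_, fun y _ => continuousOn_const.mul hP, fun x hx y _ => ?_, ?_⟩
    · refine LipschitzOnWith.of_dist_le_mul fun y _ z _ => ?_
      rw [dist_eq_norm, dist_eq_norm, ← sub_mul]
      calc ‖(radialRetraction y - radialRetraction z) * P x‖
          ≤ ‖radialRetraction y - radialRetraction z‖ * ‖P x‖ := norm_mul_le _ _
        _ ≤ (2 * ‖y - z‖) * C := mul_le_mul (norm_radialRetraction_sub_le y z) (hC x hx)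
            (norm_nonneg _) (by positivity)
        _ = ((2 * C' : NNReal) : ℝ) * ‖y - z‖ := by
            rw [NNReal.coe_mul, hC', NNReal.coe_ofNat]; ring
    · calc ‖radialRetraction y * P x‖ ≤ ‖radialRetraction y‖ * ‖P x‖ := norm_mul_le _ _
        _ ≤ 1 * C := mul_le_mul (norm_radialRetraction_le y) (hC x hx) (norm_nonneg _) zero_le_one
        _ = (C' : ℝ) := by rw [one_mul, hC']
    · rw [NNReal.coe_mul, hm, NNReal.coe_zero, sub_zero]
  obtain ⟨y, hy0, hy⟩ := hpl.exists_eq_forall_mem_Icc_hasDerivWithinAt₀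
  refine ⟨y, hy0, ?_⟩
  -- The retraction is a positive multiple of `y`, so the skewness of `P` still makes `y y*`
  -- constant.
  have hE : ∀ x ∈ Icc α β, HasDerivWithinAt (fun x => y x * star (y x)) 0 (Icc α β) x := by
    intro x hx
    refine ((hy x hx).mul (hy x hx).star).congr_deriv ?_
    rw [radialRetraction, star_mul, star_smul, hskew x hx]
    simp only [smul_mul_assoc, mul_smul_comm, neg_mul, mul_neg, smul_neg, mul_assoc]
    simp
  have hu : ∀ x ∈ Icc α β, y x * star (y x) = 1 := by
    intro x hx
    rw [← hy₀, ← hy0]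
    exact eq_of_hasDerivWithinAt_zero (convex_Icc α β) hE hx hx₀
  intro x hx
  refine ⟨(hy x hx).congr_deriv ?_, hu x hx⟩
  rw [radialRetraction_of_norm_le (norm_le_one_of_mul_star_eq_one (hu x hx))]

/-- Two unitary solutions `y`, `z` agree, since `y z*` is constant. -/
theorem unitary_solution_unique [IsDedekindFiniteMonoid A] {P y z : ℝ → A} {s : Set ℝ}
    (hs : Convex ℝ s) (hskew : ∀ x ∈ s, star (P x) = -P x)
    (hy : ∀ x ∈ s, HasDerivWithinAt y (y x * P x) s x ∧ y x * star (y x) = 1)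
    (hz : ∀ x ∈ s, HasDerivWithinAt z (z x * P x) s x ∧ z x * star (z x) = 1) {x₀ x : ℝ}
    (hx₀ : x₀ ∈ s) (h0 : y x₀ = z x₀) (hx : x ∈ s) : y x = z x := by
  have hE : ∀ x ∈ s, HasDerivWithinAt (fun x => y x * star (z x)) 0 s x := by
    intro x hx
    refine ((hy x hx).1.mul (hz x hx).1.star).congr_deriv ?_
    rw [star_mul, hskew x hx]; noncomm_ring
  have h1 := eq_of_hasDerivWithinAt_zero hs hE hx hx₀
  simp only [h0, (hz x₀ hx₀).2] at h1
  calc y x = y x * (star (z x) * z x) := by rw [mul_eq_one_comm.1 (hz x hx).2, mul_one]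
    _ = z x := by rw [← mul_assoc, h1, one_mul]

/-- On an open interval, the equation `y' = yP` with skew `P` has a unitary solution. -/
theorem exists_unitary_solution [CompleteSpace A] [IsDedekindFiniteMonoid A] {P : ℝ → A}
    {X : Set ℝ} (hX : IsOpen X) (hX' : X.OrdConnected) (hP : ContinuousOn P X)
    (hskew : ∀ x ∈ X, star (P x) = -P x) {x₀ : ℝ} (hx₀ : x₀ ∈ X) {y₀ : A}
    (hy₀ : y₀ * star y₀ = 1) :
    ∃ y : ℝ → A, y x₀ = y₀ ∧ ∀ x ∈ X, HasDerivAt y (y x * P x) x ∧ y x * star (y x) = 1 := by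
  -- Each point lies inside a compact interval that contains `x₀`.
  have hI : ∀ x ∈ X, ∃ α β, α ≤ x₀ ∧ x₀ ≤ β ∧ Icc α β ⊆ X ∧ Icc α β ∈ 𝓝 x := by
    intro x hx
    obtain ⟨ε, hε, hball⟩ := Metric.isOpen_iff.1 hX x hx
    have hl : x - ε / 2 ∈ X := hball (by
      rw [Metric.mem_ball, Real.dist_eq, abs_lt]; constructor <;> linarith)
    have hr : x + ε / 2 ∈ X := hball (by
      rw [Metric.mem_ball, Real.dist_eq, abs_lt]; constructor <;> linarith)
    have hl' : min (x - ε / 2) x₀ ∈ X := by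
      rcases min_choice (x - ε / 2) x₀ with h | h <;> rw [h] <;> assumption
    have hr' : max (x + ε / 2) x₀ ∈ X := by
      rcases max_choice (x + ε / 2) x₀ with h | h <;> rw [h] <;> assumption
    exact ⟨_, _, min_le_right _ _, le_max_right _ _, hX'.out hl' hr',
      Icc_mem_nhds (lt_of_le_of_lt (min_le_left _ _) (by linarith))
        (lt_of_lt_of_le (by linarith) (le_max_left _ _))⟩
  choose! α β hα hβ hsub hnhds using hI
  have hsol : ∀ x ∈ X, ∃ y : ℝ → A, y x₀ = y₀ ∧ ∀ x' ∈ Icc (α x) (β x),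
      HasDerivWithinAt y (y x' * P x') (Icc (α x) (β x)) x' ∧ y x' * star (y x') = 1 :=
    fun x hx => exists_unitary_solution_Icc (hα x hx) (hβ x hx) (hP.mono (hsub x hx))
      (fun x' hx' => hskew x' (hsub x hx hx')) hy₀
  choose! Y hY0 hY using hsol
  -- By uniqueness the local solutions agree where they overlap.
  refine ⟨fun x => Y x x, hY0 x₀ hx₀, fun x hx => ?_⟩
  have hloc : ∀ᶠ x' in 𝓝 x, Y x' x' = Y x x' := by
    filter_upwards [hnhds x hx, hX.mem_nhds hx] with x' hx'I hx'X
    have h1 := mem_of_mem_nhds (hnhds x' hx'X)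
    refine unitary_solution_unique ((convex_Icc (α x') (β x')).inter (convex_Icc (α x) (β x)))
      (fun z hz => hskew z (hsub x hx hz.2))
      (fun z hz => ⟨((hY x' hx'X z hz.1).1).mono inter_subset_left, (hY x' hx'X z hz.1).2⟩)
      (fun z hz => ⟨((hY x hx z hz.2).1).mono inter_subset_right, (hY x hx z hz.2).2⟩)
      (x₀ := x₀) ⟨⟨hα x' hx'X, hβ x' hx'X⟩, ⟨hα x hx, hβ x hx⟩⟩ ?_ ⟨h1, hx'I⟩
    rw [hY0 x' hx'X, hY0 x hx]
  have h2 := hY x hx x (mem_of_mem_nhds (hnhds x hx))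
  exact ⟨(h2.1.hasDerivAt (hnhds x hx)).congr_of_eventuallyEq hloc, h2.2⟩

end LinearODE

/-! ### Flat connections in two variables -/

section Flat

open Set Filter Topology

/-- The difference quotients in `t` of a smooth function of `(t, x)` converge uniformly for `x` in
a compact set. -/
theorem eventually_forall_norm_sub_le {E : Type*} [NormedAddCommGroup E] [NormedSpace ℝ E]
    {f : ℝ → ℝ → E} {T X K : Set ℝ} (hT : IsOpen T) (hX : IsOpen X)
    (hf : ContDiffOn ℝ ∞ (fun p : ℝ × ℝ => f p.1 p.2) (T ×ˢ X)) {t : ℝ} (ht : t ∈ T)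
    (hK : IsCompact K) (hKX : K ⊆ X) {ε : ℝ} (hε : 0 < ε) :
    ∀ᶠ s in 𝓝 t, ∀ y ∈ K,
      ‖f s y - f t y - (s - t) • deriv (fun s => f s y) t‖ ≤ ε * |s - t| := by
  set F : ℝ × ℝ → E := fun p => deriv (fun s => f s p.2) p.1 with hF
  have hFc : ContinuousOn F (T ×ˢ X) := (contDiffOn_deriv_left hT hX hf).continuousOn
  have h1 : ∀ᶠ τ in 𝓝 t, ∀ y ∈ K, ‖F (τ, y) - F (t, y)‖ < ε ∧ τ ∈ T := by
    refine hK.eventually_forall_of_forall_eventually fun y hy => ?_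
    have hc : ContinuousAt F (t, y) :=
      hFc.continuousAt ((hT.prod hX).mem_nhds ⟨ht, hKX hy⟩)
    have hc' : ContinuousAt (fun z : ℝ × ℝ => F (t, z.2)) (t, y) :=
      ContinuousAt.comp (f := fun z : ℝ × ℝ => (t, z.2)) (x := (t, y)) hc (by fun_prop)
    have hc2 : Tendsto (fun z : ℝ × ℝ => ‖F z - F (t, z.2)‖) (𝓝 (t, y)) (𝓝 0) := by
      have := (hc.sub hc').norm
      rw [ContinuousAt] at this
      simpa using this
    have hTe : ∀ᶠ z : ℝ × ℝ in 𝓝 (t, y), z.1 ∈ T :=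
      continuousAt_fst.eventually (hT.mem_nhds ht)
    exact (hc2.eventually (gt_mem_nhds hε)).and hTe
  obtain ⟨δ, hδ, hball⟩ := Metric.eventually_nhds_iff_ball.1 h1
  filter_upwards [Metric.ball_mem_nhds t hδ] with s hs y hy
  have h2 : ∀ τ ∈ Metric.ball t δ, HasDerivWithinAt (fun τ => f τ y - τ • F (t, y))
      (F (τ, y) - F (t, y)) (Metric.ball t δ) τ := by
    intro τ hτ
    have h3 : HasDerivAt (fun s => f s y) (F (τ, y)) τ :=
      ((hasDerivAt_left_of_differentiableAt (differentiableAt_of_contDiffOn_prod hT hX hf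
        (hball τ hτ y hy).2 (hKX hy))).differentiableAt).hasDerivAt
    have h4 := (hasDerivAt_id τ).smul_const (F (t, y))
    rw [one_smul] at h4
    exact (h3.sub h4).hasDerivWithinAt
  have h5 := (convex_ball t δ).norm_image_sub_le_of_norm_hasDerivWithin_le h2
    (fun τ hτ => (hball τ hτ y hy).1.le) (Metric.mem_ball_self hδ) hs
  have h6 : f s y - f t y - (s - t) • F (t, y) =
      f s y - s • F (t, y) - (f t y - t • F (t, y)) := by module
  rw [← Real.norm_eq_abs, h6]
  exact h5

theorem norm_mul_le_of_norm_le_one_left {A : Type*} [NormedRing A] {y z : A} (h : ‖y‖ ≤ 1) :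
    ‖y * z‖ ≤ ‖z‖ :=
  (norm_mul_le y z).trans (mul_le_of_le_one_left (norm_nonneg z) h)

theorem norm_mul_le_of_norm_le_one_right {A : Type*} [NormedRing A] {y z : A} (h : ‖z‖ ≤ 1) :
    ‖y * z‖ ≤ ‖y‖ :=
  (norm_mul_le y z).trans (mul_le_of_le_one_right (norm_nonneg y) h)

/-- A bounded function with `G_x = GP` and `G_t = GQ` is smooth if `P` and `Q` are. -/
theorem contDiffOn_of_hasDerivAt_mul {A : Type*} [NormedRing A] [NormedAlgebra ℝ A]
    {P Q G : ℝ → ℝ → A} {T X : Set ℝ} (hT : IsOpen T) (hX : IsOpen X)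
    (hP : ContDiffOn ℝ ∞ (fun p : ℝ × ℝ => P p.1 p.2) (T ×ˢ X))
    (hQ : ContDiffOn ℝ ∞ (fun p : ℝ × ℝ => Q p.1 p.2) (T ×ˢ X))
    (hG : ∀ t ∈ T, ∀ x ∈ X, ‖G t x‖ ≤ 1)
    (hGx : ∀ t ∈ T, ∀ x ∈ X, HasDerivAt (G t) (G t x * P t x) x)
    (hGt : ∀ t ∈ T, ∀ x ∈ X, HasDerivAt (fun s => G s x) (G t x * Q t x) t) :
    ContDiffOn ℝ ∞ (fun p : ℝ × ℝ => G p.1 p.2) (T ×ˢ X) := by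
  have hO := hT.prod hX
  -- Continuity: the derivative in `x` is bounded near each point.
  have hcont : ∀ p ∈ T ×ˢ X, ContinuousAt (fun p : ℝ × ℝ => G p.1 p.2) p := by
    rintro ⟨t, x⟩ ⟨ht, hx⟩
    have hPc : ContinuousAt (fun p : ℝ × ℝ => ‖P p.1 p.2‖) (t, x) :=
      (hP.continuousOn.continuousAt (hO.mem_nhds ⟨ht, hx⟩)).norm
    obtain ⟨C, hC⟩ : ∃ C, ‖P t x‖ < C := exists_gt _
    have h1 : ∀ᶠ p in 𝓝 ((t, x) : ℝ × ℝ), ‖P p.1 p.2‖ < C ∧ p ∈ T ×ˢ X :=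
      (hPc.eventually (gt_mem_nhds hC)).and (hO.mem_nhds ⟨ht, hx⟩)
    obtain ⟨δ, hδ, hball⟩ := Metric.eventually_nhds_iff_ball.1 h1
    have h2 : ∀ p ∈ Metric.ball ((t, x) : ℝ × ℝ) δ,
        ‖G p.1 p.2 - G p.1 x‖ ≤ C * ‖p.2 - x‖ := by
      rintro ⟨s, y⟩ hp
      rw [← ball_prod_same] at hp
      have hb : ∀ z ∈ Metric.ball x δ, ‖P s z‖ < C ∧ s ∈ T ∧ z ∈ X := by
        intro z hz
        have := hball (s, z) (by rw [← ball_prod_same]; exact ⟨hp.1, hz⟩)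
        exact ⟨this.1, this.2.1, this.2.2⟩
      refine (convex_ball x δ).norm_image_sub_le_of_norm_hasDerivWithin_le
        (fun z hz => (hGx s (hb z hz).2.1 z (hb z hz).2.2).hasDerivWithinAt)
        (fun z hz => ?_) (Metric.mem_ball_self hδ) hp.2
      exact (norm_mul_le_of_norm_le_one_left (hG s (hb z hz).2.1 z (hb z hz).2.2)).trans
        (hb z hz).1.le
    have h3 : Tendsto (fun p : ℝ × ℝ => C * ‖p.2 - x‖) (𝓝 (t, x)) (𝓝 0) := by
      have : Continuous fun p : ℝ × ℝ => C * ‖p.2 - x‖ := by fun_prop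
      simpa using this.tendsto (t, x)
    have h4 : Tendsto (fun p : ℝ × ℝ => G p.1 p.2 - G p.1 x) (𝓝 (t, x)) (𝓝 0) :=
      squeeze_zero_norm' (Filter.eventually_of_mem (Metric.ball_mem_nhds _ hδ) h2) h3
    have h5 : Tendsto (fun p : ℝ × ℝ => G p.1 x) (𝓝 (t, x)) (𝓝 (G t x)) :=
      ((hGt t ht x hx).continuousAt.tendsto).comp
        (continuous_fst.tendsto ((t, x) : ℝ × ℝ))
    have h6 := h4.add h5
    rw [ContinuousAt]
    simpa using h6
  -- The total derivative.
  have hder : ∀ p ∈ T ×ˢ X, HasFDerivAt (fun p : ℝ × ℝ => G p.1 p.2)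
      ((ContinuousLinearMap.fst ℝ ℝ ℝ).smulRight (G p.1 p.2 * Q p.1 p.2) +
        (ContinuousLinearMap.snd ℝ ℝ ℝ).smulRight (G p.1 p.2 * P p.1 p.2)) p := by
    rintro ⟨t, x⟩ hp
    have hcP : ContinuousAt (fun p : ℝ × ℝ => G p.1 p.2 * P p.1 p.2) (t, x) :=
      (hcont _ hp).mul (hP.continuousOn.continuousAt (hO.mem_nhds hp))
    have hcQ : ContinuousAt (fun p : ℝ × ℝ => G p.1 p.2 * Q p.1 p.2) (t, x) :=
      (hcont _ hp).mul (hQ.continuousOn.continuousAt (hO.mem_nhds hp))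
    have h1 := hasStrictFDerivAt_uncurry_coprod (𝕜 := ℝ) (u := ((t, x) : ℝ × ℝ)) (f := G)
      (f₁ := fun t x => (ContinuousLinearMap.id ℝ ℝ).smulRight (G t x * Q t x))
      (f₂ := fun t x => (ContinuousLinearMap.id ℝ ℝ).smulRight (G t x * P t x))
      (Filter.eventually_of_mem (hO.mem_nhds hp) fun v hv => (hGt v.1 hv.1 v.2 hv.2).hasFDerivAt)
      (Filter.eventually_of_mem (hO.mem_nhds hp) fun v hv => (hGx v.1 hv.1 v.2 hv.2).hasFDerivAt)
      (((ContinuousLinearMap.smulRightL ℝ ℝ A (ContinuousLinearMap.id ℝ ℝ)).continuous.continuousAt).comp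
        hcQ)
      (((ContinuousLinearMap.smulRightL ℝ ℝ A (ContinuousLinearMap.id ℝ ℝ)).continuous.continuousAt).comp
        hcP)
    refine h1.hasFDerivAt.congr_fderiv ?_
    ext <;> simp [Function.HasUncurry.uncurry]
  -- The total derivative is a polynomial in `G`, `P`, `Q`, so each order of smoothness yields the
  -- next.
  refine contDiffOn_infty.2 fun k => ?_
  induction k with
  | zero =>
    rw [Nat.cast_zero, contDiffOn_zero]
    exact fun p hp => (hcont p hp).continuousWithinAt
  | succ k ih =>
    rw [Nat.cast_succ, contDiffOn_succ_iff_fderiv_of_isOpen hO]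
    refine ⟨fun p hp => (hder p hp).differentiableAt.differentiableWithinAt, fun h => ?_, ?_⟩
    · exact absurd h (by simp)
    · have hPk := hP.of_le (m := (k : WithTop ℕ∞)) (by exact_mod_cast le_top)
      have hQk := hQ.of_le (m := (k : WithTop ℕ∞)) (by exact_mod_cast le_top)
      refine ContDiffOn.congr ?_ fun p hp => (hder p hp).fderiv
      exact ((ContinuousLinearMap.smulRightL ℝ (ℝ × ℝ) A
          (ContinuousLinearMap.fst ℝ ℝ ℝ)).contDiff.comp_contDiffOn (ih.mul hQk)).add
        ((ContinuousLinearMap.smulRightL ℝ (ℝ × ℝ) A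
          (ContinuousLinearMap.snd ℝ ℝ ℝ)).contDiff.comp_contDiffOn (ih.mul hPk))

variable {A : Type*} [NormedRing A] [StarRing A] [CStarRing A] [NormedAlgebra ℝ A] [StarModule ℝ A]
  [IsDedekindFiniteMonoid A]

/-- If the unitary functions `G(t,·)` solve `G_x = GP` and `G_t = GQ` holds at one point `x₀`, it
holds everywhere, provided that the connection is flat: the function `G(t,·)(1 + hQ(t,·))` solves
the equation at `t + h` up to an error `o(h)`. -/
theorem hasDerivAt_left_of_flat {P Q G : ℝ → ℝ → A} {T X : Set ℝ} (hT : IsOpen T) (hX : IsOpen X)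
    (hX' : X.OrdConnected)
    (hP : ContDiffOn ℝ ∞ (fun p : ℝ × ℝ => P p.1 p.2) (T ×ˢ X))
    (hQ : ContDiffOn ℝ ∞ (fun p : ℝ × ℝ => Q p.1 p.2) (T ×ˢ X))
    (hPs : ∀ t ∈ T, ∀ x ∈ X, star (P t x) = -P t x)
    (hflat : ∀ t ∈ T, ∀ x ∈ X, deriv (fun s => P s x) t - deriv (Q t) x +
      (Q t x * P t x - P t x * Q t x) = 0)
    (hG : ∀ t ∈ T, ∀ x ∈ X, HasDerivAt (G t) (G t x * P t x) x ∧ G t x * star (G t x) = 1)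
    {t x₀ x : ℝ} (ht : t ∈ T) (hx₀ : x₀ ∈ X) (hx : x ∈ X)
    (hG₀ : HasDerivAt (fun s => G s x₀) (G t x₀ * Q t x₀) t) :
    HasDerivAt (fun s => G s x) (G t x * Q t x) t := by
  rw [hasDerivAt_iff_isLittleO, Asymptotics.isLittleO_iff] at hG₀ ⊢
  intro c hc
  have hI : uIcc x₀ x ⊆ X := hX'.uIcc_subset hx₀ hx
  have hcQ : ContinuousOn (Q t) (uIcc x₀ x) :=
    (hQ.continuousOn.comp (continuousOn_const.prodMk continuousOn_id)
      fun y hy => ⟨ht, hI hy⟩ : ContinuousOn (fun y => Q t y) _)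
  have hcP : ContinuousOn (fun y => deriv (fun s => P s y) t) (uIcc x₀ x) :=
    ((contDiffOn_deriv_left hT hX hP).continuousOn.comp
      (continuousOn_const.prodMk continuousOn_id) fun y hy => ⟨ht, hI hy⟩)
  obtain ⟨CQ, hCQ⟩ := isCompact_uIcc.exists_bound_of_continuousOn hcQ
  obtain ⟨CP, hCP⟩ := isCompact_uIcc.exists_bound_of_continuousOn hcP
  have hCQ0 : 0 ≤ CQ := (norm_nonneg _).trans (hCQ x₀ left_mem_uIcc)
  have hCP0 : 0 ≤ CP := (norm_nonneg _).trans (hCP x₀ left_mem_uIcc)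
  -- The derivative of `H (G s)*` is bounded by `2ε|h|` below, and integrating it from `x₀` to `x`
  -- must cost at most `(c/2)|h|`.
  set ε : ℝ := c / (4 * (|x - x₀| + 1)) with hεdef
  have hℓ : 0 < |x - x₀| + 1 := by positivity
  have hε : 0 < ε := by positivity
  have hsmall : ∀ᶠ s in 𝓝 t, |s - t| * (CQ * (ε + CP)) < ε := by
    have h1 : Tendsto (fun s => |s - t| * (CQ * (ε + CP))) (𝓝 t) (𝓝 0) := by
      have : Continuous fun s => |s - t| * (CQ * (ε + CP)) := by fun_prop
      simpa using this.tendsto t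
    exact h1.eventually (gt_mem_nhds hε)
  filter_upwards [hG₀ (half_pos hc), hsmall, hT.mem_nhds ht,
    eventually_forall_norm_sub_le hT hX hP ht isCompact_uIcc hI hε] with s h0 hs hsT hR
  rw [Real.norm_eq_abs] at h0 ⊢
  set h := s - t with hh
  have hGs : ∀ y ∈ X, ‖G s y‖ ≤ 1 := fun y hy => norm_le_one_of_mul_star_eq_one (hG s hsT y hy).2
  have hGt : ∀ y ∈ X, ‖G t y‖ ≤ 1 := fun y hy => norm_le_one_of_mul_star_eq_one (hG t ht y hy).2
  have hGs' : ∀ y ∈ X, ‖star (G s y)‖ ≤ 1 := fun y hy => by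
    refine norm_le_one_of_mul_star_eq_one ?_
    rw [star_star]; exact mul_eq_one_comm.1 (hG s hsT y hy).2
  set H : ℝ → A := fun y => G t y + h • (G t y * Q t y) with hHdef
  -- By flatness, the derivative of `H (G s)*` is `o(h)`: the terms linear in `h` cancel up to the
  -- remainder `R` of the expansion of `P` in `t`.
  have hE : ∀ y ∈ uIcc x₀ x, ∃ E', HasDerivWithinAt (fun y => H y * star (G s y)) E' (uIcc x₀ x) y ∧
      ‖E'‖ ≤ 2 * ε * |h| := by
    intro y hy
    have hyX := hI hy
    have hQy : HasDerivAt (Q t) (deriv (Q t) y) y :=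
      ((hasDerivAt_right_of_differentiableAt
        (differentiableAt_of_contDiffOn_prod hT hX hQ ht hyX)).differentiableAt).hasDerivAt
    have hH : HasDerivAt H _ y :=
      (hG t ht y hyX).1.add (((hG t ht y hyX).1.mul hQy).const_smul h)
    refine ⟨_, (hH.mul (hG s hsT y hyX).1.star).hasDerivWithinAt, ?_⟩
    set R := P s y - P t y - h • deriv (fun s => P s y) t with hRdef
    have hPs' : P s y = R + P t y + h • deriv (fun s => P s y) t := by rw [hRdef]; abel
    have hfl : deriv (Q t) y = deriv (fun s => P s y) t + (Q t y * P t y - P t y * Q t y) := by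
      have h1 := hflat t ht y hyX
      rw [← sub_eq_zero, ← neg_eq_zero, ← h1]; abel
    have hRn : ‖R‖ ≤ ε * |h| := hR y hy
    have hkey : (G t y * P t y + h • (G t y * P t y * Q t y + G t y * deriv (Q t) y)) *
        star (G s y) + H y * star (G s y * P s y) =
        -(G t y * (R + h • (Q t y * (R + h • deriv (fun s => P s y) t)))) * star (G s y) := by
      rw [star_mul, hPs s hsT y hyX, hHdef, hfl]
      rw [hPs']
      simp only [smul_add, mul_add, add_mul, neg_mul, mul_neg, mul_assoc, mul_sub,
        smul_mul_assoc, mul_smul_comm, smul_sub, sub_mul, smul_smul, neg_add]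
      abel
    rw [hkey]
    calc ‖-(G t y * (R + h • (Q t y * (R + h • deriv (fun s => P s y) t)))) * star (G s y)‖
        ≤ ‖-(G t y * (R + h • (Q t y * (R + h • deriv (fun s => P s y) t))))‖ :=
          norm_mul_le_of_norm_le_one_right (hGs' y hyX)
      _ ≤ ‖R + h • (Q t y * (R + h • deriv (fun s => P s y) t))‖ := by
          rw [norm_neg]; exact norm_mul_le_of_norm_le_one_left (hGt y hyX)
      _ ≤ ‖R‖ + |h| * (‖Q t y‖ * (‖R‖ + |h| * ‖deriv (fun s => P s y) t‖)) := by
          refine (norm_add_le _ _).trans (add_le_add le_rfl ?_)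
          rw [norm_smul, Real.norm_eq_abs]
          refine mul_le_mul_of_nonneg_left ((norm_mul_le _ _).trans
            (mul_le_mul_of_nonneg_left ((norm_add_le _ _).trans ?_) (norm_nonneg _)))
            (abs_nonneg _)
          rw [norm_smul, Real.norm_eq_abs]
      _ ≤ ε * |h| + |h| * (CQ * (ε * |h| + |h| * CP)) := by
          gcongr
          · exact hCQ y hy
          · exact hCP y hy
      _ = |h| * (ε + |h| * (CQ * (ε + CP))) := by ring
      _ ≤ |h| * (ε + ε) := by gcongr
      _ = 2 * ε * |h| := by ring
  choose! E' hE' hE'n using hE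
  have h1 := (convex_uIcc x₀ x).norm_image_sub_le_of_norm_hasDerivWithin_le hE' hE'n
    left_mem_uIcc right_mem_uIcc
  rw [Real.norm_eq_abs] at h1
  have h2 : ‖H x₀ * star (G s x₀) - 1‖ ≤ c / 2 * |h| := by
    have h3 : H x₀ * star (G s x₀) - 1 =
        -(G s x₀ - G t x₀ - h • (G t x₀ * Q t x₀)) * star (G s x₀) := by
      rw [hHdef, ← (hG s hsT x₀ hx₀).2]
      simp only [neg_sub, sub_mul, add_mul]
      abel
    rw [h3]
    refine (norm_mul_le_of_norm_le_one_right (hGs' x₀ hx₀)).trans ?_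
    rw [norm_neg]; exact h0
  have h4 : G s x - G t x - h • (G t x * Q t x) = (1 - H x * star (G s x)) * G s x := by
    rw [sub_mul, one_mul, mul_assoc, mul_eq_one_comm.1 (hG s hsT x hx).2, mul_one]
    exact sub_sub _ _ _
  rw [h4]
  refine (norm_mul_le_of_norm_le_one_right (hGs x hx)).trans ?_
  have h5 : (1 : A) - H x * star (G s x) =
      -((H x * star (G s x) - H x₀ * star (G s x₀)) + (H x₀ * star (G s x₀) - 1)) := by abel
  have h6 : 2 * ε * |x - x₀| ≤ c / 2 := by
    have : ε * (4 * (|x - x₀| + 1)) = c := by rw [hεdef]; field_simp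
    nlinarith [hε, abs_nonneg (x - x₀)]
  calc ‖(1 : A) - H x * star (G s x)‖ ≤ 2 * ε * |h| * |x - x₀| + c / 2 * |h| := by
        rw [h5, norm_neg]; exact (norm_add_le _ _).trans (add_le_add h1 h2)
    _ ≤ c * |h| := by nlinarith [mul_le_mul_of_nonneg_right h6 (abs_nonneg h)]

/-- A flat skew connection on a product of intervals has a smooth unitary parallel section. -/
theorem exists_unitary_of_flat [CompleteSpace A] {P Q : ℝ → ℝ → A} {T X : Set ℝ} (hT : IsOpen T)
    (hT' : T.OrdConnected) (hX : IsOpen X) (hX' : X.OrdConnected)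
    (hP : ContDiffOn ℝ ∞ (fun p : ℝ × ℝ => P p.1 p.2) (T ×ˢ X))
    (hQ : ContDiffOn ℝ ∞ (fun p : ℝ × ℝ => Q p.1 p.2) (T ×ˢ X))
    (hPs : ∀ t ∈ T, ∀ x ∈ X, star (P t x) = -P t x)
    (hQs : ∀ t ∈ T, ∀ x ∈ X, star (Q t x) = -Q t x)
    (hflat : ∀ t ∈ T, ∀ x ∈ X, deriv (fun s => P s x) t - deriv (Q t) x +
      (Q t x * P t x - P t x * Q t x) = 0) {t₀ x₀ : ℝ} (ht₀ : t₀ ∈ T) (hx₀ : x₀ ∈ X) :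
    ∃ G : ℝ → ℝ → A, G t₀ x₀ = 1 ∧ ContDiffOn ℝ ∞ (fun p : ℝ × ℝ => G p.1 p.2) (T ×ˢ X) ∧
      ∀ t ∈ T, ∀ x ∈ X, HasDerivAt (G t) (G t x * P t x) x ∧
        HasDerivAt (fun s => G s x) (G t x * Q t x) t ∧ G t x * star (G t x) = 1 := by
  have hQc : ContinuousOn (fun t => Q t x₀) T :=
    hQ.continuousOn.comp (continuousOn_id.prodMk continuousOn_const) fun t ht => ⟨ht, hx₀⟩
  -- Solve the equation in `t` along `x = x₀`, then the equation in `x` for each `t`.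
  obtain ⟨k, hk0, hk⟩ := exists_unitary_solution hT hT' hQc (fun t ht => hQs t ht x₀ hx₀) ht₀
    (y₀ := (1 : A)) (by simp)
  have hsol : ∀ t ∈ T, ∃ y : ℝ → A, y x₀ = k t ∧
      ∀ x ∈ X, HasDerivAt y (y x * P t x) x ∧ y x * star (y x) = 1 := fun t ht =>
    exists_unitary_solution hX hX'
      (hP.continuousOn.comp (continuousOn_const.prodMk continuousOn_id) fun x hx => ⟨ht, hx⟩)
      (hPs t ht) hx₀ (hk t ht).2
  choose! G hG0 hG using hsol
  have hGt : ∀ t ∈ T, ∀ x ∈ X, HasDerivAt (fun s => G s x) (G t x * Q t x) t := by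
    intro t ht x hx
    refine hasDerivAt_left_of_flat hT hX hX' hP hQ hPs hflat hG ht hx₀ hx ?_
    rw [hG0 t ht]
    exact (hk t ht).1.congr_of_eventuallyEq (Filter.eventually_of_mem (hT.mem_nhds ht) hG0)
  refine ⟨G, by rw [hG0 t₀ ht₀, hk0], contDiffOn_of_hasDerivAt_mul hT hX hP hQ
    (fun t ht x hx => norm_le_one_of_mul_star_eq_one (hG t ht x hx).2)
    (fun t ht x hx => (hG t ht x hx).1) hGt, fun t ht x hx =>
    ⟨(hG t ht x hx).1, hGt t ht x hx, (hG t ht x hx).2⟩⟩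

end Flat

/-! ### Flat connections with values in skew matrices -/

section MatrixFlat

open scoped Matrix.Norms.L2Operator

variable {ι : Type*} [Fintype ι] [DecidableEq ι]

/-- The entries of a matrix, as a continuous linear equivalence for the operator norm. -/
noncomputable def entriesL (ι : Type*) [Fintype ι] [DecidableEq ι] :
    Matrix ι ι ℝ ≃L[ℝ] (ι → ι → ℝ) :=
  (Matrix.ofLinearEquiv ℝ).symm.toContinuousLinearEquiv

theorem mHasDeriv_iff_hasDerivAt {F : ℝ → Matrix ι ι ℝ} {F' : Matrix ι ι ℝ} {x : ℝ} :
    MHasDeriv F F' x ↔ HasDerivAt F F' x := by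
  have h : HasDerivAt (fun y => entriesL ι (F y)) (entriesL ι F') x ↔ MHasDeriv F F' x := by
    simp only [hasDerivAt_pi]; rfl
  rw [← h]
  refine ⟨fun h1 => ?_, fun h1 => (entriesL ι).hasFDerivAt.comp_hasDerivAt x h1⟩
  have h2 := (entriesL ι).symm.hasFDerivAt.comp_hasDerivAt x h1
  simpa [Function.comp_def] using h2

theorem mSmooth_iff_contDiffOn {P : Type*} [NormedAddCommGroup P] [NormedSpace ℝ P]
    {F : P → Matrix ι ι ℝ} {s : Set P} : MSmooth F s ↔ ContDiffOn ℝ ∞ F s := by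
  rw [← (entriesL ι).comp_contDiffOn_iff]
  simp only [contDiffOn_pi]; rfl

/-- A flat connection with values in skew matrices has a smooth orthogonal parallel section. -/
theorem exists_orthogonal_of_flat {P Q : ℝ → ℝ → Matrix ι ι ℝ} {T X : Set ℝ} (hT : IsOpen T)
    (hT' : T.OrdConnected) (hX : IsOpen X) (hX' : X.OrdConnected)
    (hP : SmoothOn₂ P T X) (hQ : SmoothOn₂ Q T X)
    (hPs : ∀ t ∈ T, ∀ x ∈ X, (P t x)ᵀ = -P t x) (hQs : ∀ t ∈ T, ∀ x ∈ X, (Q t x)ᵀ = -Q t x)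
    (hflat : ∀ t ∈ T, ∀ x ∈ X, mderiv (fun s => P s x) t - mderiv (Q t) x +
      ⁅Q t x, P t x⁆ = 0) {t₀ x₀ : ℝ} (ht₀ : t₀ ∈ T) (hx₀ : x₀ ∈ X) :
    ∃ G : ℝ → ℝ → Matrix ι ι ℝ, G t₀ x₀ = 1 ∧ SmoothOn₂ G T X ∧
      ∀ t ∈ T, ∀ x ∈ X, MHasDeriv (G t) (G t x * P t x) x ∧
        MHasDeriv (fun s => G s x) (G t x * Q t x) t ∧ G t x * (G t x)ᵀ = 1 := by
  have hstar : ∀ Y : Matrix ι ι ℝ, star Y = Yᵀ := fun Y => by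
    rw [Matrix.star_eq_conjTranspose, Matrix.conjTranspose_eq_transpose_of_trivial]
  obtain ⟨G, hG0, hG, hG1⟩ := exists_unitary_of_flat hT hT' hX hX'
    (mSmooth_iff_contDiffOn.1 hP) (mSmooth_iff_contDiffOn.1 hQ)
    (fun t ht x hx => (hstar _).trans (hPs t ht x hx))
    (fun t ht x hx => (hstar _).trans (hQs t ht x hx)) (fun t ht x hx => by
      rw [(mHasDeriv_iff_hasDerivAt.1 ((hP.left hx).mHasDeriv hT ht)).deriv,
        (mHasDeriv_iff_hasDerivAt.1 ((hQ.right ht).mHasDeriv hX hx)).deriv]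
      exact hflat t ht x hx) ht₀ hx₀
  refine ⟨G, hG0, mSmooth_iff_contDiffOn.2 hG, fun t ht x hx => ?_⟩
  obtain ⟨h1, h2, h3⟩ := hG1 t ht x hx
  exact ⟨mHasDeriv_iff_hasDerivAt.2 h1, mHasDeriv_iff_hasDerivAt.2 h2, by rw [← hstar]; exact h3⟩

end MatrixFlat

/-- Orthogonal matrices that depend continuously on a parameter in a preconnected set are special
orthogonal if one of them is. -/
theorem det_eq_one_of_isPreconnected {ι P : Type*} [Fintype ι] [DecidableEq ι] [TopologicalSpace P]
    {s : Set P} (hs : IsPreconnected s) {G : P → Matrix ι ι ℝ}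
    (hG : ∀ i j, ContinuousOn (fun p => G p i j) s) (hG1 : ∀ p ∈ s, G p * (G p)ᵀ = 1) {p₀ : P}
    (hp₀ : p₀ ∈ s) (h0 : G p₀ = 1) {p : P} (hp : p ∈ s) : (G p).det = 1 := by
  have hsq : ∀ p ∈ s, (G p).det ^ 2 = 1 := by
    intro p hp
    have h1 := congrArg Matrix.det (hG1 p hp)
    rw [Matrix.det_mul, Matrix.det_transpose, Matrix.det_one] at h1
    rw [sq, h1]
  have hc : ContinuousOn (fun p => (G p).det) s := by
    have h1 : ContinuousOn G s := continuousOn_pi.2 fun i => continuousOn_pi.2 fun j => hG i j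
    exact (continuous_id.matrix_det).comp_continuousOn h1
  by_contra hne
  have hneg : (G p).det = -1 := by
    have h1 := hsq p hp
    have h2 : ((G p).det - 1) * ((G p).det + 1) = 0 := by linear_combination h1
    rcases mul_eq_zero.1 h2 with h3 | h3
    · exact absurd (sub_eq_zero.1 h3) hne
    · linarith
  obtain ⟨q, hq, hq0⟩ : (0 : ℝ) ∈ (fun p => (G p).det) '' s := by
    refine hs.intermediate_value hp hp₀ hc ⟨?_, ?_⟩
    · simp only [hneg]; norm_num
    · simp only [h0, Matrix.det_one]; norm_num
  have h3 := hsq q hq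
  simp only at hq0
  rw [hq0] at h3; norm_num at h3

/-- A flat `so(2n)`-valued connection on a product of intervals is the Maurer-Cartan form of a
smooth family of frames. -/
theorem exists_frame_of_flat {P Q : ℝ → ℝ → Mat n} {T X : Set ℝ} (hT : IsOpen T)
    (hT' : T.OrdConnected) (hX : IsOpen X) (hX' : X.OrdConnected)
    (hP : SmoothOn₂ P T X) (hQ : SmoothOn₂ Q T X)
    (hPs : ∀ t ∈ T, ∀ x ∈ X, (P t x)ᵀ = -P t x) (hQs : ∀ t ∈ T, ∀ x ∈ X, (Q t x)ᵀ = -Q t x)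
    (hflat : ∀ t ∈ T, ∀ x ∈ X, mderiv (fun s => P s x) t - mderiv (Q t) x +
      ⁅Q t x, P t x⁆ = 0) {t₀ x₀ : ℝ} (ht₀ : t₀ ∈ T) (hx₀ : x₀ ∈ X) :
    ∃ g : ℝ → ℝ → SO n, g t₀ x₀ = 1 ∧ SmoothOn₂ (fun t x => (g t x : Mat n)) T X ∧
      ∀ t ∈ T, ∀ x ∈ X, maurerCartan (g t) x = P t x ∧
        maurerCartan (fun s => g s x) t = Q t x := by
  obtain ⟨G, hG0, hG, hG1⟩ := exists_orthogonal_of_flat hT hT' hX hX' hP hQ hPs hQs hflat ht₀ hx₀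
  have hmem : ∀ t ∈ T, ∀ x ∈ X, G t x ∈ Matrix.specialOrthogonalGroup (Idx n ⊕ Idx n) ℝ := by
    intro t ht x hx
    refine Matrix.mem_specialOrthogonalGroup_iff.2
      ⟨(Matrix.mem_orthogonalGroup_iff (Idx n ⊕ Idx n) ℝ).2 (hG1 t ht x hx).2.2, ?_⟩
    exact det_eq_one_of_isPreconnected (hT'.isPreconnected.prod hX'.isPreconnected)
      (G := fun p : ℝ × ℝ => G p.1 p.2) (fun i j => (hG i j).continuousOn)
      (fun p hp => (hG1 p.1 hp.1 p.2 hp.2).2.2) (p₀ := (t₀, x₀)) ⟨ht₀, hx₀⟩ hG0 (p := (t, x))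
      ⟨ht, hx⟩
  classical
  let g : ℝ → ℝ → SO n := fun t x => if h : t ∈ T ∧ x ∈ X then ⟨G t x, hmem t h.1 x h.2⟩ else 1
  have hg : ∀ t ∈ T, ∀ x ∈ X, (g t x : Mat n) = G t x := by
    intro t ht x hx
    simp only [g, dif_pos (And.intro ht hx)]
  refine ⟨g, Subtype.ext ((hg t₀ ht₀ x₀ hx₀).trans hG0),
    MSmooth.congr (F := fun p : ℝ × ℝ => G p.1 p.2) hG
    (fun p hp => hg p.1 hp.1 p.2 hp.2), fun t ht x hx => ⟨maurerCartan_eq ?_, maurerCartan_eq ?_⟩⟩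
  · rw [hg t ht x hx]
    exact (hG1 t ht x hx).1.congr_of_eventuallyEq
      (Filter.eventually_of_mem (hX.mem_nhds hx) fun y hy => hg t ht y hy)
  · rw [hg t ht x hx]
    exact (hG1 t ht x hx).2.1.congr_of_eventuallyEq
      (Filter.eventually_of_mem (hT.mem_nhds ht) fun s hs => hg s hs x hx)

/-! ### The zero curvature equation and the NLS system -/

theorem MHasDeriv.uBlock {r : ℝ → ℝ} {V : ℝ → Matrix (Fin (n - 2)) (Fin 2) ℂ} {r' : ℝ}
    {V' : Matrix (Fin (n - 2)) (Fin 2) ℂ} {x : ℝ} (hr : HasDerivAt r r' x)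
    (hV : MHasDeriv V V' x) :
    MHasDeriv (fun y => uBlock (r y) (V y)) (SU2CurveFlow.uBlock r' V') x := by
  have h1 : MHasDeriv (fun y => (-2 * Complex.I * r y) • (1 : Matrix (Fin 2) (Fin 2) ℂ))
      ((-2 * Complex.I * r') • 1) x :=
    (MHasDeriv.smul (hr.ofReal_comp.const_mul (-2 * Complex.I)) (MHasDeriv.const 1)).congr_deriv
      (by simp)
  have h2 : MHasDeriv (fun y => eps * (V y)ᵀ) (eps * V'ᵀ) x :=
    ((MHasDeriv.const eps).mul hV.transpose).congr_deriv (by simp)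
  have h3 : MHasDeriv (fun y => SU2CurveFlow.cj (V y) * eps) (SU2CurveFlow.cj V' * eps) x :=
    (hV.cj.mul (MHasDeriv.const eps)).congr_deriv (by simp)
  exact h1.fromBlocks h2 h3 (MHasDeriv.const 0)

theorem MHasDeriv.wBlock {K : ℝ → Matrix (Fin 2) (Fin 2) ℂ}
    {Z : ℝ → Matrix (Fin (n - 2)) (Fin 2) ℂ} {F : ℝ → Matrix (Fin (n - 2)) (Fin (n - 2)) ℂ}
    {K' Z' F'} {x : ℝ} (hK : MHasDeriv K K' x) (hZ : MHasDeriv Z Z' x) (hF : MHasDeriv F F' x) :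
    MHasDeriv (fun y => wBlock (K y) (Z y) (F y)) (SU2CurveFlow.wBlock K' Z' F') x := by
  have h2 : MHasDeriv (fun y => eps * (Z y)ᵀ) (eps * Z'ᵀ) x :=
    ((MHasDeriv.const eps).mul hZ.transpose).congr_deriv (by simp)
  have h3 : MHasDeriv (fun y => SU2CurveFlow.cj (Z y) * eps) (SU2CurveFlow.cj Z' * eps) x :=
    (hZ.cj.mul (MHasDeriv.const eps)).congr_deriv (by simp)
  exact hK.fromBlocks h2 h3 hF

theorem MHasDeriv.mBlock_zero {B : ℝ → Matrix (Fin (n - 2)) (Fin 2) ℂ} {B'} {x : ℝ}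
    (hB : MHasDeriv B B' x) :
    MHasDeriv (fun y => mBlock 0 (B y) 0) (SU2CurveFlow.mBlock 0 B' 0) x :=
  (MHasDeriv.const _).fromBlocks hB.transpose hB.neg (MHasDeriv.const _) |>.congr_deriv
    (by simp [SU2CurveFlow.mBlock])

theorem eps_mul_eq_zero_iff {m : Type*} {A : Matrix (Fin 2) m ℂ} : eps * A = 0 ↔ A = 0 := by
  refine ⟨fun h => ?_, fun h => by rw [h, Matrix.mul_zero]⟩
  rw [← neg_eq_zero, ← eps_mul_eps_mul, h, Matrix.mul_zero]

/-- The `𝔥`-component of the curvature, in blocks. -/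
theorem curvature_h_eq (hn : 3 ≤ n) {K : Matrix (Fin 2) (Fin 2) ℂ} (hK : Kᴴ = -K)
    {Z V B : Matrix (Fin (n - 2)) (Fin 2) ℂ} {F : Matrix (Fin (n - 2)) (Fin (n - 2)) ℂ}
    (hF : Fᴴ = -F) (r rt : ℝ) (Vt : Matrix (Fin (n - 2)) (Fin 2) ℂ) (Kx Zx Fx)
    {X : Matrix (Fin 2) (Fin 2) ℂ} {Y : Matrix (Fin (n - 2)) (Fin 2) ℂ}
    (hX : X = Vᴴ * Z - Zᴴ * V)
    (hY : Y = Vt - Zx + (K.trace • V - V * K + (2 * Complex.I * r) • Z - Fᵀ * V) -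
      ((1 / χ n : ℝ) : ℂ) • B) :
    uBlock rt Vt - wBlock Kx Zx Fx + (wBlock K Z F * uBlock r V - uBlock r V * wBlock K Z F +
      (cj (mBlock 0 ((1 / √(χ n)) • B) 0) * ((1 / √(χ n)) • eBlock n) -
        cj ((1 / √(χ n)) • eBlock n) * mBlock 0 ((1 / √(χ n)) • B) 0)) =
    Matrix.fromBlocks ((-2 * Complex.I * rt) • 1 - Kx + (X - X.trace • 1)) (eps * Yᵀ) (cj Y * eps)
      (cj V * Zᵀ - cj Z * Vᵀ - Fx) := by
  have h1 : mBlock 0 ((1 / √(χ n)) • B) 0 = (1 / √(χ n)) • mBlock 0 B 0 := by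
    rw [mBlock_smul]; simp
  have h2 : ∀ A : Matrix (Fin (n - 2)) (Fin 2) ℂ, ((1 / χ n : ℝ) : ℂ) • A = (1 / χ n : ℝ) • A := by
    intro A; ext i j; simp
  rw [h1, cj_smul_real, cj_smul_real, smul_mul_smul_comm, smul_mul_smul_comm, ← smul_sub,
    sq_one_div_sqrt hn, cj_mBlock_mul_eBlock_sub, wBlock_mul_uBlock_sub hK Z V hF r hX rfl, hY, h2,
    uBlock, wBlock, sub_eq_add_neg, smul_neg, Matrix.fromBlocks_smul, Matrix.fromBlocks_neg,
    Matrix.fromBlocks_neg, Matrix.fromBlocks_add, Matrix.fromBlocks_add, Matrix.fromBlocks_add]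
  congr 1
  · simp [sub_eq_add_neg]
  · simp only [Matrix.transpose_add, Matrix.transpose_sub, Matrix.transpose_smul, Matrix.mul_add,
      Matrix.mul_sub, Matrix.mul_smul]
    module
  · simp only [cj_add, cj_sub, cj_smul_real, Matrix.add_mul, Matrix.sub_mul, Matrix.smul_mul]
    module
  · simp only [smul_zero, neg_zero, add_zero, zero_add]
    abel

/-- The `𝔪`-component of the zero curvature equation holds for the matrices of the curve flow. -/
theorem curvature_m_eq_zero {J K : Matrix (Fin 2) (Fin 2) ℂ} (hJ0 : J.trace = 0) (hK : Kᴴ = -K)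
    {V Vx : Matrix (Fin (n - 2)) (Fin 2) ℂ} (hKtr : K.trace = (Vᴴ * (V * J)).trace) (r s : ℝ)
    (F : Matrix (Fin (n - 2)) (Fin (n - 2)) ℂ) {Z : Matrix (Fin (n - 2)) (Fin 2) ℂ}
    (hZ : Z = Vx * J + (2 * Complex.I * r) • (V * J)) :
    0 - mBlock 0 (s • (Vx * J)) 0 + (cj (wBlock K Z F) * (s • eBlock n) -
      (s • eBlock n) * wBlock K Z F - (cj (uBlock r V) * mBlock 0 (s • (V * J)) 0 -
        mBlock 0 (s • (V * J)) 0 * uBlock r V)) = 0 := by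
  rw [mul_smul_comm, smul_mul_assoc, ← smul_sub, wBlock, cj_mul_eBlock_sub hK,
    cj_uBlock_mul_mBlock_sub, mBlock, Matrix.fromBlocks_smul, zero_sub, sub_eq_add_neg,
    Matrix.fromBlocks_neg, Matrix.fromBlocks_neg, Matrix.fromBlocks_add, Matrix.fromBlocks_add,
    ← Matrix.fromBlocks_zero, Matrix.fromBlocks_inj]
  refine ⟨?_, ?_, ?_, ?_⟩
  · rw [hKtr, Matrix.mul_smul, Matrix.trace_smul]
    simp only [zero_smul, mul_zero, zero_sub, Complex.real_smul]
    module
  · rw [eps_mul_eps_mul, hZ]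
    simp only [Matrix.transpose_smul, Matrix.transpose_add, Matrix.mul_zero]
    module
  · rw [cj_mul, cj_cj, cj_eps, mul_eps_mul_eps, hZ]
    simp only [Matrix.zero_mul]
    module
  · rw [mul_eps_mul_transpose_add hJ0]; simp

/-- The derivative of `V J Vᴴ`, up to a transpose. -/
theorem cj_mul_transpose_sub {J : Matrix (Fin 2) (Fin 2) ℂ} (hJ : Jᴴ = -J) (r : ℝ)
    {m : Type*} {V Vx Z : Matrix m (Fin 2) ℂ} (hZ : Z = Vx * J + (2 * Complex.I * r) • (V * J)) :
    cj V * Zᵀ - cj Z * Vᵀ = (Vx * J * Vᴴ + V * J * Vxᴴ)ᵀ := by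
  have hcJ : cj J = -Jᵀ := by rw [← cj_conjTranspose, hJ, cj_neg, neg_neg]
  rw [hZ]
  simp only [Matrix.transpose_add, Matrix.transpose_smul, Matrix.transpose_mul, cj_add, cj_smul,
    cj_mul, hcJ, conjTranspose_transpose', Matrix.mul_add, Matrix.add_mul, Matrix.mul_smul,
    Matrix.smul_mul, Matrix.mul_neg, Matrix.neg_mul, Matrix.mul_assoc, map_mul, Complex.conj_I,
    Complex.conj_ofReal, Complex.conj_ofNat]
  module

/-- The `u(n-2)`-component of the curve flow is skew-hermitian. -/
theorem transpose_mul_mul_conjTranspose_skew {m : Type*} {J : Matrix (Fin 2) (Fin 2) ℂ}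
    (hJ : Jᴴ = -J) (V : Matrix m (Fin 2) ℂ) : ((V * J * Vᴴ)ᵀ)ᴴ = -(V * J * Vᴴ)ᵀ := by
  rw [transpose_conjTranspose', ← conjTranspose_transpose', ← Matrix.transpose_neg]
  congr 1
  rw [Matrix.conjTranspose_mul, Matrix.conjTranspose_mul, Matrix.conjTranspose_conjTranspose,
    hJ, Matrix.neg_mul, Matrix.mul_neg, Matrix.mul_assoc]

theorem half_anticommutator_skew {m : Type*} [Fintype m] {J : Matrix (Fin 2) (Fin 2) ℂ}
    (hJ : Jᴴ = -J) (V : Matrix m (Fin 2) ℂ) :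
    ((1 / 2 : ℂ) • (J * (Vᴴ * V) + Vᴴ * V * J))ᴴ =
      -((1 / 2 : ℂ) • (J * (Vᴴ * V) + Vᴴ * V * J)) := by
  have hL : (Vᴴ * V)ᴴ = Vᴴ * V := by
    rw [Matrix.conjTranspose_mul, Matrix.conjTranspose_conjTranspose]
  rw [Matrix.conjTranspose_smul, Matrix.conjTranspose_add, Matrix.conjTranspose_mul,
    Matrix.conjTranspose_mul (Vᴴ * V), hL, hJ]
  simp only [Matrix.mul_neg, Matrix.neg_mul, one_div, star_inv₀, star_ofNat]
  module

theorem trace_half_anticommutator {m : Type*} [Fintype m] (J : Matrix (Fin 2) (Fin 2) ℂ)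
    (V : Matrix m (Fin 2) ℂ) :
    ((1 / 2 : ℂ) • (J * (Vᴴ * V) + Vᴴ * V * J)).trace = (Vᴴ * (V * J)).trace := by
  rw [Matrix.trace_smul, Matrix.trace_add, Matrix.trace_mul_comm J, ← Matrix.mul_assoc,
    smul_eq_mul]
  ring

/-! ### The curvature equations of a curve flow -/

section FlowBlocks

variable {T X : Set ℝ} {γ : ℝ → ℝ → M n} {g : ℝ → ℝ → SO n} {r : ℝ → ℝ → ℝ}
  {V : ℝ → ℝ → Matrix (Fin (n - 2)) (Fin 2) ℂ}

/-- The Hasimoto variables of a flow with parallel frames exist and are smooth. -/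
theorem IsFlowFrame.exists_isHasimoto (hn : 3 ≤ n) (hT : IsOpen T) (hX : IsOpen X)
    (h : IsFlowFrame T X γ g) : ∃ (r : ℝ → ℝ → ℝ) (V : ℝ → ℝ → Matrix (Fin (n - 2)) (Fin 2) ℂ),
      ContDiffOn ℝ ∞ (fun p : ℝ × ℝ => r p.1 p.2) (T ×ˢ X) ∧ SmoothOn₂ V T X ∧
      IsHasimoto T X g r V := by
  set H : ℝ → ℝ → Matrix (Idx n) (Idx n) ℂ := fun t x => hPart (maurerCartan (g t) x) with hH
  have hHs : MSmooth (fun p : ℝ × ℝ => H p.1 p.2) (T ×ˢ X) :=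
    MSmooth.hPart (h.smooth.maurerCartan_right hT hX)
  -- The upper left block of `uBlock r V` is `-2ir`, and the upper right one is `ε Vᵀ`.
  refine ⟨fun t x => -(H t x (.inl 0) (.inl 0)).im / 2, fun t x => (-(eps * (H t x).toBlocks₁₂))ᵀ,
    ?_, ?_, (isHasimoto_iff hn).2 fun t ht x hx => ?_⟩
  · exact (Complex.imCLM.contDiff.comp_contDiffOn (hHs (.inl 0) (.inl 0))).neg.div_const 2
  · exact (((MSmooth.const eps).mul (hHs.submatrix Sum.inl Sum.inr)).neg.transpose :
      MSmooth (fun p : ℝ × ℝ => (-(eps * (H p.1 p.2).toBlocks₁₂))ᵀ) (T ×ˢ X))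
  · have h1 := (h.parallel t ht).perp x hx
    rw [mem_hPerp_iff hn, connection_eq] at h1
    obtain ⟨q, B, hq⟩ := h1
    have h2 : H t x = uBlock q B := hC_injective hq
    show H t x = _
    rw [h2, uBlock_inj]
    refine ⟨?_, ?_⟩
    · simp [uBlock]
    · simp [uBlock, eps_mul_eps_mul]

/-- For a curve flow, the `𝔪`-component of the zero curvature equation determines the
`𝔥_⊥`-component of `g⁻¹g_t`: the trace of the upper left block and the off-diagonal blocks. -/
theorem IsFlowFrame.exists_hPart_eq_wBlock (hn : 3 ≤ n) (hT : IsOpen T) (hX : IsOpen X)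
    (h : IsFlowFrame T X γ g) (hV : SmoothOn₂ V T X) (hrV : IsHasimoto T X g r V)
    {J : Matrix (Fin 2) (Fin 2) ℂ}
    (hflow : ∀ t ∈ T, ∀ x ∈ X, mPart (maurerCartan (fun s => g s x) t) =
      mBlock 0 ((1 / √(χ n)) • (V t x * J)) 0) {t x : ℝ} (ht : t ∈ T) (hx : x ∈ X)
    {w : Matrix (Idx n) (Idx n) ℂ} (hw : hPart (maurerCartan (fun s => g s x) t) = w) :
    (w.toBlocks₁₁)ᴴ = -w.toBlocks₁₁ ∧ (w.toBlocks₂₂)ᴴ = -w.toBlocks₂₂ ∧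
      w.toBlocks₁₁.trace = ((V t x)ᴴ * (V t x * J)).trace ∧
      w = wBlock w.toBlocks₁₁
        (mderiv (V t) x * J + (2 * Complex.I * r t x) • (V t x * J)) w.toBlocks₂₂ := by
  have hwb : w = Matrix.fromBlocks w.toBlocks₁₁ w.toBlocks₁₂ w.toBlocks₂₁ w.toBlocks₂₂ :=
    (Matrix.fromBlocks_toBlocks w).symm
  have hskew := hPart_conjTranspose_of_skew (h.maurerCartan_left_transpose hT ht hx)
  rw [hw, hwb, Matrix.fromBlocks_conjTranspose, Matrix.fromBlocks_neg, Matrix.fromBlocks_inj]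
    at hskew
  obtain ⟨hK, h21, -, hF⟩ := hskew
  set s := 1 / √(χ n) with hs
  have hs0 : s ≠ 0 := (one_div_pos.2 (Real.sqrt_pos.2 (χ_pos hn))).ne'
  have hVx := (hV.right ht).mHasDeriv hX hx
  have hW' : MHasDeriv (fun y => mPart (maurerCartan (fun s => g s y) t))
      (mBlock 0 (s • (mderiv (V t) x * J)) 0) x := by
    have h1 : MHasDeriv (fun y => s • (V t y * J)) (s • (mderiv (V t) x * J)) x :=
      ((hVx.mul (MHasDeriv.const J)).const_smul s).congr_deriv (by simp)
    exact h1.mBlock_zero.congr_of_eventuallyEq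
      (Filter.eventually_of_mem (hX.mem_nhds hx) fun y hy => hflow t ht y hy)
  have h1 := hW'.unique (h.mderiv_mPart hn hT hX hrV ht hx (hw.trans hwb) (hflow t ht x hx))
  rw [mBlock, Matrix.fromBlocks_smul, sub_eq_add_neg, Matrix.fromBlocks_neg, Matrix.fromBlocks_add,
    Matrix.fromBlocks_inj, ← hs] at h1
  obtain ⟨e11, e12, -, -⟩ := h1
  have htr : w.toBlocks₁₁.trace = ((V t x)ᴴ * (V t x * J)).trace := by
    have h2 := congrFun (congrFun e11 0) 1
    rw [Matrix.mul_smul, Matrix.trace_smul] at h2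
    simp [eps] at h2
    have h3 : (s : ℂ) ≠ 0 := by exact_mod_cast hs0
    refine mul_left_cancel₀ h3 ?_
    linear_combination h2
  have h12 : w.toBlocks₁₂ = eps * (mderiv (V t) x * J + (2 * Complex.I * r t x) • (V t x * J))ᵀ := by
    have h2 : s • (eps * w.toBlocks₁₂ +
        (mderiv (V t) x * J + (2 * Complex.I * r t x) • (V t x * J))ᵀ) = 0 := by
      rw [← sub_eq_zero] at e12
      rw [← e12]
      simp only [Matrix.transpose_smul, Matrix.transpose_add, Matrix.mul_zero, zero_smul]
      module
    rw [smul_eq_zero_iff_right hs0] at h2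
    have h3 := congrArg (eps * ·) (eq_neg_of_add_eq_zero_left h2)
    simpa only [eps_mul_eps_mul, Matrix.mul_neg, neg_inj] using h3
  refine ⟨hK, hF, htr, ?_⟩
  conv_lhs => rw [hwb]
  rw [wBlock, Matrix.fromBlocks_inj]
  refine ⟨rfl, h12, ?_, rfl⟩
  have h3 : (w.toBlocks₂₁)ᴴ = -w.toBlocks₁₂ := h21
  rw [← Matrix.conjTranspose_conjTranspose w.toBlocks₂₁, h3, h12]
  simp [Matrix.conjTranspose_mul, Complex.conj_ofNat]

/-- The `𝔥`-component of the zero curvature equation of a curve flow, in blocks. -/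
theorem IsFlowFrame.curvature_blocks (hn : 3 ≤ n) (hT : IsOpen T) (hX : IsOpen X)
    (h : IsFlowFrame T X γ g) (hr : ContDiffOn ℝ ∞ (fun p : ℝ × ℝ => r p.1 p.2) (T ×ˢ X))
    (hV : SmoothOn₂ V T X) (hrV : IsHasimoto T X g r V)
    {J : Matrix (Fin 2) (Fin 2) ℂ} (hJ : Jᴴ = -J)
    (hflow : ∀ t ∈ T, ∀ x ∈ X, mPart (maurerCartan (fun s => g s x) t) =
      mBlock 0 ((1 / √(χ n)) • (V t x * J)) 0)
    {w : ℝ → ℝ → Matrix (Idx n) (Idx n) ℂ}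
    (hw : w = fun t x => hPart (maurerCartan (fun s => g s x) t))
    {Z : ℝ → ℝ → Matrix (Fin (n - 2)) (Fin 2) ℂ}
    (hZ : Z = fun t x => mderiv (V t) x * J + (2 * Complex.I * r t x) • (V t x * J))
    {t x : ℝ} (ht : t ∈ T) (hx : x ∈ X) {Q : Matrix (Fin 2) (Fin 2) ℂ}
    (hQ : Q = (V t x)ᴴ * Z t x - (Z t x)ᴴ * V t x) :
    (-2 * Complex.I * (deriv (fun s => r s x) t : ℝ)) • 1 -
        mderiv (fun y => (w t y).toBlocks₁₁) x + (Q - Q.trace • 1) = 0 ∧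
      mderiv (fun s => V s x) t - mderiv (Z t) x +
        ((w t x).toBlocks₁₁.trace • V t x - V t x * (w t x).toBlocks₁₁ +
          (2 * Complex.I * r t x) • Z t x - ((w t x).toBlocks₂₂)ᵀ * V t x) -
        ((1 / χ n : ℝ) : ℂ) • (V t x * J) = 0 ∧
      MHasDeriv (fun y => (w t y).toBlocks₂₂)
        (mderiv (V t) x * J * (V t x)ᴴ + V t x * J * (mderiv (V t) x)ᴴ)ᵀ x := by
  have hws : MSmooth (w t) X := by
    rw [hw]; exact ((h.smooth.maurerCartan_left hT hX).right ht).hPart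
  have hKx := (hws.submatrix Sum.inl Sum.inl).mHasDeriv hX hx
  have hFx := (hws.submatrix Sum.inr Sum.inr).mHasDeriv hX hx
  have hrs : MSmooth (fun y => (2 * Complex.I * r t y) • (V t y * J)) X :=
    MSmooth.smul (contDiffOn_const.mul (Complex.ofRealCLM.contDiff.comp_contDiffOn
      (hr.comp (contDiffOn_const.prodMk contDiffOn_id) fun y hy => ⟨ht, hy⟩)))
      ((hV.right ht).mul (MSmooth.const J))
  have hZs : MSmooth (Z t) X := by
    rw [hZ]; exact (((hV.right ht).mderiv hX).mul (MSmooth.const J)).add hrs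
  have hZx := hZs.mHasDeriv hX hx
  have hblock : ∀ y ∈ X, ((w t y).toBlocks₁₁)ᴴ = -(w t y).toBlocks₁₁ ∧
      ((w t y).toBlocks₂₂)ᴴ = -(w t y).toBlocks₂₂ ∧
      w t y = wBlock (w t y).toBlocks₁₁ (Z t y) (w t y).toBlocks₂₂ := fun y hy => by
    obtain ⟨h1, h2, -, h3⟩ := h.exists_hPart_eq_wBlock hn hT hX hV hrV hflow ht hy (w := w t y)
      (by rw [hw])
    exact ⟨h1, h2, by rw [hZ]; exact h3⟩
  obtain ⟨hK, hF, hwx⟩ := hblock x hx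
  have hr' : HasDerivAt (fun s => r s x) (deriv (fun s => r s x) t) t :=
    (hasDerivAt_left_of_differentiableAt
      (differentiableAt_of_contDiffOn_prod hT hX hr ht hx)).differentiableAt.hasDerivAt
  have hU' : MHasDeriv (fun s => hPart (maurerCartan (g s) x))
      (uBlock (deriv (fun s => r s x) t) (mderiv (fun s => V s x) t)) t :=
    (MHasDeriv.uBlock hr' ((hV.left hx).mHasDeriv hT ht)).congr_of_eventuallyEq
      (Filter.eventually_of_mem (hT.mem_nhds ht) fun s hs => hrV.hPart_maurerCartan hn hs hx)
  have hw' : MHasDeriv (fun y => hPart (maurerCartan (fun s => g s y) t))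
      (wBlock (mderiv (fun y => (w t y).toBlocks₁₁) x) (mderiv (Z t) x)
        (mderiv (fun y => (w t y).toBlocks₂₂) x)) x :=
    (MHasDeriv.wBlock hKx hZx hFx).congr_of_eventuallyEq
      (Filter.eventually_of_mem (hX.mem_nhds hx) fun y hy =>
        (show hPart (maurerCartan (fun s => g s y) t) = w t y by rw [hw]).trans
          (hblock y hy).2.2)
  have h1 := zero_curvature_h hT hX h.smooth ht hx (hrV.hPart_maurerCartan hn ht hx)
    ((h.parallel t ht).mPart_maurerCartan hX hx)
    ((show hPart (maurerCartan (fun s => g s x) t) = w t x by rw [hw]).trans hwx)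
    (hflow t ht x hx) hU' hw'
  rw [curvature_h_eq hn hK hF _ _ _ _ _ _ hQ rfl, ← Matrix.fromBlocks_zero,
    Matrix.fromBlocks_inj, eps_mul_eq_zero_iff, Matrix.transpose_eq_zero] at h1
  obtain ⟨e1, e2, -, e4⟩ := h1
  refine ⟨e1, e2, hFx.congr_deriv ?_⟩
  rw [cj_mul_transpose_sub hJ (r t x) (congrFun (congrFun hZ t) x)] at e4
  exact (sub_eq_zero.1 e4).symm

theorem smul_one_add_eq_zero_iff {c : ℂ} {A : Matrix (Fin 2) (Fin 2) ℂ} (hA : A.trace = 0) :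
    c • (1 : Matrix (Fin 2) (Fin 2) ℂ) + A = 0 ↔ c = 0 ∧ A = 0 := by
  refine ⟨fun h => ?_, fun ⟨h1, h2⟩ => by rw [h1, h2, zero_smul, add_zero]⟩
  have h1 := congrArg Matrix.trace h
  rw [Matrix.trace_add, Matrix.trace_smul, hA, add_zero, Matrix.trace_one, Matrix.trace_zero] at h1
  have hc : c = 0 := by simpa using h1
  exact ⟨hc, by rwa [hc, zero_smul, zero_add] at h⟩

/-- The Hasimoto variables of a curve flow solve the NLS system if the `u(n-2)`-component of
`g⁻¹g_t` is the transpose of `V J Vᴴ`. -/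
theorem IsFlowFrame.isNLSSolution (hn : 3 ≤ n) (hT : IsOpen T) (hX : IsOpen X)
    (h : IsFlowFrame T X γ g) (hr : ContDiffOn ℝ ∞ (fun p : ℝ × ℝ => r p.1 p.2) (T ×ˢ X))
    (hV : SmoothOn₂ V T X) (hrV : IsHasimoto T X g r V)
    {J : Matrix (Fin 2) (Fin 2) ℂ} (hJ : Jᴴ = -J)
    (hflow : ∀ t ∈ T, ∀ x ∈ X, mPart (maurerCartan (fun s => g s x) t) =
      mBlock 0 ((1 / √(χ n)) • (V t x * J)) 0)
    (hF : ∀ t ∈ T, ∀ x ∈ X, (hPart (maurerCartan (fun s => g s x) t)).toBlocks₂₂ =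
      (V t x * J * (V t x)ᴴ)ᵀ) : IsNLSSolution J T X r V := by
  set w : ℝ → ℝ → Matrix (Idx n) (Idx n) ℂ := fun t x => hPart (maurerCartan (fun s => g s x) t)
    with hw
  have hws : MSmooth (fun p : ℝ × ℝ => w p.1 p.2) (T ×ˢ X) :=
    MSmooth.hPart (h.smooth.maurerCartan_left hT hX)
  have hV' : MSmooth (fun p : ℝ × ℝ => V p.1 p.2) (T ×ˢ X) := hV
  have hL : MSmooth (fun p : ℝ × ℝ => J * ((V p.1 p.2)ᴴ * V p.1 p.2) +
      ((V p.1 p.2)ᴴ * V p.1 p.2) * J) (T ×ˢ X) :=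
    ((MSmooth.const J).mul (hV'.conjTranspose.mul hV')).add
      ((hV'.conjTranspose.mul hV').mul (MSmooth.const J))
  -- The antiderivative is the upper left block without its local part `½{J, L}`, which makes it
  -- traceless and turns the derivative of the block into the integrand.
  refine ⟨hr, hV, fun t x => (w t x).toBlocks₁₁ - (1 / 2 : ℂ) •
    (J * ((V t x)ᴴ * V t x) + ((V t x)ᴴ * V t x) * J),
    ((hws.submatrix Sum.inl Sum.inl).sub (hL.const_smul (1 / 2 : ℂ)) : MSmooth _ _),
    fun t ht x hx => ?_⟩
  obtain ⟨hK, -, htr, -⟩ := h.exists_hPart_eq_wBlock hn hT hX hV hrV hflow ht hx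
    (w := w t x) rfl
  obtain ⟨e11, e12, -⟩ := h.curvature_blocks hn hT hX hr hV hrV hJ hflow hw rfl ht hx rfl
  have hVx := (hV.right ht).mHasDeriv hX hx
  have hVxx := (((hV.right ht).mderiv hX)).mHasDeriv hX hx
  have hLx : MHasDeriv (fun y => (V t y)ᴴ * V t y)
      ((mderiv (V t) x)ᴴ * V t x + (V t x)ᴴ * mderiv (V t) x) x := hVx.conjTranspose.mul hVx
  have hKx : MHasDeriv (fun y => (w t y).toBlocks₁₁) (mderiv (fun y => (w t y).toBlocks₁₁) x) x :=
    (SmoothOn₂.right (F := fun t x => (w t x).toBlocks₁₁)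
      (hws.submatrix Sum.inl Sum.inl) ht).mHasDeriv hX hx
  have hr' : HasDerivAt (r t) (deriv (r t) x) x :=
    (hasDerivAt_right_of_differentiableAt
      (differentiableAt_of_contDiffOn_prod hT hX hr ht hx)).differentiableAt.hasDerivAt
  set L := (V t x)ᴴ * V t x with hLdef
  set Lx := (mderiv (V t) x)ᴴ * V t x + (V t x)ᴴ * mderiv (V t) x with hLxdef
  have hΘx := (hKx.sub ((((MHasDeriv.const J).mul hLx).add
    (hLx.mul (MHasDeriv.const J))).const_smul (1 / 2 : ℂ))).mderiv
  simp only [Matrix.zero_mul, Matrix.mul_zero, zero_add, add_zero] at hΘx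
  have hΘ0 : ((w t x).toBlocks₁₁ - (1 / 2 : ℂ) • (J * L + L * J)).trace = 0 := by
    rw [Matrix.trace_sub, htr, trace_half_anticommutator, sub_self]
  have hcomm : ∀ A : Matrix (Fin 2) (Fin 2) ℂ, (⁅A, J⁆).trace = 0 := fun A => by
    rw [Ring.lie_def, Matrix.trace_sub, Matrix.trace_mul_comm, sub_self]
  have hKx' : mderiv (fun y => (w t y).toBlocks₁₁) x =
      mderiv (fun y => (w t y).toBlocks₁₁) x - (1 / 2 : ℂ) • (J * Lx + Lx * J) +
        (1 / 2 : ℂ) • (J * Lx + Lx * J) := by rw [sub_add_cancel]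
  rw [hKx', nls_block₁₁ hJ (r t x) _ rfl rfl rfl rfl rfl] at e11
  have hΘtr : (mderiv (fun y => (w t y).toBlocks₁₁) x -
      (1 / 2 : ℂ) • (J * Lx + Lx * J)).trace = 0 := by
    have h1 : HasDerivAt (fun _ : ℝ => (0 : ℂ)) _ x := (MHasDeriv.trace (hKx.sub
      ((((MHasDeriv.const J).mul hLx).add (hLx.mul (MHasDeriv.const J))).const_smul
        (1 / 2 : ℂ)))).congr_of_eventuallyEq
      (Filter.eventually_of_mem (hX.mem_nhds hx) fun y hy => by
        obtain ⟨-, -, htr, -⟩ := h.exists_hPart_eq_wBlock hn hT hX hV hrV hflow ht hy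
          (w := w t y) rfl
        simp only []
        rw [Matrix.trace_sub, htr, trace_half_anticommutator, sub_self])
    have h2 := h1.unique (hasDerivAt_const x (0 : ℂ))
    simpa only [Matrix.zero_mul, Matrix.mul_zero, zero_add, add_zero] using h2
  rw [smul_one_add_eq_zero_iff (by
    rw [Matrix.trace_sub, hΘtr, Matrix.trace_add, Matrix.trace_smul, Matrix.trace_smul, hcomm,
      hcomm]; simp)] at e11
  obtain ⟨f1, f2⟩ := e11
  refine ⟨?_, hΘ0, ?_, ?_, ?_⟩
  · show ((w t x).toBlocks₁₁ - (1 / 2 : ℂ) • (J * L + L * J))ᴴ =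
      -((w t x).toBlocks₁₁ - (1 / 2 : ℂ) • (J * L + L * J))
    rw [Matrix.conjTranspose_sub, hK, half_anticommutator_skew hJ]
    abel
  · exact hΘx.trans (sub_eq_zero.1 f2).symm
  · rw [hLx.mderiv]
    linear_combination (Complex.I / 2) * f1 + ((deriv (fun s => r s x) t : ℝ) : ℂ) * Complex.I_mul_I
  · have hZx := ((hVxx.mul (MHasDeriv.const J)).add (MHasDeriv.smul
      (hr'.ofReal_comp.const_mul (2 * Complex.I)) (hVx.mul (MHasDeriv.const J)))).mderiv
    simp only [Matrix.mul_zero, add_zero] at hZx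
    have hFV : ((w t x).toBlocks₂₂)ᵀ * V t x = V t x * J * L := by
      rw [hF t ht x hx, Matrix.transpose_transpose, hLdef, Matrix.mul_assoc]
    rw [nls_block₁₂ (L := L) hΘ0 (r t x) (deriv (r t) x) (1 / χ n) rfl hZx
      (sub_add_cancel _ _).symm hFV] at e12
    exact sub_eq_zero.1 e12

end FlowBlocks

/-! ### Gauge transformations by `U(n-2)` -/

theorem eq_of_mHasDeriv_zero {α β E : Type*} [NormedAddCommGroup E] [NormedSpace ℝ E]
    {F : ℝ → Matrix α β E} {X : Set ℝ} (hX' : X.OrdConnected)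
    (h : ∀ x ∈ X, MHasDeriv F 0 x) {x y : ℝ} (hx : x ∈ X) (hy : y ∈ X) : F x = F y := by
  ext i j
  exact eq_of_hasDerivWithinAt_zero (f := fun s => F s i j) hX'.convex
    (fun z hz => (h z hz i j).hasDerivWithinAt) hx hy

theorem hC_fromBlocks_mul_hC_fromBlocks_eq_zero (A : Matrix (Fin (n - 2)) (Fin (n - 2)) ℂ) :
    hC (Matrix.fromBlocks (0 : Matrix (Fin 2) (Fin 2) ℂ) 0 0 A) *
      hC (Matrix.fromBlocks (1 : Matrix (Fin 2) (Fin 2) ℂ) 0 0 0) = 0 := by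
  rw [hC_mul_hC, Matrix.fromBlocks_multiply]
  simp

/-- The linear equation `k_t = -Φ k` with `Φ` in `u(n-2)` has a smooth solution in `U(n-2)`. The
orthogonal solution of the transposed equation commutes with `J₀` and fixes the first block, since
`Φ` commutes with the one and annihilates the other. -/
theorem exists_gauge {T : Set ℝ} (hT : IsOpen T) (hT' : T.OrdConnected)
    {Φ : ℝ → Matrix (Fin (n - 2)) (Fin (n - 2)) ℂ} (hΦ : MSmooth Φ T)
    (hs : ∀ t ∈ T, (Φ t)ᴴ = -Φ t) {t₀ : ℝ} (ht₀ : t₀ ∈ T) :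
    ∃ (k : ℝ → SO n) (K : ℝ → Matrix (Fin (n - 2)) (Fin (n - 2)) ℂ),
      MSmooth (fun t => (k t : Mat n)) T ∧ MSmooth K T ∧
      ∀ t ∈ T, (k t : Mat n) = hC (Matrix.fromBlocks 1 0 0 (K t)) ∧
        MHasDeriv (fun s => (k s : Mat n))
          (-(hC (Matrix.fromBlocks 0 0 0 (Φ t)) * (k t : Mat n))) t := by
  set Q : ℝ → Mat n := fun t => hC (Matrix.fromBlocks 0 0 0 (Φ t)) with hQ
  have hQs : MSmooth Q T :=
    ((MSmooth.const _).fromBlocks (MSmooth.const _) (MSmooth.const _) hΦ).hC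
  have hQskew : ∀ t ∈ T, (Q t)ᵀ = -Q t := by
    intro t ht
    rw [hQ]
    simp only
    rw [hC_transpose, Matrix.fromBlocks_conjTranspose, hs t ht, ← hC_neg, Matrix.fromBlocks_neg]
    simp
  -- A connection that depends on `t` only and has no component in the direction of `x` is flat.
  obtain ⟨g, hg0, hg, hgQ⟩ := exists_frame_of_flat (n := n) (P := fun _ _ => 0)
    (Q := fun t _ => Q t) hT hT' isOpen_univ Set.ordConnected_univ
    (fun i j => contDiffOn_const)
    (MSmooth.comp hQs (φ := Prod.fst) contDiff_fst.contDiffOn fun p hp => hp.1)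
    (fun t ht x hx => by simp) (fun t ht x hx => hQskew t ht)
    (fun t ht x hx => by
      rw [(MHasDeriv.const (0 : Mat n)).mderiv, (MHasDeriv.const (Q t)).mderiv, Ring.lie_def]
      simp) ht₀ (Set.mem_univ (0 : ℝ))
  set h : ℝ → SO n := fun t => g t 0 with hh
  have hhs : MSmooth (fun t => (h t : Mat n)) T := hg.left (Set.mem_univ (0 : ℝ))
  have hder : ∀ t ∈ T, MHasDeriv (fun s => (h s : Mat n)) ((h t : Mat n) * Q t) t := by
    intro t ht
    have h1 := (hhs.mHasDeriv hT ht).frame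
    rwa [(hgQ t ht 0 (Set.mem_univ _)).2] at h1
  set E : Mat n := hC (Matrix.fromBlocks 1 0 0 0) with hE
  have hET : Eᵀ = E := by
    rw [hE, hC_transpose, Matrix.fromBlocks_conjTranspose]; simp
  -- The solution fixes the first block.
  have hfix : ∀ t ∈ T, (h t : Mat n) * E = E := by
    intro t ht
    have h1 : ∀ s ∈ T, MHasDeriv (fun s => (h s : Mat n) * E) 0 s := by
      intro s hs'
      refine ((hder s hs').mul (MHasDeriv.const E)).congr_deriv ?_
      rw [mul_assoc, hQ, hE]
      simp only
      rw [hC_fromBlocks_mul_hC_fromBlocks_eq_zero]; simp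
    rw [eq_of_mHasDeriv_zero hT' h1 ht ht₀, hh]
    simp only
    rw [hg0]
    exact one_mul E
  have hfix' : ∀ t ∈ T, E * (h t : Mat n) = E := by
    intro t ht
    have h1 := congrArg Matrix.transpose (hfix t ht)
    rw [Matrix.transpose_mul, hET] at h1
    rw [← h1, mul_assoc, transpose_mul_self, mul_one, h1]
  -- The solution commutes with `J₀`.
  have hcomm : ∀ t ∈ T, (h t : Mat n) * J₀ n * (h t : Mat n)ᵀ = J₀ n := by
    intro t ht
    have h1 : ∀ s ∈ T, MHasDeriv (fun s => (h s : Mat n) * J₀ n * (h s : Mat n)ᵀ) 0 s := by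
      intro s hs'
      refine (((hder s hs').mul (MHasDeriv.const (J₀ n))).mul
        (hder s hs').transpose).congr_deriv ?_
      rw [Matrix.transpose_mul, hQskew s hs']
      have h2 : Q s * J₀ n = J₀ n * Q s := hC_mul_J₀ _
      rw [mul_zero, add_zero, mul_assoc (h s : Mat n) (Q s), h2]
      simp only [mul_assoc, neg_mul, mul_neg]
      abel
    rw [eq_of_mHasDeriv_zero hT' h1 ht ht₀, hh]
    simp only
    rw [hg0]
    show (1 : Mat n) * J₀ n * (1 : Mat n)ᵀ = J₀ n
    rw [one_mul, Matrix.transpose_one, mul_one]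
  have hhC : ∀ t ∈ T, ∃ B, (h t : Mat n) = hC (Matrix.fromBlocks 1 0 0 B) := by
    intro t ht
    have h1 : (h t : Mat n) * J₀ n = J₀ n * (h t : Mat n) := by
      conv_rhs => rw [← hcomm t ht]
      rw [mul_assoc _ _ (h t : Mat n), transpose_mul_self, mul_one]
    have h2 := half_sub_J₀_mul_mul_J₀ (h t : Mat n)
    rw [← h1, mul_assoc, J₀_mul_self, mul_neg, mul_one, sub_neg_eq_add, ← two_smul ℝ, smul_smul,
      one_div, inv_mul_cancel₀ two_ne_zero, one_smul] at h2
    have h3 := hfix t ht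
    have h4 := hfix' t ht
    generalize hPart (h t : Mat n) = H at h2
    rw [h2, hE, hC_mul_hC, ← Matrix.fromBlocks_toBlocks H, Matrix.fromBlocks_multiply] at h3 h4
    have h5 := hC_injective h3
    have h6 := hC_injective h4
    simp only [mul_one, mul_zero, Matrix.mul_one, Matrix.one_mul, Matrix.zero_mul,
      Matrix.mul_zero, add_zero, Matrix.fromBlocks_inj] at h5 h6
    refine ⟨H.toBlocks₂₂, ?_⟩
    conv_lhs => rw [h2, ← Matrix.fromBlocks_toBlocks H]
    rw [h5.1, h5.2.2.1, h6.2.1]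
  choose! B hB using hhC
  have hkB : ∀ t ∈ T, ((h t)⁻¹ : SO n) = (hC (Matrix.fromBlocks 1 0 0 (B t)ᴴ) : Mat n) := by
    intro t ht
    rw [coe_inv, hB t ht, hC_transpose, Matrix.fromBlocks_conjTranspose]
    simp
  have hks : MSmooth (fun t => ((h t)⁻¹ : SO n) : ℝ → Mat n) T :=
    hhs.transpose.congr fun t _ => coe_inv (h t)
  refine ⟨fun t => (h t)⁻¹, fun t => (B t)ᴴ, hks, ?_, fun t ht => ⟨hkB t ht, ?_⟩⟩
  · refine (hks.hPart.submatrix Sum.inr Sum.inr).congr fun t ht => ?_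
    rw [hkB t ht, hPart_hC]; rfl
  · have h1 : (fun s => ((h s)⁻¹ : SO n) : ℝ → Mat n) = fun s => (h s : Mat n)ᵀ :=
      funext fun s => coe_inv (h s)
    rw [h1]
    refine (hder t ht).transpose.congr_deriv ?_
    rw [Matrix.transpose_mul, hQskew t ht, neg_mul, coe_inv]

/-- The complex linear part of a gauge transformed matrix. -/
theorem hPart_conj (κ : Matrix (Idx n) (Idx n) ℂ) (Y : Mat n) :
    hPart ((hC κ)ᵀ * Y * hC κ) = κᴴ * hPart Y * κ := by
  conv_lhs => rw [← hC_hPart_add_mC_mPart Y]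
  rw [hC_transpose, mul_add, add_mul, hC_mul_hC, hC_mul_hC, hC_mul_mC, mC_mul_hC]
  simp

/-- The complex antilinear part of a gauge transformed matrix. -/
theorem mPart_conj (κ : Matrix (Idx n) (Idx n) ℂ) (Y : Mat n) :
    mPart ((hC κ)ᵀ * Y * hC κ) = κᵀ * mPart Y * κ := by
  conv_lhs => rw [← hC_hPart_add_mC_mPart Y]
  rw [hC_transpose, mul_add, add_mul, hC_mul_hC, hC_mul_hC, hC_mul_mC, mC_mul_hC]
  simp

/-- A gauge transformation in `U(n-2)` multiplies the Hasimoto variables `(v₁, v₂)` by `Kᵀ`, and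
leaves `r` unchanged. -/
theorem uBlock_conj (r : ℝ) (V : Matrix (Fin (n - 2)) (Fin 2) ℂ)
    (K : Matrix (Fin (n - 2)) (Fin (n - 2)) ℂ) :
    (Matrix.fromBlocks 1 0 0 K)ᴴ * uBlock r V * Matrix.fromBlocks 1 0 0 K = uBlock r (Kᵀ * V) := by
  rw [Matrix.fromBlocks_conjTranspose, uBlock, Matrix.fromBlocks_multiply,
    Matrix.fromBlocks_multiply, uBlock]
  simp [Matrix.mul_assoc]

theorem mBlock_conj (c : ℂ) (B : Matrix (Fin (n - 2)) (Fin 2) ℂ)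
    (K : Matrix (Fin (n - 2)) (Fin (n - 2)) ℂ) :
    (Matrix.fromBlocks 1 0 0 K)ᵀ * mBlock c B 0 * Matrix.fromBlocks 1 0 0 K =
      mBlock c (Kᵀ * B) 0 := by
  rw [Matrix.fromBlocks_transpose, mBlock, Matrix.fromBlocks_multiply,
    Matrix.fromBlocks_multiply, mBlock]
  simp

section Gauge

variable {T X : Set ℝ} {γ : ℝ → ℝ → M n} {g : ℝ → ℝ → SO n} {r : ℝ → ℝ → ℝ}
  {V : ℝ → ℝ → Matrix (Fin (n - 2)) (Fin 2) ℂ} {k : ℝ → SO n}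
  {K : ℝ → Matrix (Fin (n - 2)) (Fin (n - 2)) ℂ}

theorem IsFlowFrame.maurerCartan_mul_right (hX : IsOpen X) (h : IsFlowFrame T X γ g) {t x : ℝ}
    (ht : t ∈ T) (hx : x ∈ X) : maurerCartan (fun y => g t y * k t) x =
      (k t : Mat n)ᵀ * maurerCartan (g t) x * (k t : Mat n) := by
  refine maurerCartan_eq ?_
  have h1 := ((h.smooth.right ht).mHasDeriv hX hx).frame.mul (MHasDeriv.const (k t : Mat n))
  refine MHasDeriv.congr_deriv h1 ?_
  show _ = (g t x : Mat n) * (k t : Mat n) * ((k t : Mat n)ᵀ * _ * _)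
  rw [mul_assoc (k t : Mat n)ᵀ, mul_assoc (g t x : Mat n) (k t : Mat n),
    ← mul_assoc (k t : Mat n) (k t : Mat n)ᵀ, mul_transpose_self, one_mul]
  simp [mul_assoc]

/-- The inhomogeneous term `k⁻¹k_t` of the gauge transformation subtracts `Φ` from `g⁻¹g_t`. -/
theorem IsFlowFrame.maurerCartan_mul_left (hT : IsOpen T) (h : IsFlowFrame T X γ g) {t x : ℝ}
    (ht : t ∈ T) (hx : x ∈ X) {Φ : Mat n}
    (hk : MHasDeriv (fun s => (k s : Mat n)) (-(Φ * (k t : Mat n))) t) :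
    maurerCartan (fun s => g s x * k s) t =
      (k t : Mat n)ᵀ * (maurerCartan (fun s => g s x) t - Φ) * (k t : Mat n) := by
  refine maurerCartan_eq ?_
  have h1 := (h.mHasDeriv_left hT ht hx).frame.mul hk
  refine MHasDeriv.congr_deriv h1 ?_
  show _ = (g t x : Mat n) * (k t : Mat n) * ((k t : Mat n)ᵀ * _ * _)
  rw [mul_assoc (k t : Mat n)ᵀ, mul_assoc (g t x : Mat n) (k t : Mat n),
    ← mul_assoc (k t : Mat n) (k t : Mat n)ᵀ, mul_transpose_self, one_mul, sub_mul]
  simp [mul_assoc, mul_add, sub_eq_add_neg]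

/-- Parallel frames remain parallel under a gauge transformation in `U(n-2)`. -/
theorem IsFlowFrame.mul_gauge (hn : 3 ≤ n) (hX : IsOpen X) (h : IsFlowFrame T X γ g)
    (hrV : IsHasimoto T X g r V) (hks : MSmooth (fun t => (k t : Mat n)) T)
    (hk : ∀ t ∈ T, (k t : Mat n) = hC (Matrix.fromBlocks 1 0 0 (K t))) :
    IsFlowFrame T X γ (fun t x => g t x * k t) ∧
      IsHasimoto T X (fun t x => g t x * k t) r (fun t x => (K t)ᵀ * V t x) := by
  have hU : ∀ t ∈ T, ∀ x ∈ X, hPart (maurerCartan (fun y => g t y * k t) x) =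
      uBlock (r t x) ((K t)ᵀ * V t x) := fun t ht x hx => by
    rw [h.maurerCartan_mul_right hX ht hx, hk t ht, hPart_conj, hrV.hPart_maurerCartan hn ht hx,
      uBlock_conj]
  have hsm : SmoothOn₂ (fun t x => ((g t x * k t : SO n) : Mat n)) T X :=
    MSmooth.mul (F := fun p : ℝ × ℝ => (g p.1 p.2 : Mat n)) h.smooth
      (MSmooth.comp hks (φ := Prod.fst) contDiff_fst.contDiffOn fun p hp => hp.1)
  have hlift : ∀ t ∈ T, ∀ x ∈ X, γ t x = QuotientGroup.mk (g t x * k t) := fun t ht x hx => by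
    rw [(h.parallel t ht).lifts x hx]
    refine (QuotientGroup.mk_mul_of_mem (g t x)
      (show k t ∈ U n from ⟨_, _, hk t ht⟩)).symm
  refine ⟨⟨hsm, fun t ht => ⟨hsm.right ht, hlift t ht, fun x hx => ?_, fun x hx => ?_⟩⟩,
    (isHasimoto_iff hn).2 hU⟩
  · rw [coframe_velocity (g := fun y => g t y * k t) ((hsm.right ht).mHasDeriv hX hx)
      (Filter.eventually_of_mem (hX.mem_nhds hx) (hlift t ht)), h.maurerCartan_mul_right hX ht hx,
      hk t ht, mPart_conj, (h.parallel t ht).mPart_maurerCartan hX hx, mul_smul_comm,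
      smul_mul_assoc, ee_eq]
    have h1 : eBlock n = mBlock 1 0 0 := by simp [eBlock, mBlock]
    rw [h1, mBlock_conj, Matrix.mul_zero]
  · rw [connection_eq, hU t ht x hx]
    exact (mem_hPerp_iff hn).2 ⟨_, _, rfl⟩

theorem IsFlowFrame.isCurveFlow_iff_mPart (hn : 3 ≤ n) (hT : IsOpen T) (hX : IsOpen X)
    (h : IsFlowFrame T X γ g) (hrV : IsHasimoto T X g r V) (a : ℝ) (b : ℂ) :
    IsCurveFlow (suGen a b) T X γ g ↔ ∀ t ∈ T, ∀ x ∈ X, mPart (maurerCartan (fun s => g s x) t) =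
      mBlock 0 ((1 / √(χ n)) • (V t x * suGen a b)) 0 := by
  rw [← h.isCurveFlow_iff hn hT hX hrV]
  refine forall₄_congr fun t ht x hx => ?_
  rw [h.coframe_velocity_left hT ht hx, smul_mPerp_mul_eq, mC_injective.eq_iff]

/-- Along a curve flow, the `u(n-2)`-component of `g⁻¹g_t` differs from the transpose of `V J Vᴴ`
by a function of `t`, which a gauge transformation removes. -/
theorem IsFlowFrame.exists_gauge_isNLSSolution (hn : 3 ≤ n) (hT : IsOpen T)
    (hT' : T.OrdConnected) (hX : IsOpen X) (hX' : X.OrdConnected) (h : IsFlowFrame T X γ g)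
    {a : ℝ} {b : ℂ} (hflow : IsCurveFlow (suGen a b) T X γ g) {t₀ x₀ : ℝ} (ht₀ : t₀ ∈ T)
    (hx₀ : x₀ ∈ X) :
    ∃ k : ℝ → SO n,
      SmoothOn (fun t => (k t : Mat n)) T ∧ (∀ t ∈ T, InUnitaryFactor (k t)) ∧
      IsFlowFrame T X γ (fun t x => g t x * k t) ∧
      IsCurveFlow (suGen a b) T X γ (fun t x => g t x * k t) ∧
      ∃ (r : ℝ → ℝ → ℝ) (V : ℝ → ℝ → Matrix (Fin (n - 2)) (Fin 2) ℂ),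
        IsHasimoto T X (fun t x => g t x * k t) r V ∧
        IsNLSSolution (suGen a b) T X r V := by
  obtain ⟨r, V, hr, hV, hrV⟩ := h.exists_isHasimoto hn hT hX
  rw [h.isCurveFlow_iff_mPart hn hT hX hrV] at hflow
  set J := suGen a b with hJdef
  have hJ : Jᴴ = -J := suGen_conjTranspose a b
  have hVm : MSmooth (fun p : ℝ × ℝ => V p.1 p.2) (T ×ˢ X) := hV
  set w : ℝ → ℝ → Matrix (Idx n) (Idx n) ℂ := fun t x => hPart (maurerCartan (fun s => g s x) t)
    with hw
  have hws : SmoothOn₂ w T X := MSmooth.hPart (h.smooth.maurerCartan_left hT hX)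
  set D : ℝ → ℝ → Matrix (Fin (n - 2)) (Fin (n - 2)) ℂ := fun t x =>
    (w t x).toBlocks₂₂ - (V t x * J * (V t x)ᴴ)ᵀ with hD
  have hDs : SmoothOn₂ D T X :=
    (MSmooth.submatrix (F := fun p : ℝ × ℝ => w p.1 p.2) Sum.inr Sum.inr hws).sub
      ((hVm.mul (MSmooth.const J)).mul hVm.conjTranspose).transpose
  have hDx : ∀ t ∈ T, ∀ x ∈ X, D t x = D t x₀ := by
    intro t ht x hx
    refine eq_of_mHasDeriv_zero hX' (fun y hy => ?_) hx hx₀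
    have hVx := (hV.right ht).mHasDeriv hX hy
    have h1 := (h.curvature_blocks hn hT hX hr hV hrV hJ hflow hw rfl ht hy rfl).2.2
    refine (h1.sub ((hVx.mul (MHasDeriv.const J)).mul hVx.conjTranspose).transpose).congr_deriv ?_
    rw [Matrix.mul_zero, add_zero, sub_self]
  have hDskew : ∀ t ∈ T, (D t x₀)ᴴ = -D t x₀ := by
    intro t ht
    obtain ⟨-, hF, -, -⟩ := h.exists_hPart_eq_wBlock hn hT hX hV hrV hflow ht hx₀ (w := w t x₀) rfl
    rw [hD]
    simp only
    rw [Matrix.conjTranspose_sub, hF, transpose_mul_mul_conjTranspose_skew hJ]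
    abel
  -- With `k_t = -D k`, the gauge transformation subtracts `D` from the lower right block.
  obtain ⟨k, K, hks, hKs, hk⟩ := exists_gauge hT hT' (hDs.left hx₀) hDskew ht₀
  obtain ⟨hfr, hha⟩ := h.mul_gauge hn hX hrV hks fun t ht => (hk t ht).1
  have hMC : ∀ t ∈ T, ∀ x ∈ X, maurerCartan (fun s => g s x * k s) t = _ := fun t ht x hx =>
    h.maurerCartan_mul_left hT ht hx (hk t ht).2
  have hV' : SmoothOn₂ (fun t x => (K t)ᵀ * V t x) T X :=
    (MSmooth.comp hKs (φ := Prod.fst) contDiff_fst.contDiffOn fun p hp => hp.1).transpose.mul hVm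
  have hflow' : ∀ t ∈ T, ∀ x ∈ X, mPart (maurerCartan (fun s => g s x * k s) t) =
      mBlock 0 ((1 / √(χ n)) • ((K t)ᵀ * V t x * J)) 0 := fun t ht x hx => by
    rw [hMC t ht x hx, (hk t ht).1, mPart_conj, mPart_sub, mPart_hC, sub_zero, hflow t ht x hx,
      mBlock_conj, Matrix.mul_smul, Matrix.mul_assoc]
  refine ⟨k, hks, fun t ht => ?_, hfr, (hfr.isCurveFlow_iff_mPart hn hT hX hha a b).2 hflow',
    r, _, hha, hfr.isNLSSolution hn hT hX hr hV' hha hJ hflow' fun t ht x hx => ?_⟩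
  · refine ⟨(K t).map Complex.re, (K t).map Complex.im, ?_⟩
    rw [(hk t ht).1, hC, Matrix.fromBlocks_map, Matrix.fromBlocks_map]
    congr 2
    · ext i j; simp [Matrix.one_apply]; split_ifs <;> simp
    · ext i j; simp [Matrix.one_apply]; split_ifs <;> simp
  · have h1 : (w t x).toBlocks₂₂ - D t x₀ = (V t x * J * (V t x)ᴴ)ᵀ := by
      rw [← hDx t ht x hx, hD]
      simp only
      abel
    rw [hMC t ht x hx, (hk t ht).1, hPart_conj, hPart_sub, hPart_hC]
    show ((Matrix.fromBlocks 1 0 0 (K t))ᴴ * (w t x - Matrix.fromBlocks 0 0 0 (D t x₀)) *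
      Matrix.fromBlocks 1 0 0 (K t)).toBlocks₂₂ = _
    rw [← Matrix.fromBlocks_toBlocks (w t x), sub_eq_add_neg, Matrix.fromBlocks_neg,
      Matrix.fromBlocks_add, ← sub_eq_add_neg (w t x).toBlocks₂₂, h1,
      Matrix.fromBlocks_conjTranspose, Matrix.fromBlocks_multiply, Matrix.fromBlocks_multiply,
      Matrix.toBlocks_fromBlocks₂₂]
    simp [Matrix.mul_assoc]

end Gauge

/-! ### The curve flow of a solution of the NLS system -/

/-- The connection with the components `u`, `e` in the direction of `x` and the components of the
curve flow in the direction of `t` is flat if the NLS system holds. -/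
theorem flat_of_nls (hn : 3 ≤ n) {J K Θ Θx Lx : Matrix (Fin 2) (Fin 2) ℂ} (hJ : Jᴴ = -J)
    (hJ0 : J.trace = 0) {r rt rx : ℝ} {V Vx Vxx Vt Z : Matrix (Fin (n - 2)) (Fin 2) ℂ}
    (hΘ : Θᴴ = -Θ) (hΘ0 : Θ.trace = 0)
    (hK : K = Θ + (1 / 2 : ℂ) • (J * (Vᴴ * V) + Vᴴ * V * J))
    (hZ : Z = Vx * J + (2 * Complex.I * r) • (V * J)) (hLx : Lx = Vxᴴ * V + Vᴴ * Vx)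
    (e1 : Θx = (2 * Complex.I * r) • ⁅Vᴴ * V, J⁆ + (1 / 2 : ℂ) • ⁅Vᴴ * Vx - Vxᴴ * V, J⁆)
    (e2 : (rt : ℂ) = Complex.I / 2 * (Lx * J).trace)
    (e3 : Vt - ((1 / χ n : ℝ) : ℂ) • (V * J) = Vxx * J
         + (2 * Complex.I * (rx : ℂ) + 4 * (r : ℂ) ^ 2) • (V * J)
         + V * ((J * (Vᴴ * V) + Vᴴ * V * J) + (1 / 2 : ℂ) • ⁅J, Vᴴ * V⁆ - (J * (Vᴴ * V)).trace • 1)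
         + V * Θ) {s : ℝ} (hs : s = 1 / √(χ n)) :
    hC (uBlock rt Vt) -
      (hC (wBlock (Θx + (1 / 2 : ℂ) • (J * Lx + Lx * J))
        (Vxx * J + ((2 * Complex.I * rx) • (V * J) + (2 * Complex.I * r) • (Vx * J)))
        (Vx * J * Vᴴ + V * J * Vxᴴ)ᵀ) + mC (mBlock 0 (s • (Vx * J)) 0)) +
      ⁅hC (wBlock K Z (V * J * Vᴴ)ᵀ) + mC (mBlock 0 (s • (V * J)) 0),
        hC (uBlock r V) + mC (s • eBlock n)⁆ = 0 := by
  subst hs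
  have hKs : Kᴴ = -K := by
    rw [hK, Matrix.conjTranspose_add, hΘ, half_anticommutator_skew hJ, neg_add]
  have hKtr : K.trace = (Vᴴ * (V * J)).trace := by
    rw [hK, Matrix.trace_add, hΘ0, trace_half_anticommutator, zero_add]
  have hFV : ((V * J * Vᴴ)ᵀ)ᵀ * V = V * J * (Vᴴ * V) := by
    rw [Matrix.transpose_transpose, Matrix.mul_assoc]
  have hh := curvature_h_eq hn hKs (Z := Z) (V := V) (B := V * J)
    (transpose_mul_mul_conjTranspose_skew hJ V) r rt Vt
    (Θx + (1 / 2 : ℂ) • (J * Lx + Lx * J))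
    (Vxx * J + ((2 * Complex.I * rx) • (V * J) + (2 * Complex.I * r) • (Vx * J)))
    (Vx * J * Vᴴ + V * J * Vxᴴ)ᵀ rfl rfl
  rw [nls_block₁₂ hΘ0 r rx (1 / χ n) hZ rfl hK hFV, sub_eq_zero.2 e3,
    nls_block₁₁ hJ r rt hZ rfl rfl hLx rfl, sub_eq_zero.2 e1.symm,
    cj_mul_transpose_sub hJ r hZ, sub_self] at hh
  have hrt : -2 * Complex.I * (rt : ℂ) - (Lx * J).trace = 0 := by
    rw [e2]; linear_combination -(Lx * J).trace * Complex.I_mul_I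
  rw [hrt] at hh
  have hm := curvature_m_eq_zero hJ0 hKs hKtr r (1 / √(χ n)) (V * J * Vᴴ)ᵀ hZ
  rw [← hC_hPart_add_mC_mPart (_ + _)]
  rw [hPart_add, mPart_add, hPart_lie, mPart_lie]
  simp only [hPart_add, hPart_sub, mPart_add, mPart_sub, hPart_hC, hPart_mC, mPart_hC, mPart_mC,
    add_zero, zero_add]
  rw [hh, hm]
  simp

/-- Integration of the flat connection of a solution of the NLS system. -/
theorem exists_flow_of_isNLSSolution (hn : 3 ≤ n) {T X : Set ℝ} (hT : IsOpen T)
    (hT' : T.OrdConnected) (hX : IsOpen X) (hX' : X.OrdConnected) {a : ℝ} {b : ℂ}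
    {r : ℝ → ℝ → ℝ} {V : ℝ → ℝ → Matrix (Fin (n - 2)) (Fin 2) ℂ}
    (h : IsNLSSolution (suGen a b) T X r V) {t₀ x₀ : ℝ} (ht₀ : t₀ ∈ T) (hx₀ : x₀ ∈ X) :
    ∃ (γ : ℝ → ℝ → M n) (g : ℝ → ℝ → SO n),
      IsFlowFrame T X γ g ∧ IsHasimoto T X g r V ∧ IsCurveFlow (suGen a b) T X γ g := by
  obtain ⟨hr, hV, Θ, hΘ, hsys⟩ := h
  set J := suGen a b with hJdef
  have hJ : Jᴴ = -J := suGen_conjTranspose a b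
  have hJ0 : J.trace = 0 := suGen_trace a b
  set s := 1 / √(χ n) with hs
  have hVm : MSmooth (fun p : ℝ × ℝ => V p.1 p.2) (T ×ˢ X) := hV
  have hΘm : MSmooth (fun p : ℝ × ℝ => Θ p.1 p.2) (T ×ˢ X) := hΘ
  have hVxm : MSmooth (fun p : ℝ × ℝ => mderiv (V p.1) p.2) (T ×ˢ X) := hV.mderiv_right hT hX
  set K : ℝ → ℝ → Matrix (Fin 2) (Fin 2) ℂ := fun t x =>
    Θ t x + (1 / 2 : ℂ) • (J * ((V t x)ᴴ * V t x) + (V t x)ᴴ * V t x * J) with hKdef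
  set Z : ℝ → ℝ → Matrix (Fin (n - 2)) (Fin 2) ℂ := fun t x =>
    mderiv (V t) x * J + (2 * Complex.I * r t x) • (V t x * J) with hZdef
  set P : ℝ → ℝ → Mat n := fun t x => hC (uBlock (r t x) (V t x)) + mC (s • eBlock n) with hPdef
  set Q : ℝ → ℝ → Mat n := fun t x => hC (wBlock (K t x) (Z t x) (V t x * J * (V t x)ᴴ)ᵀ) +
    mC (mBlock 0 (s • (V t x * J)) 0) with hQdef
  have hrc : ContDiffOn ℝ ∞ (fun p : ℝ × ℝ => (r p.1 p.2 : ℂ)) (T ×ˢ X) :=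
    Complex.ofRealCLM.contDiff.comp_contDiffOn hr
  have hKm : MSmooth (fun p : ℝ × ℝ => K p.1 p.2) (T ×ˢ X) :=
    hΘm.add ((((MSmooth.const J).mul (hVm.conjTranspose.mul hVm)).add
      ((hVm.conjTranspose.mul hVm).mul (MSmooth.const J))).const_smul (1 / 2 : ℂ))
  have hZm : MSmooth (fun p : ℝ × ℝ => Z p.1 p.2) (T ×ˢ X) :=
    (hVxm.mul (MSmooth.const J)).add
      (MSmooth.smul (contDiffOn_const.mul hrc) (hVm.mul (MSmooth.const J)))
  have hPm : SmoothOn₂ P T X := by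
    refine MSmooth.add (F := fun p : ℝ × ℝ => hC (uBlock (r p.1 p.2) (V p.1 p.2)))
      (MSmooth.hC ?_) (MSmooth.const _)
    exact MSmooth.fromBlocks (MSmooth.smul (contDiffOn_const.mul hrc) (MSmooth.const 1))
      ((MSmooth.const eps).mul hVm.transpose) (hVm.cj.mul (MSmooth.const eps)) (MSmooth.const 0)
  have hQm : SmoothOn₂ Q T X := by
    refine MSmooth.add (F := fun p : ℝ × ℝ => hC (wBlock (K p.1 p.2) (Z p.1 p.2)
      (V p.1 p.2 * J * (V p.1 p.2)ᴴ)ᵀ)) (G := fun p : ℝ × ℝ =>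
      mC (mBlock 0 (s • (V p.1 p.2 * J)) 0)) (MSmooth.hC ?_) (MSmooth.mC ?_)
    · exact MSmooth.fromBlocks hKm ((MSmooth.const eps).mul hZm.transpose)
        (hZm.cj.mul (MSmooth.const eps))
        ((hVm.mul (MSmooth.const J)).mul hVm.conjTranspose).transpose
    · have hB := (hVm.mul (MSmooth.const J)).const_smul s
      exact MSmooth.fromBlocks (MSmooth.const _) hB.transpose hB.neg (MSmooth.const _)
  have hPskew : ∀ t ∈ T, ∀ x ∈ X, (P t x)ᵀ = -P t x := by
    intro t ht x hx
    have h1 : eBlock n = mBlock 1 0 0 := by simp [eBlock, mBlock]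
    simp only [hPdef]
    rw [Matrix.transpose_add, hC_transpose, mC_transpose, uBlock_conjTranspose,
      Matrix.transpose_smul, h1, mBlock_transpose _ _ (by simp), hC_neg, smul_neg, mC_neg]
    abel
  have hQskew : ∀ t ∈ T, ∀ x ∈ X, (Q t x)ᵀ = -Q t x := by
    intro t ht x hx
    obtain ⟨hΘs, -, -⟩ := hsys t ht x hx
    have hKs : (K t x)ᴴ = -K t x := by
      simp only [hKdef]
      rw [Matrix.conjTranspose_add, hΘs, half_anticommutator_skew hJ, neg_add]
    simp only [hQdef]
    rw [Matrix.transpose_add, hC_transpose, mC_transpose,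
      wBlock_conjTranspose hKs _ (transpose_mul_mul_conjTranspose_skew hJ _),
      mBlock_transpose _ _ (by simp), hC_neg, mC_neg]
    abel
  have hflat : ∀ t ∈ T, ∀ x ∈ X, mderiv (fun s => P s x) t - mderiv (Q t) x +
      ⁅Q t x, P t x⁆ = 0 := by
    intro t ht x hx
    obtain ⟨hΘs, hΘ0, e1, e2, e3⟩ := hsys t ht x hx
    have hVx := (hV.right ht).mHasDeriv hX hx
    have hVxx := (((hV.right ht).mderiv hX)).mHasDeriv hX hx
    have hVt := (hV.left hx).mHasDeriv hT ht
    have hΘx := (hΘ.right ht).mHasDeriv hX hx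
    have hLx := hVx.conjTranspose.mul hVx
    have hrx : HasDerivAt (r t) (deriv (r t) x) x :=
      (hasDerivAt_right_of_differentiableAt
        (differentiableAt_of_contDiffOn_prod hT hX hr ht hx)).differentiableAt.hasDerivAt
    have hrt : HasDerivAt (fun s => r s x) (deriv (fun s => r s x) t) t :=
      (hasDerivAt_left_of_differentiableAt
        (differentiableAt_of_contDiffOn_prod hT hX hr ht hx)).differentiableAt.hasDerivAt
    have hKx := hΘx.add ((((MHasDeriv.const J).mul hLx).add
      (hLx.mul (MHasDeriv.const J))).const_smul (1 / 2 : ℂ))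
    have hZx := (hVxx.mul (MHasDeriv.const J)).add (MHasDeriv.smul
      (hrx.ofReal_comp.const_mul (2 * Complex.I)) (hVx.mul (MHasDeriv.const J)))
    have hFx := ((hVx.mul (MHasDeriv.const J)).mul hVx.conjTranspose).transpose
    have hB := (hVx.mul (MHasDeriv.const J)).const_smul s
    simp only [Matrix.mul_zero, Matrix.zero_mul, add_zero, zero_add] at hKx hZx hFx hB
    have hP' : mderiv (fun s => P s x) t = _ :=
      (((MHasDeriv.uBlock hrt hVt).hC).add (MHasDeriv.const (mC (s • eBlock n)))).mderiv
    have hQ' : mderiv (Q t) x = _ :=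
      (((MHasDeriv.wBlock hKx hZx hFx).hC).add hB.mBlock_zero.mC).mderiv
    rw [hP', hQ', add_zero]
    rw [hLx.mderiv] at e2
    exact flat_of_nls hn hJ hJ0 hΘs hΘ0 rfl rfl rfl e1 e2 e3 rfl
  obtain ⟨g, -, hg, hMC⟩ := exists_frame_of_flat hT hT' hX hX' hPm hQm hPskew hQskew hflat ht₀ hx₀
  have hU : ∀ t ∈ T, ∀ x ∈ X, hPart (maurerCartan (g t) x) = uBlock (r t x) (V t x) :=
    fun t ht x hx => by rw [(hMC t ht x hx).1]; simp [hPdef]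
  have hfr : IsFlowFrame T X (fun t x => QuotientGroup.mk (g t x)) g := by
    refine ⟨hg, fun t ht => ⟨hg.right ht, fun _ _ => rfl, fun x hx => ?_, fun x hx => ?_⟩⟩
    · rw [coframe_velocity ((hg.right ht).mHasDeriv hX hx) (Filter.Eventually.of_forall
        fun _ => rfl), (hMC t ht x hx).1, ee_eq]
      simp [hPdef, hs]
    · rw [connection_eq, hU t ht x hx]
      exact (mem_hPerp_iff hn).2 ⟨_, _, rfl⟩
  have hha : IsHasimoto T X g r V := (isHasimoto_iff hn).2 hU
  refine ⟨_, g, hfr, hha, (hfr.isCurveFlow_iff_mPart hn hT hX hha a b).2 fun t ht x hx => ?_⟩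
  rw [(hMC t ht x hx).2]
  simp only [hQdef, mPart_add, mPart_hC, mPart_mC, zero_add]
  rfl

end SU2CurveFlow

open SU2CurveFlow in
theorem mainTheorem5 (n : ℕ) (hn : 3 ≤ n) (a : ℝ) (b : ℂ) (hab : a ^ 2 + ‖b‖ ^ 2 = 1)
    (T X : Set ℝ) (hT : IsOpen T) (hT' : T.OrdConnected) (hX : IsOpen X) (hX' : X.OrdConnected) :
    -- the structure along a curve that has a parallel frame
    (∀ (c : ℝ → M n) (g : ℝ → SO n), IsParallelFrame X c g →
      (∀ (K : Matrix (Fin 2) (Fin 2) ℂ) (Z : ℝ → Mat n), SmoothOn Z X →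
        SmoothOn (fun x => frameMap (g x) K (Z x)) X) ∧
      ∀ x ∈ X,
        let S := embed (c x)
        let ξ := velocity c x
        let iγ := frameMap (g x) (Complex.I • pauli₃)
        let jγ := frameMap (g x) (Complex.I • pauli₂)
        let kγ := frameMap (g x) (Complex.I • pauli₁)
        let Jγ := frameMap (g x) (suGen a b)
        metric S ξ ξ = 1 ∧
        tangentPar S ξ ⊔ tangentPerp S ξ = tangent S ∧
        tangentPar S ξ ⊓ tangentPerp S ξ = ⊥ ∧
        tangentC S ξ ⊔ tangentR S ξ = tangentPerp S ξ ∧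
        tangentC S ξ ⊓ tangentR S ξ = ⊥ ∧
        (∀ Y ∈ tangentC S ξ, ∀ Z ∈ tangentR S ξ, metric S Y Z = 0) ∧
        (∀ Z ∈ tangentC S ξ, adSq S ξ Z = (-(1 / χ n)) • Z) ∧
        (∀ Z ∈ tangentR S ξ, adSq S ξ Z = (-(4 / χ n)) • Z) ∧
        Module.finrank ℝ (tangentC S ξ) = 4 * (n - 2) ∧
        Module.finrank ℝ (tangentR S ξ) = 1 ∧
        IsDegenerateQuaternionic (tangentC S ξ) (tangentR S ξ) (tangentPar S ξ) iγ jγ kγ ∧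
        (∀ Z ∈ tangent S,
          iγ (adSq S ξ Z) = adSq S ξ (iγ Z) ∧
          jγ (adSq S ξ Z) = adSq S ξ (jγ Z) ∧
          kγ (adSq S ξ Z) = adSq S ξ (kγ Z)) ∧
        Jγ = a • iγ + (-b.re) • jγ + b.im • kγ ∧
        (∀ Z ∈ tangentC S ξ, Jγ (Jγ Z) = -Z)) ∧
    -- the flow equation at one time preserves the local arclength to first order
    (∀ (γ : ℝ → ℝ → M n) (t₀ : ℝ) (g : ℝ → SO n), t₀ ∈ T →
      SmoothOn₂ (fun t x => embed (γ t x)) T X → IsParallelFrame X (γ t₀) g →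
      (∀ x ∈ X, velocity (fun s => γ s x) t₀ =
        frameMap (g x) (suGen a b) (normal (γ t₀) x)) →
      ∀ x ∈ X, HasDerivAt
        (fun t => metric (embed (γ t x)) (velocity (γ t) x) (velocity (γ t) x)) 0 t₀) ∧
    -- the flow equation is the flow with generator `(0, (v₁, v₂)J)`
    (∀ (γ : ℝ → ℝ → M n) (g : ℝ → ℝ → SO n) (r : ℝ → ℝ → ℝ)
      (V : ℝ → ℝ → Matrix (Fin (n - 2)) (Fin 2) ℂ),
      IsFlowFrame T X γ g → IsHasimoto T X g r V →
      ((∀ t ∈ T, ∀ x ∈ X, projPerp (coframe (g t x) (velocity (fun s => γ s x) t)) =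
          (1 / √(χ n)) • mPerp 0 (V t x * suGen a b)) →
        ∀ t ∈ T, ∀ x ∈ X, mderiv (fun y =>
          coframe (g t y) (velocity (fun s => γ s y) t) -
            projPerp (coframe (g t y) (velocity (fun s => γ s y) t))) x = 0) ∧
      ((∀ t ∈ T, ∀ x ∈ X, coframe (g t x) (velocity (fun s => γ s x) t) =
          (1 / √(χ n)) • mPerp 0 (V t x * suGen a b)) ↔
        IsCurveFlow (suGen a b) T X γ g)) ∧
    -- from the curve flow to the NLS system
    (∀ (γ : ℝ → ℝ → M n) (g : ℝ → ℝ → SO n),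
      IsFlowFrame T X γ g → IsCurveFlow (suGen a b) T X γ g →
      ∃ k : ℝ → SO n,
        SmoothOn (fun t => (k t : Mat n)) T ∧ (∀ t ∈ T, InUnitaryFactor (k t)) ∧
        IsFlowFrame T X γ (fun t x => g t x * k t) ∧
        IsCurveFlow (suGen a b) T X γ (fun t x => g t x * k t) ∧
        ∃ (r : ℝ → ℝ → ℝ) (V : ℝ → ℝ → Matrix (Fin (n - 2)) (Fin 2) ℂ),
          IsHasimoto T X (fun t x => g t x * k t) r V ∧
          IsNLSSolution (suGen a b) T X r V) ∧
    -- from the NLS system to the curve flow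
    (∀ (r : ℝ → ℝ → ℝ) (V : ℝ → ℝ → Matrix (Fin (n - 2)) (Fin 2) ℂ),
      IsNLSSolution (suGen a b) T X r V →
      ∃ (γ : ℝ → ℝ → M n) (g : ℝ → ℝ → SO n),
        IsFlowFrame T X γ g ∧ IsHasimoto T X g r V ∧
        IsCurveFlow (suGen a b) T X γ g) := by
  have hempty : ¬(T.Nonempty ∧ X.Nonempty) → ∀ t ∈ T, ∀ x ∈ X, False :=
    fun h t ht x hx => h ⟨⟨t, ht⟩, ⟨x, hx⟩⟩
  refine ⟨fun c g h => ⟨fun K Z hZ => h.smoothOn_frameMap K hZ, fun x hx => ?_⟩,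
    fun γ t₀ g ht₀ hγ hg hflow x hx =>
      hasDerivAt_metric_velocity hn a b hT hX ht₀ hγ hg hflow hx,
    fun γ g r V h hrV => ⟨fun hflow t ht x hx => h.mderiv_par_eq_zero hn hT hX hrV
      (suGen_conjTranspose a b) (suGen_trace a b) hflow ht hx,
      h.isCurveFlow_iff hn hT hX hrV a b⟩,
    fun γ g h hflow => ?_, fun r V h => ?_⟩
  · rw [h.velocity_eq hX hx, h.lifts x hx]
    refine ⟨metric_ee _ hn, tangentPar_sup_tangentPerp _ hn, tangentPar_inf_tangentPerp _ hn,
      tangentC_sup_tangentR _ hn, tangentC_inf_tangentR _ hn,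
      fun Y hY Z hZ => metric_tangentC_tangentR _ hn hY hZ, fun Z hZ => ?_, fun Z hZ => ?_,
      finrank_tangentC _ hn, finrank_tangentR _ hn, isDegenerateQuaternionic _ hn,
      fun Z hZ => ?_, ?_, fun Z hZ => ?_⟩
    · obtain ⟨B, rfl⟩ := (mem_tangentC_iff _ hn).1 hZ
      rw [adSq_ee_mPerp _ hn, mul_zero]
    · obtain ⟨r, rfl⟩ := (mem_tangentR_iff _ hn).1 hZ
      rw [adSq_ee_mPerp _ hn, ← map_smul, ← map_smul, mPerp_smul, mPerp_smul, smul_zero, smul_zero]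
      congr 2
      ring
    · rw [I_smul_pauli₁, I_smul_pauli₂, I_smul_pauli₃]
      exact ⟨frameMap_adSq _ hn _ _ hZ, frameMap_adSq _ hn _ _ hZ, frameMap_adSq _ hn _ _ hZ⟩
    · rw [suGen_eq, frameMap_add, frameMap_add, frameMap_smul, frameMap_smul, frameMap_smul]
    · obtain ⟨B, rfl⟩ := (mem_tangentC_iff _ hn).1 hZ
      exact frameMap_suGen_suGen _ hab B
  · by_cases hTX : T.Nonempty ∧ X.Nonempty
    · obtain ⟨⟨t₀, ht₀⟩, ⟨x₀, hx₀⟩⟩ := hTX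
      exact h.exists_gauge_isNLSSolution hn hT hT' hX hX' hflow ht₀ hx₀
    · -- For an empty domain, the frames need no change and any functions solve the system.
      have hk : (fun t x => g t x * (1 : SO n)) = g := by funext t x; exact mul_one _
      obtain ⟨r, V, hr, hV, hrV⟩ := h.exists_isHasimoto hn hT hX
      refine ⟨fun _ => 1, fun i j => contDiffOn_const, fun t _ => ⟨1, 0, ?_⟩, ?_, ?_, r, V, ?_,
        hr, hV, fun _ _ => 0, fun i j => contDiffOn_const,
        fun t ht x hx => (hempty hTX t ht x hx).elim⟩
      · simp [hElt]
      · rw [hk]; exact h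
      · rw [hk]; exact hflow
      · rw [hk]; exact hrV
  · by_cases hTX : T.Nonempty ∧ X.Nonempty
    · obtain ⟨⟨t₀, ht₀⟩, ⟨x₀, hx₀⟩⟩ := hTX
      exact exists_flow_of_isNLSSolution hn hT hT' hX hX' h ht₀ hx₀
    · -- For an empty domain, any family of curves will do.
      exact ⟨fun _ _ => QuotientGroup.mk 1, fun _ _ => 1,
        ⟨fun i j => contDiffOn_const, fun t ht => ⟨fun i j => contDiffOn_const, fun _ _ => rfl,
          fun x hx => (hempty hTX t ht x hx).elim, fun x hx => (hempty hTX t ht x hx).elim⟩⟩,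
        fun t ht x hx => (hempty hTX t ht x hx).elim, fun t ht x hx => (hempty hTX t ht x hx).elim⟩
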